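/- **Setting.** Let $p$ be a prime, $\bar k$ an algebraically closed field of characteristic $p$ (for example the algebraic closure of a perfect field $k$ of characteristic $p$), $\bar W=W(\bar k)$ with Witt vector Frobenius $\sigma$, $K^{u}=\bar W[1/p]$, $n\ge 0$, $\bar A=\bar W[[t_1,\dots,t_n]]$, $\bar A_0=\bar A/p\bar A=\bar k[[t_1,\dots,t_n]]$, and let $\Omega^1=\bigoplus_i \bar A\,dt_i$ be the module of continuous differentials of $\bar A/\bar W$. A *lift of Frobenius* is a ring endomorphism $\phi$ of $\bar A$ with $\phi|_{\bar W}=\sigma$ and $\phi(a)\equiv a^p \bmod p$ for all $a$. An *$F$-crystal* over $\bar A_0$ is a finitely generated free $\bar A$-module $H$ with an integrable connection $\nabla=\sum_i dt_i\otimes D_i$ such that $D_i^m\to 0$ $p$-adically on $H$ for each $i$, and, for every lift of Frobenius $\phi$, an $\bar A$-linear map $F(\phi):\phi^*H\to H$ which is horizontal for $\nabla$ and becomes an isomorphism after inverting $p$, such that for any two lifts $\phi,\psi$ and $x\in H$ $$F(\phi)\phi^*(x)=\sum_{m_1,\dots,m_n\ge0}\ \prod_{j}\frac{(\phi(t_j)-\psi(t_j))^{m_j}}{m_j!}\;F(\psi)\psi^*(D_1^{m_1}\cdots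 D_n^{m_n}x)$$ ($p$-adic convergence; $\phi^*:H\to\phi^*H$, $h\mapsto 1\otimes h$). It is a *unit* $F$-crystal if every $F(\phi)$ is an isomorphism. Put $H_0=H/pH$, fix a lift of Frobenius $\phi$, and let $\mathrm{Fil}_iH_0$ (respectively $\mathrm{Fil}^iH_0$) be the set of classes of those $y\in H$ with $p^iy\in\mathrm{Im}\,F(\phi)$ (respectively $F(\phi)\phi^*y\in p^iH$), for $i\ge 0$, and $\mathrm{Fil}_{-1}H_0=0$. - $H$ is *of level $\le N$* if $\mathrm{Fil}_NH_0=H_0$ and $\mathrm{Fil}^{N+1}H_0=0$. - $H$ is *ordinary* if all $\mathrm{gr}_iH_0=\mathrm{Fil}_iH_0/\mathrm{Fil}_{i-1}H_0$ are free over $\bar A_0$ and $H_0=\mathrm{Fil}_iH_0\oplus\mathrm{Fil}^{i+1}H_0$ for all $i$. The rank of $\mathrm{gr}_iH_0$ is the Hodge number $h^i$. - A *Hodge $F$-crystal* is an $F$-crystal $H$ with a decreasing filtration $H=\mathrm{Fil}^0H\supset\mathrm{Fil}^1H\supset\cdots$ by free $\bar A$-submodules such that $\mathrm{Fil}^iH\otimes_{\bar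 A}\bar A_0=\mathrm{Fil}^iH_0$ inside $H_0$ and $\nabla\mathrm{Fil}^{i}H\subset\Omega^1\otimes\mathrm{Fil}^{i-1}H$ for all $i$. - A Hodge $F$-crystal of level $\le N$ is *divisible* if for some lift of Frobenius $\phi'$ one has $F(\phi')\phi'^*\,\mathrm{Fil}^iH\subset p^iH$ for $i=0,\dots,N$. **Theorem.** Let $N<p$ and let $\bar H$ be a divisible ordinary Hodge $F$-crystal over $\bar A_0$ of level $\le N$. There is a unique increasing filtration $0=U_{-1}\subset U_0\subset U_1\subset\cdots$ of $\bar H$ by sub-$F$-crystals such that, for all $i\ge0$, $U_i\otimes_{\bar A}\bar A_0=\mathrm{Fil}_i\bar H_0$ inside $\bar H_0$ and $U_i/U_{i-1}\simeq V_i(-i)$ for some unit $F$-crystal $V_i$ (where $V_i(-i)$ is $V_i$ with each $F(\psi)$ multiplied by $p^i$). With this filtration, $$\bar H=\bigoplus_{i=0}^N\bar H^i,\qquad \bar H^i=U_i\cap\mathrm{Fil}^i\bar H,$$ and there are an $\bar A$-basis $\{e_{im}\}_{0\le i\le N,\,1\le m\le h^i}$ of $\bar H$ with $e_{im}\in\bar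 H^i$ and a matrix $\mathcal T=(\tau_{ij})_{0\le i,j\le N}$ with entries in $K^{u}[[t_1,\dots,t_n]]$, $\tau_{ij}$ being an $h^i\times h^j$ block, such that: - $\tau_{ij}=0$ for $j<i$, $\tau_{ii}$ is the identity matrix, and for $j\ge i$ the matrix $\tau_{ij}(0)$ of constant terms has entries in $p^{j-i}\bar W$; - the matrix of $\nabla$ with respect to $\{e_{im}\}$ is $\mathcal T^{-1}\cdot d\mathcal T$; - for every lift of Frobenius $\psi$, the matrix of $F(\psi)\psi^*$ with respect to $\{e_{im}\}$ is $\mathcal T^{-1}\cdot P\cdot\psi(\mathcal T)$, where $P=\mathrm{diag}(1,\dots,1,p,\dots,p,\dots,p^N,\dots,p^N)$ with $p^j$ repeated $h^j$ times. Here the columns of a matrix hold the coordinates of the images of the basis vectors, and for $f=\sum_m a_mt^m\in K^{u}[[t_1,\dots,t_n]]$ one sets $\psi(f)=\sum_m\sigma(a_m)\psi(t_1)^{m_1}\cdots\psi(t_n)^{m_n}$; part of the claim is that for the entries of $\mathcal T$ this series converges unconditionally, coefficient by coefficient in the $p$-adic topology of $K^{u}$. -/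

import Mathlib

noncomputable section

namespace OrdinaryCrystal

open MvPowerSeries

universe u v

/-- The ring `A = W(κ)[[t_1, …, t_n]]`. -/
abbrev PS (p : ℕ) [Fact p.Prime] (κ : Type v) [CommRing κ] (n : ℕ) : Type v :=
  MvPowerSeries (Fin n) (WittVector p κ)

/-- The field `W(κ)[1/p] = Frac W(κ)`. -/
abbrev KK (p : ℕ) [Fact p.Prime] (κ : Type v) [CommRing κ] : Type v :=
  FractionRing (WittVector p κ)

/-- The ring `K[[t_1, …, t_n]]`, where `K = W(κ)[1/p]`. -/
abbrev KPS (p : ℕ) [Fact p.Prime] (κ : Type v) [CommRing κ] (n : ℕ) : Type v :=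
  MvPowerSeries (Fin n) (KK p κ)

/-- The ideal `pA`; the ring `A / pA` is `A_0 = κ[[t_1, …, t_n]]`. -/
abbrev pIdeal (p : ℕ) [Fact p.Prime] (κ : Type v) [CommRing κ] (n : ℕ) : Ideal (PS p κ n) :=
  Ideal.span {(p : PS p κ n)}

/-- The ring `A_0 = A / pA = κ[[t_1, …, t_n]]`. -/
abbrev PS0 (p : ℕ) [Fact p.Prime] (κ : Type v) [CommRing κ] (n : ℕ) : Type v :=
  PS p κ n ⧸ pIdeal p κ n

/-- The reduction `H_0 = H ⊗_A A_0 = H / pH`, a module over `A_0`. -/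
abbrev Red (p : ℕ) [Fact p.Prime] (κ : Type v) [CommRing κ] (n : ℕ)
    (H : Type u) [AddCommGroup H] [Module (PS p κ n) H] : Type u :=
  H ⧸ (pIdeal p κ n • (⊤ : Submodule (PS p κ n) H))

/-- The reduction map `H → H_0`, semilinear over `A → A_0`. -/
def red (p : ℕ) [Fact p.Prime] (κ : Type v) [CommRing κ] (n : ℕ)
    (H : Type u) [AddCommGroup H] [Module (PS p κ n) H] :
    H →ₛₗ[Ideal.Quotient.mk (pIdeal p κ n)] Red p κ n H where
  toFun x := Submodule.Quotient.mk x
  map_add' _ _ := rfl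
  map_smul' _ _ := rfl

/-- The element `x ^ m / m!` of `A`, for `x ∈ pA` (it exists and is unique, as `A` is
torsion-free and `p ^ m / m!` is `p`-integral; see `factorial_mul_dpow`). -/
def dpow {p : ℕ} [Fact p.Prime] {κ : Type v} [CommRing κ] {n : ℕ} (x : PS p κ n) (m : ℕ) :
    PS p κ n :=
  open Classical in
  if h : ∃ y : PS p κ n, (m.factorial : PS p κ n) * y = x ^ m then h.choose else 0

theorem factorial_mul_dpow {p : ℕ} [Fact p.Prime] {κ : Type v} [Field κ] [CharP κ p] {n : ℕ}
    {x : PS p κ n} (hx : (p : PS p κ n) ∣ x) (m : ℕ) :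
    (m.factorial : PS p κ n) * dpow x m = x ^ m := by
  have key : ∃ y : PS p κ n, (m.factorial : PS p κ n) * y = x ^ m := by
    obtain ⟨z, rfl⟩ := hx
    have hp : p.Prime := Fact.out
    obtain ⟨c, hc⟩ : p ^ padicValNat p m.factorial ∣ m.factorial := pow_padicValNat_dvd
    have hcp : ¬ p ∣ c := by
      rintro ⟨d, rfl⟩
      have : p ^ (padicValNat p m.factorial + 1) ∣ m.factorial :=
        ⟨d, by rw [pow_succ, mul_assoc]; exact hc⟩
      exact pow_succ_padicValNat_not_dvd (Nat.factorial_ne_zero m) this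
    have hle : padicValNat p m.factorial ≤ m := by
      have h1 := sub_one_mul_padicValNat_factorial (p := p) m
      have h2 : 1 ≤ p - 1 := by have := hp.two_le; omega
      calc padicValNat p m.factorial ≤ (p - 1) * padicValNat p m.factorial :=
            Nat.le_mul_of_pos_left _ h2
        _ ≤ m := by rw [h1]; exact Nat.sub_le _ _
    have hu : IsUnit ((c : WittVector p κ)) := by
      apply WittVector.isUnit_of_coeff_zero_ne_zero
      have : ((c : WittVector p κ)).coeff 0 = (c : κ) :=
        map_natCast (WittVector.constantCoeff (p := p) (R := κ)) c
      rw [this]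
      intro h0
      exact hcp ((CharP.cast_eq_zero_iff κ p c).1 h0)
    have hu' : IsUnit ((c : PS p κ n)) := by
      have := hu.map (MvPowerSeries.C (σ := Fin n) (R := WittVector p κ))
      simpa using this
    obtain ⟨w, hw⟩ := hu'.exists_right_inv
    refine ⟨w * p ^ (m - padicValNat p m.factorial) * z ^ m, ?_⟩
    have e1 : (m.factorial : PS p κ n) = (p : PS p κ n) ^ padicValNat p m.factorial * c := by
      conv_lhs => rw [hc]
      push_cast
      rfl
    have e2 : (p : PS p κ n) ^ padicValNat p m.factorial *
        (p : PS p κ n) ^ (m - padicValNat p m.factorial) = (p : PS p κ n) ^ m := by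
      rw [← pow_add, Nat.add_sub_cancel' hle]
    calc (m.factorial : PS p κ n) * (w * p ^ (m - padicValNat p m.factorial) * z ^ m)
        = ((p : PS p κ n) ^ padicValNat p m.factorial *
            (p : PS p κ n) ^ (m - padicValNat p m.factorial)) * (c * w) * z ^ m := by
          rw [e1]; ring
      _ = (p * z) ^ m := by rw [e2, hw, mul_pow]; ring
  rw [dpow, dif_pos key]
  exact key.choose_spec

/-- The family `f` is unconditionally summable with sum `s` in the `p`-adic topology of `H`. -/
def HasPadicSum (p : ℕ) {ι : Type*} {H : Type*} [AddCommGroup H] (f : ι → H) (s : H) : Prop :=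
  ∀ r : ℕ, ∃ S₀ : Finset ι, ∀ S : Finset ι, S₀ ⊆ S → ∃ h : H, s - ∑ i ∈ S, f i = p ^ r • h

section Frobenius

variable (p : ℕ) [Fact p.Prime] (κ : Type v) [Field κ] [CharP κ p]

/-- A lift of Frobenius on `A`: a ring endomorphism that restricts to the Witt vector Frobenius
on `W(κ)` and reduces to the `p`-th power map modulo `p`. -/
structure FrobLift (n : ℕ) where
  toRingHom : PS p κ n →+* PS p κ n
  map_C : ∀ w : WittVector p κ, toRingHom (C w) = C (WittVector.frobenius w)
  mod_p : ∀ a : PS p κ n, (p : PS p κ n) ∣ toRingHom a - a ^ p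

/-- An `F`-crystal over `A_0` with underlying `A`-module `H`. The module of (continuous)
differentials `Ω¹_{A/W}` is free on `dt_1, …, dt_n`, so a connection `∇` is given by
its components `D_1, …, D_n`, with `∇ x = ∑ dt_i ⊗ D_i x`. A linear map `F(φ) : φ^*H → H` is given
by the corresponding `φ`-semilinear map `frob φ = F(φ)φ^* : H → H`; the image of `F(φ)` is the
`A`-span of the range of `frob φ`. -/
structure FCrystal (n : ℕ) (H : Type u) [AddCommGroup H] [Module (PS p κ n) H] where
  free : Module.Free (PS p κ n) H
  finite : Module.Finite (PS p κ n) H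
  /-- the components of the connection -/
  D : Fin n → AddMonoid.End H
  leibniz : ∀ (i : Fin n) (a : PS p κ n) (x : H),
    D i (a • x) = pderiv (WittVector p κ) i a • x + a • D i x
  /-- integrability -/
  comm : ∀ i j : Fin n, D i * D j = D j * D i
  /-- `p`-adic topological nilpotence -/
  nilp : ∀ (i : Fin n) (r : ℕ), ∃ M : ℕ, ∀ m ≥ M, ∀ x : H, ∃ y : H, (D i ^ m) x = p ^ r • y
  /-- the `φ`-semilinear map `F(φ)φ^*` -/
  frob : ∀ φ : FrobLift p κ n, H →ₛₗ[φ.toRingHom] H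
  /-- horizontality, in components: `φ` acts on differentials by
  `dt_i ↦ d(φ(t_i)) = ∑_j ∂φ(t_i)/∂t_j dt_j` -/
  horizontal : ∀ (φ : FrobLift p κ n) (j : Fin n) (x : H),
    D j (frob φ x) =
      ∑ i : Fin n, pderiv (WittVector p κ) j (φ.toRingHom (X i)) • frob φ (D i x)
  /-- `F(φ) = F(ψ) ∘ χ(φ,ψ)`, with `χ(φ,ψ)` written out as a Taylor expansion -/
  taylor : ∀ (φ ψ : FrobLift p κ n) (x : H),
    HasPadicSum p
      (fun m : Fin n →₀ ℕ =>
        (∏ j : Fin n, dpow (φ.toRingHom (X j) - ψ.toRingHom (X j)) (m j)) •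
          frob ψ ((List.ofFn fun j : Fin n => D j ^ m j).prod x))
      (frob φ x)
  /-- `F(φ) ⊗ ℚ_p` is an isomorphism. As `φ^*H` and `H` are free of the same finite rank, this
  says that the cokernel of `F(φ)` is killed by a power of `p`. -/
  isogeny : ∀ φ : FrobLift p κ n, ∃ m : ℕ, ∀ x : H,
    p ^ m • x ∈ Submodule.span (PS p κ n) (Set.range (frob φ))

namespace FCrystal

variable {p κ} {n : ℕ} {H : Type u} [AddCommGroup H] [Module (PS p κ n) H]
  (Cr : FCrystal p κ n H)

/-- The image of the linear map `F(φ) : φ^*H → H`. -/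
def imF (φ : FrobLift p κ n) : Submodule (PS p κ n) H :=
  Submodule.span (PS p κ n) (Set.range (Cr.frob φ))

/-- A unit `F`-crystal: `F(φ)` is an isomorphism (equivalently surjective, since `φ^*H` and `H` are
free of the same finite rank). -/
def IsUnitCrystal : Prop := ∀ φ : FrobLift p κ n, Cr.imF φ = ⊤

/-- The step `Fil_i H_0` of the conjugate filtration: the classes of the `y ∈ H` with
`p ^ i y ∈ Im F(φ)`. -/
def conjFil (φ : FrobLift p κ n) (i : ℕ) : Submodule (PS0 p κ n) (Red p κ n H) :=
  Submodule.map (red p κ n H)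
    (Submodule.comap (LinearMap.lsmul (PS p κ n) H ((p : PS p κ n) ^ i)) (Cr.imF φ))

/-- The step `Fil_{i-1} H_0` of the conjugate filtration, which is `0` for `i = 0`. -/
def conjFilPred (φ : FrobLift p κ n) : ℕ → Submodule (PS0 p κ n) (Red p κ n H)
  | 0 => ⊥
  | i + 1 => Cr.conjFil φ i

/-- The step `Fil^i H_0` of the Hodge filtration: the classes of the `y ∈ H` with
`F(φ)φ^* y ∈ p ^ i H`. -/
def hodgeFil (φ : FrobLift p κ n) (i : ℕ) : Submodule (PS0 p κ n) (Red p κ n H) :=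
  Submodule.map (red p κ n H)
    (Submodule.comap (Cr.frob φ)
      (LinearMap.range (LinearMap.lsmul (PS p κ n) H ((p : PS p κ n) ^ i))))

/-- `gr_i H_0 = Fil_i H_0 / Fil_{i-1} H_0`. -/
abbrev conjGr (φ : FrobLift p κ n) (i : ℕ) : Type u :=
  ↥(Cr.conjFil φ i) ⧸ (Cr.conjFilPred φ i).submoduleOf (Cr.conjFil φ i)

/-- The `i`-th Hodge number `h^i`, the rank of `gr_i H_0` over `A_0`. -/
def hodgeNumber (φ : FrobLift p κ n) (i : ℕ) : ℕ :=
  Module.finrank (PS0 p κ n) (Cr.conjGr φ i)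

/-- `H` is of level `≤ N`. -/
def LevelLE (φ : FrobLift p κ n) (N : ℕ) : Prop :=
  Cr.conjFil φ N = ⊤ ∧ Cr.hodgeFil φ (N + 1) = ⊥

/-- `H` is ordinary: the graded module of the conjugate filtration is free and the
conjugate and the Hodge filtrations on `H_0` are opposite. -/
def IsOrdinary (φ : FrobLift p κ n) : Prop :=
  (∀ i : ℕ, Module.Free (PS0 p κ n) (Cr.conjGr φ i)) ∧
    ∀ i : ℕ, IsCompl (Cr.conjFil φ i) (Cr.hodgeFil φ (i + 1))

/-- The submodule `S` of `H` satisfies `S ⊗_A A_0 = S₀` inside `H_0`: the natural map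
`S / pS → H_0` is injective with image `S₀`. -/
def Lifts (S : Submodule (PS p κ n) H) (S₀ : Submodule (PS0 p κ n) (Red p κ n H)) : Prop :=
  (∀ x : H, p • x ∈ S → x ∈ S) ∧ Submodule.map (red p κ n H) S = S₀

/-- `Fil` makes the `F`-crystal `H` into a Hodge `F`-crystal: it is a decreasing filtration by free
submodules, which lifts the Hodge filtration of `H_0` and satisfies Griffiths transversality. -/
structure IsHodgeFiltration (φ : FrobLift p κ n) (Fil : ℕ → Submodule (PS p κ n) H) : Prop where
  zero : Fil 0 = ⊤
  anti : Antitone Fil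
  free : ∀ i, Module.Free (PS p κ n) (Fil i)
  lifts : ∀ i, Lifts (Fil i) (Cr.hodgeFil φ i)
  griffiths : ∀ (i : ℕ) (j : Fin n), ∀ x ∈ Fil (i + 1), Cr.D j x ∈ Fil i

/-- Divisibility of a Hodge `F`-crystal with Hodge filtration `Fil^0, …, Fil^N`. -/
def IsDivisible (Fil : ℕ → Submodule (PS p κ n) H) (N : ℕ) : Prop :=
  ∃ φ : FrobLift p κ n, ∀ i ≤ N, ∀ x ∈ Fil i, ∃ y : H, Cr.frob φ x = p ^ i • y

/-- `S` is a sub-`F`-crystal: connection and Frobenius maps restrict to `S`, and make it an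
`F`-crystal. -/
def IsSubcrystal (S : Submodule (PS p κ n) H) : Prop :=
  ∃ Cs : FCrystal p κ n S, (∀ (j : Fin n) (x : S), (Cs.D j x : H) = Cr.D j x) ∧
    ∀ (φ : FrobLift p κ n) (x : S), (Cs.frob φ x : H) = Cr.frob φ x

/-- The step `U_{i-1}` of a filtration `U_0 ⊆ U_1 ⊆ …`, with `U_{-1} = 0`. -/
def pred (U : ℕ → Submodule (PS p κ n) H) : ℕ → Submodule (PS p κ n) H
  | 0 => ⊥
  | i + 1 => U i

/-- The filtration `0 = U_{-1} ⊆ U_0 ⊆ U_1 ⊆ …` by sub-`F`-crystals that lifts the conjugate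
filtration, with `U_i / U_{i-1} ≃ V_i(-i)` for a unit `F`-crystal `V_i`. The isomorphism is given
by a surjection `q : U_i → V_i` with kernel `U_{i-1}`; the Frobenius maps of the Tate twist `V_i(-i)`
are `p ^ i` times those of `V_i`. -/
structure IsUnitRootFiltration (φ : FrobLift p κ n) (U : ℕ → Submodule (PS p κ n) H) : Prop where
  mono : Monotone U
  sub : ∀ i, Cr.IsSubcrystal (U i)
  lifts : ∀ i, Lifts (U i) (Cr.conjFil φ i)
  graded : ∀ i : ℕ, ∃ (V : Type u) (_ : AddCommGroup V) (_ : Module (PS p κ n) V)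
    (Cv : FCrystal p κ n V) (q : U i →ₗ[PS p κ n] V),
    Cv.IsUnitCrystal ∧ Function.Surjective q ∧
    (∀ x : U i, q x = 0 ↔ (x : H) ∈ pred U i) ∧
    (∀ (j : Fin n) (x y : U i), (y : H) = Cr.D j x → q y = Cv.D j (q x)) ∧
    ∀ (ψ : FrobLift p κ n) (x y : U i), (y : H) = Cr.frob ψ x → q y = p ^ i • Cv.frob ψ (q x)

/-- The matrix of the connection with respect to the basis `e`, as a matrix of `1`-forms
`∑_j M_j dt_j`; this is its component `M_j`. Column `b` holds the coordinates of `D_j e_b`. -/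
def connMatrix {ι : Type*} (e : Module.Basis ι (PS p κ n) H) (j : Fin n) :
    Matrix ι ι (PS p κ n) :=
  Matrix.of fun a b => e.repr (Cr.D j (e b)) a

/-- The matrix of `F(ψ)ψ^*` with respect to the basis `e`. Column `b` holds the coordinates of
the image of `e_b`. -/
def frobMatrix {ι : Type*} (e : Module.Basis ι (PS p κ n) H) (ψ : FrobLift p κ n) :
    Matrix ι ι (PS p κ n) :=
  Matrix.of fun a b => e.repr (Cr.frob ψ (e b)) a

end FCrystal

variable {p κ} {n : ℕ}

/-- The inclusion `A → K[[t_1, …, t_n]]`. -/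
def toKPS : PS p κ n →+* KPS p κ n :=
  MvPowerSeries.map (algebraMap (WittVector p κ) (KK p κ))

/-- `g = ψ(f)` for `f, g ∈ K[[t_1, …, t_n]]`: if `f = ∑ a_m t ^ m`, then the series
`∑ σ(a_m) ψ(t) ^ m` converges to `g`, unconditionally, coefficient by coefficient,
for the `p`-adic topology of `K`. -/
def IsFrobValue [PerfectRing κ p] (ψ : FrobLift p κ n) (f g : KPS p κ n) : Prop :=
  ∀ (d : Fin n →₀ ℕ) (r : ℕ), ∃ S₀ : Finset (Fin n →₀ ℕ), ∀ S : Finset (Fin n →₀ ℕ), S₀ ⊆ S →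
    ∃ w : WittVector p κ,
      coeff d (g - ∑ m ∈ S, C (WittVector.FractionRing.frobenius p κ (coeff m f)) *
          toKPS (∏ j : Fin n, ψ.toRingHom (X j) ^ m j)) =
        algebraMap (WittVector p κ) (KK p κ) ((p : WittVector p κ) ^ r * w)

end Frobenius

end OrdinaryCrystal

end

noncomputable section

namespace OrdinaryCrystal

open MvPowerSeries

universe u v

set_option linter.unusedSectionVars false

/-! ### Lang's theorem for `GL` over an algebraically closed field -/

section Lang

variable {p : ℕ} [Fact p.Prime] {κ : Type*} [Field κ] [CharP κ p] [IsAlgClosed κ]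

/-! Almost everything is computed with one lift of Frobenius φ, the lift t_i ↦ t_i^p (`powLift`).
For it horizontality reads D_j F = p t_j^(p-1) F D_j (`FCrystal.D_frob_powLift`), which gains a
factor p and raises the degree in t. Hence unknowns governed by a Frobenius equation are fixed
points of p-adic or t-adic contractions. Other lifts are reached through the Taylor formula of the
crystal.

Normal form. Ordinarity identifies gr_i H_0 with Fil_i ∩ Fil^i, which gives a basis of H lying in
the Hodge filtration whose reduction lies in the conjugate filtration
(`FCrystal.exists_adapted_basis`). Divisibility passes to every lift because N < p
(`FCrystal.frob_mem_of_divisible`). So the matrix of F is G P with P = diag(p^i), where G is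
invertible and block upper triangular modulo p. A block lower triangular change of basis, which
respects the Hodge filtration, makes it block upper triangular on the nose
(`exists_lower_mul_upper`). Lang's theorem over W(κ)[[t]] turns the diagonal blocks into identities.
The outcome is `FCrystal.exists_unitriangular_basis`: F has matrix r P with r block unitriangular.

Filtration. U_i is the span of the basis vectors of degree ≤ i. Two facts carry everything: F(H) ⊂
U_i + p^(i+1) H, and p^i U_i lies in the span of F(U_i). What F gains, p^(i+1), beats what inverting
F on U_i costs, p^i. This yields stability under D_j, the comparison with the conjugate filtration,
and uniqueness, each time by successive p-adic approximation. On graded pieces the basis is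
horizontal, since a connection coefficient c satisfies c = p t_j^(p-1) φ(c), hence vanishes.

Trivialization. The equation T r P = P φ(T) is solved first for constant terms, then degree by
degree (`exists_frobenius_trivialization`). Its rows are linear forms ℓ_a with ℓ_a ∘ F = p^(deg a) φ
∘ ℓ_a. This forces them to be horizontal (`FCrystal.rowForm_D`), which is the formula for the
connection. For an arbitrary lift ψ one applies ℓ_a to the Taylor formula. The result agrees with
termwise substitution of ψ(t), because the denominators of T grow only logarithmically and for
polynomials the agreement is the binomial theorem (`isFrobValue_of_taylor`). -/

/-- Artin–Schreier equations are solvable over an algebraically closed field. -/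
theorem exists_sub_pow_eq (c : κ) : ∃ y : κ, y - y ^ p = c := by
  have hp : 1 < p := (Fact.out : p.Prime).one_lt
  have hdeg : (Polynomial.X ^ p - (Polynomial.X - Polynomial.C c) : Polynomial κ).degree = p :=
    Polynomial.degree_sub_eq_left_of_degree_lt (by
      rw [Polynomial.degree_X_pow, Polynomial.degree_X_sub_C]; exact_mod_cast hp) |>.trans
      (Polynomial.degree_X_pow p)
  obtain ⟨y, hy⟩ := IsAlgClosed.exists_root
    (Polynomial.X ^ p - (Polynomial.X - Polynomial.C c) : Polynomial κ)
    (by rw [hdeg]; exact_mod_cast (by omega : p ≠ 0))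
  refine ⟨y, ?_⟩
  simp only [Polynomial.IsRoot, Polynomial.eval_sub, Polynomial.eval_pow, Polynomial.eval_X,
    Polynomial.eval_C] at hy
  linear_combination -hy

/-- The polynomials expressing the coordinates of a fixed vector through the last one. -/
def fixedPoly (p : ℕ) (a : ℕ → κ) : ℕ → Polynomial κ
  | 0 => Polynomial.C (a 0) * Polynomial.X ^ p
  | i + 1 => fixedPoly p a i ^ p + Polynomial.C (a (i + 1)) * Polynomial.X ^ p

theorem X_pow_dvd_fixedPoly (a : ℕ → κ) (i : ℕ) : Polynomial.X ^ p ∣ fixedPoly p a i := by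
  have hp : p ≠ 0 := (Fact.out : p.Prime).ne_zero
  induction i with
  | zero => exact Dvd.intro_left _ rfl
  | succ i ih => exact dvd_add (ih.trans (dvd_pow_self _ hp)) (Dvd.intro_left _ rfl)

/-- The p-th power in the recursion only contributes from X^(p²) on, so the coefficient of X^p in
step i + 1 is exactly a (i + 1). If that vanishes, the polynomial is a p-th power of the previous
one. -/
theorem fixedPoly_ne_zero (a : ℕ → κ) (i : ℕ) (h : ∃ j ≤ i, a j ≠ 0) : fixedPoly p a i ≠ 0 := by
  have hp : 1 < p := (Fact.out : p.Prime).one_lt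
  induction i with
  | zero =>
    obtain ⟨j, hj, h⟩ := h
    obtain rfl : j = 0 := by omega
    simpa [fixedPoly] using h
  | succ i ih =>
    by_cases hi : a (i + 1) = 0
    · have : fixedPoly p a i ≠ 0 := by
        apply ih
        obtain ⟨j, hj, h⟩ := h
        refine ⟨j, ?_, h⟩
        by_contra hj'
        obtain rfl : j = i + 1 := by omega
        exact h hi
      simpa [fixedPoly, hi] using fun h' => absurd h' this
    · intro h0
      obtain ⟨q, hq⟩ := X_pow_dvd_fixedPoly (p := p) a i
      have h1 := congrArg (fun f : Polynomial κ => f.coeff p) h0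
      simp only [fixedPoly, hq, mul_pow, ← pow_mul, Polynomial.coeff_add,
        Polynomial.coeff_X_pow_mul', Polynomial.coeff_C_mul, Polynomial.coeff_X_pow,
        Polynomial.coeff_zero] at h1
      rw [if_neg (by nlinarith)] at h1
      exact hi (by simpa using h1)

/-- A nonzero finite-dimensional space with an injective Frobenius-semilinear endomorphism
contains a nonzero fixed vector. -/
theorem exists_fixed_vector {V : Type*} [AddCommGroup V] [Module κ V] [FiniteDimensional κ V]
    [Nontrivial V] (F : V →ₛₗ[frobenius κ p] V) (hF : Function.Injective F) :
    ∃ v : V, v ≠ 0 ∧ F v = v := by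
  have hp : 1 < p := (Fact.out : p.Prime).one_lt
  obtain ⟨v, hv⟩ := exists_ne (0 : V)
  have hex : ∃ s : ℕ, ¬ LinearIndependent κ (fun i : Fin (s + 1) => F^[i] v) := by
    refine ⟨Module.finrank κ V, fun h => ?_⟩
    have := h.fintype_card_le_finrank
    simp at this
  classical
  have hs := Nat.find_spec hex
  have hmin := fun m => Nat.find_min hex (m := m)
  set s := Nat.find hex
  have hli : LinearIndependent κ (fun i : Fin s => F^[i] v) := by
    rcases Nat.eq_zero_or_pos s with h0 | h0
    · rw [h0]; exact linearIndependent_empty_type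
    · have := hmin (s - 1) (by omega)
      rw [not_not] at this
      rwa [Nat.sub_add_cancel h0] at this
  have hmem : F^[s] v ∈ Submodule.span κ (Set.range fun i : Fin s => F^[i] v) := by
    rw [linearIndependent_finSucc'] at hs
    by_contra hc
    apply hs
    refine ⟨?_, ?_⟩
    · exact hli
    · exact hc
  obtain ⟨a', ha'⟩ := (Submodule.mem_span_range_iff_exists_fun κ).1 hmem
  have hiter : ∀ i, F^[i] v ≠ 0 := by
    intro i
    induction i with
    | zero => simpa using hv
    | succ i ih =>
      rw [Function.iterate_succ_apply']
      intro h0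
      exact ih (hF (by rw [h0, map_zero]))
  let a : ℕ → κ := fun i => if h : i < s then a' ⟨i, h⟩ else 0
  have ha : ∑ i ∈ Finset.range s, a i • F^[i] v = F^[s] v := by
    rw [← ha', Finset.sum_range]
    simp [a]
  have hs0 : s ≠ 0 := by
    intro h0
    rw [h0] at ha
    exact hiter 0 (by simpa using ha.symm)
  obtain ⟨m, hm⟩ := Nat.exists_eq_succ_of_ne_zero hs0
  have hane : ∃ j ≤ m, a j ≠ 0 := by
    by_contra! hc
    apply hiter s
    rw [← ha]
    exact Finset.sum_eq_zero fun i hi => by rw [hc i (by have := Finset.mem_range.1 hi; omega), zero_smul]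
  obtain ⟨q, hq⟩ := X_pow_dvd_fixedPoly (p := p) a m
  have hq0 : q ≠ 0 := by
    rintro rfl
    exact fixedPoly_ne_zero a m hane (by rw [hq, mul_zero])
  -- Write m = s - 1. A vector ∑ x_i F^i v is fixed iff x_0 = a_0 x_m^p and x_{i+1} = x_i^p +
  -- a_{i+1} x_m^p. So x_i is `fixedPoly p a i` evaluated at z = x_m, and the only remaining
  -- condition is that the m-th polynomial X^p q fixes z. Dividing by z leaves the equation solved
  -- here, whose solutions are automatically nonzero.
  obtain ⟨z, hz⟩ : ∃ z : κ, z ^ (p - 1) * q.eval z = 1 := by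
    have hd : (Polynomial.X ^ (p - 1) * q - Polynomial.C 1 : Polynomial κ).degree ≠ 0 := by
      rw [Polynomial.degree_sub_C, Polynomial.degree_mul, Polynomial.degree_X_pow]
      · rw [Polynomial.degree_eq_natDegree hq0]
        exact_mod_cast (by omega : p - 1 + q.natDegree ≠ 0)
      · rw [Polynomial.degree_mul, Polynomial.degree_X_pow, Polynomial.degree_eq_natDegree hq0]
        exact_mod_cast (by omega : 0 < p - 1 + q.natDegree)
    obtain ⟨z, hz⟩ := IsAlgClosed.exists_root _ hd
    refine ⟨z, ?_⟩
    simpa [sub_eq_zero] using hz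
  have hz0 : z ≠ 0 := by
    rintro rfl
    rw [zero_pow (by omega), zero_mul] at hz
    exact zero_ne_one hz
  have hPz : (fixedPoly p a m).eval z = z := by
    rw [hq, Polynomial.eval_mul, Polynomial.eval_pow, Polynomial.eval_X]
    calc z ^ p * q.eval z = z * (z ^ (p - 1) * q.eval z) := by
          rw [← mul_assoc, ← pow_succ', Nat.sub_add_cancel hp.le]
      _ = z := by rw [hz, mul_one]
  set x : ℕ → κ := fun i => (fixedPoly p a i).eval z with hx
  have hxm : x m = z := hPz
  refine ⟨∑ i ∈ Finset.range s, x i • F^[i] v, ?_, ?_⟩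
  · intro h0
    have := (Fintype.linearIndependent_iff.1 hli) (fun i => x i)
      (by rw [← h0, Finset.sum_range]) ⟨m, by omega⟩
    exact hz0 (by rw [← hxm]; exact this)
  · rw [map_sum]
    have e1 : ∀ i, F (x i • F^[i] v) = x i ^ p • F^[i + 1] v := by
      intro i
      rw [map_smulₛₗ, Function.iterate_succ_apply', frobenius_def]
    simp_rw [e1]
    rw [hm, Finset.sum_range_succ, hxm, ← Nat.succ_eq_add_one m, ← hm, ← ha, Finset.smul_sum, hm,
      Nat.succ_eq_add_one, Finset.sum_range_succ', Finset.sum_range_succ' (fun i => x i • F^[i] v),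
      ← add_assoc, ← Finset.sum_add_distrib]
    congr 1
    · refine Finset.sum_congr rfl fun i _ => ?_
      rw [smul_smul, ← add_smul]
      congr 1
      simp only [hx, fixedPoly, Polynomial.eval_add, Polynomial.eval_pow, Polynomial.eval_mul,
        Polynomial.eval_C, Polynomial.eval_X]
      ring
    · rw [smul_smul]
      congr 1
      simp only [hx, fixedPoly, Polynomial.eval_pow, Polynomial.eval_mul,
        Polynomial.eval_C, Polynomial.eval_X]
      ring

/-- The fixed vectors of an injective Frobenius-semilinear endomorphism span. -/
theorem span_fixed_vectors_eq_top {V : Type*} [AddCommGroup V] [Module κ V]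
    [FiniteDimensional κ V] (F : V →ₛₗ[frobenius κ p] V) (hF : Function.Injective F) :
    Submodule.span κ {v : V | F v = v} = ⊤ := by
  set S := Submodule.span κ {v : V | F v = v} with hS
  have hlift : ∀ w ∈ S, ∃ y ∈ S, F y = w := by
    intro w hw
    induction hw using Submodule.span_induction with
    | mem w hw => exact ⟨w, Submodule.subset_span hw, hw⟩
    | zero => exact ⟨0, S.zero_mem, map_zero F⟩
    | add w w' _ _ h h' =>
      obtain ⟨y, hy, rfl⟩ := h
      obtain ⟨y', hy', rfl⟩ := h'
      exact ⟨y + y', S.add_mem hy hy', map_add F _ _⟩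
    | smul c w _ h =>
      obtain ⟨y, hy, rfl⟩ := h
      obtain ⟨d, rfl⟩ := (PerfectRing.bijective_frobenius (R := κ) (p := p)).2 c
      exact ⟨d • y, S.smul_mem _ hy, map_smulₛₗ F _ _⟩
  -- 1 - F is additive but not semilinear, so the induction runs over additive generators c • w with
  -- w fixed, where the equation becomes Artin–Schreier for c.
  have hsub : ∀ w ∈ S, ∃ y ∈ S, y - F y = w := by
    intro w hw
    induction hw using Submodule.closure_induction with
    | zero => exact ⟨0, S.zero_mem, by simp⟩
    | add w w' _ _ h h' =>
      obtain ⟨y, hy, rfl⟩ := h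
      obtain ⟨y', hy', rfl⟩ := h'
      exact ⟨y + y', S.add_mem hy hy', by rw [map_add]; abel⟩
    | smul_mem c w hw =>
      obtain ⟨d, hd⟩ := exists_sub_pow_eq (p := p) c
      refine ⟨d • w, S.smul_mem _ (Submodule.subset_span hw), ?_⟩
      have hw' : F w = w := hw
      rw [map_smulₛₗ, hw', frobenius_def, ← sub_smul, hd]
  have hle : ∀ w ∈ S, F w ∈ S := by
    intro w hw
    induction hw using Submodule.span_induction with
    | mem w hw => rw [show F w = w from hw]; exact Submodule.subset_span hw
    | zero => rw [map_zero]; exact S.zero_mem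
    | add w w' hw hw' h1 h2 =>
      rw [map_add]
      exact S.add_mem (h1) (h2)
    | smul c w hw h1 =>
      rw [map_smulₛₗ]
      exact S.smul_mem _ (h1)
  by_contra hne
  have : Nontrivial (V ⧸ S) := Submodule.Quotient.nontrivial_iff.2 hne
  let Fb : (V ⧸ S) →ₛₗ[frobenius κ p] (V ⧸ S) := S.mapQ S F hle
  have hFb : Function.Injective Fb := by
    rw [injective_iff_map_eq_zero]
    intro x hx
    obtain ⟨x, rfl⟩ := S.mkQ_surjective x
    have hx' : F x ∈ S := (Submodule.Quotient.mk_eq_zero S).1 hx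
    obtain ⟨y, hy, h⟩ := hlift _ hx'
    rw [← hF h]
    exact (Submodule.Quotient.mk_eq_zero S).2 hy
  -- A fixed class in V ⧸ S can be corrected to a fixed vector because 1 - F is onto on S. That
  -- vector lies in S by definition, so the class was zero.
  obtain ⟨v, hv, hv'⟩ := exists_fixed_vector Fb hFb
  obtain ⟨v, rfl⟩ := S.mkQ_surjective v
  have hd : F v - v ∈ S := by
    rw [← Submodule.Quotient.mk_eq_zero S, Submodule.Quotient.mk_sub]
    exact sub_eq_zero.2 hv'
  obtain ⟨y, hy, h⟩ := hsub _ hd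
  apply hv
  have : v + y ∈ S := Submodule.subset_span (by
    show F (v + y) = v + y
    rw [map_add]
    rw [sub_eq_sub_iff_add_eq_add] at h
    rw [add_comm v y, h])
  exact (Submodule.Quotient.mk_eq_zero S).2 (by simpa using S.sub_mem this hy)

/-- Lang's theorem for `GL` over an algebraically closed field. -/
theorem exists_isUnit_mul_map_frobenius_eq {ι : Type*} [Fintype ι] [DecidableEq ι]
    (B : Matrix ι ι κ) (hB : IsUnit B) :
    ∃ C : Matrix ι ι κ, IsUnit C ∧ B * C.map (frobenius κ p) = C := by
  let F : (ι → κ) →ₛₗ[frobenius κ p] (ι → κ) :=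
    { toFun := fun x => B.mulVec (fun i => frobenius κ p (x i))
      map_add' := fun x y => by
        rw [← Matrix.mulVec_add]; congr 1; ext i; simp
      map_smul' := fun c x => by
        rw [← Matrix.mulVec_smul]; congr 1; ext i; simp [frobenius_def, mul_pow] }
  have hF : Function.Injective F := by
    intro x y h
    have := Matrix.mulVec_injective_iff_isUnit.2 hB h
    ext i
    exact frobenius_inj κ p (congrFun this i)
  have hspan := span_fixed_vectors_eq_top F hF
  obtain ⟨b, hb, hbs, hbli⟩ := exists_linearIndependent κ {v : ι → κ | F v = v}
  rw [hspan] at hbs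
  let e : Module.Basis b κ (ι → κ) := Module.Basis.mk hbli (by simp [hbs])
  let f : Module.Basis ι κ (ι → κ) := e.reindex (e.indexEquiv (Pi.basisFun κ ι))
  have hf : ∀ i, F (f i) = f i := by
    intro i
    have : f i ∈ b := by
      simp only [f, Module.Basis.reindex_apply, e, Module.Basis.mk_apply]
      exact Subtype.coe_prop _
    exact hb this
  refine ⟨(Pi.basisFun κ ι).toMatrix f, ?_, ?_⟩
  · have := (Pi.basisFun κ ι).invertibleToMatrix f
    exact isUnit_of_invertible _
  · ext i j
    exact congrFun (hf j) i
end Lang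

/-! ### p-adic completeness and fixed points of contractions -/

section Complete

/-- The power series with prescribed coefficients. -/
def ofCoeff {σ R : Type*} (f : (σ →₀ ℕ) → R) : MvPowerSeries σ R := f

@[simp]
theorem coeff_ofCoeff {σ R : Type*} [Semiring R] (f : (σ →₀ ℕ) → R) (d : σ →₀ ℕ) :
    coeff d (ofCoeff f) = f d := rfl

/-- The ring `R` is separated and complete for the `p`-adic topology. -/
structure PadicallyComplete (p : ℕ) (R : Type*) [Ring R] : Prop where
  sep : ∀ x : R, (∀ k : ℕ, (p : R) ^ k ∣ x) → x = 0
  lim : ∀ f : ℕ → R, (∀ k, (p : R) ^ k ∣ f (k + 1) - f k) → ∃ L, ∀ k, (p : R) ^ k ∣ L - f k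

theorem natCast_pow_dvd_mul_left {p k : ℕ} {R : Type*} [Ring R] (a : R) {b : R}
    (h : (p : R) ^ k ∣ b) : (p : R) ^ k ∣ a * b := by
  obtain ⟨c, rfl⟩ := h
  exact ⟨a * c, by rw [← mul_assoc, ← mul_assoc, ((Nat.cast_commute p a).pow_left k).eq]⟩

theorem map_natCast_pow_dvd {p k : ℕ} {R S : Type*} [Ring R] [Ring S] (f : R →+* S) {b : R}
    (h : (p : R) ^ k ∣ b) : (p : S) ^ k ∣ f b := by
  obtain ⟨c, rfl⟩ := h
  exact ⟨f c, by simp⟩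

/-- The iterates of Φ at 0 form a Cauchy sequence. The ring need not be commutative, since the
statement serves for matrix rings. -/
theorem PadicallyComplete.exists_fixedPoint {p : ℕ} {R : Type*} [Ring R]
    (hR : PadicallyComplete p R) (Φ : R → R)
    (hΦ : ∀ k x y, (p : R) ^ k ∣ x - y → (p : R) ^ (k + 1) ∣ Φ x - Φ y) : ∃ x, Φ x = x := by
  have h1 : ∀ k, (p : R) ^ k ∣ Φ^[k + 1] 0 - Φ^[k] 0 := by
    intro k
    induction k with
    | zero => simp
    | succ k ih =>
      rw [Function.iterate_succ_apply', Function.iterate_succ_apply' _ k]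
      rw [Function.iterate_succ_apply'] at ih
      exact hΦ _ _ _ ih
  obtain ⟨L, hL⟩ := hR.lim (fun k => Φ^[k] 0) h1
  refine ⟨L, sub_eq_zero.1 (hR.sep _ fun k => ?_)⟩
  have h2 := hΦ _ _ _ (hL k)
  rw [← Function.iterate_succ_apply' Φ] at h2
  have h3 := dvd_sub h2 (hL (k + 1))
  rw [sub_sub_sub_cancel_right] at h3
  exact (pow_dvd_pow _ (Nat.le_succ k)).trans h3

/-- Successive refinement of approximate solutions. -/
theorem PadicallyComplete.exists_limit {p : ℕ} {R : Type*} [Ring R]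
    (hR : PadicallyComplete p R) (P : ℕ → R → Prop) (k₀ : ℕ) (x₀ : R) (h₀ : P k₀ x₀)
    (hP : ∀ k x, k₀ ≤ k → P k x → ∃ y, P (k + 1) y ∧ (p : R) ^ k ∣ y - x) :
    ∃ L : R, ∀ k, k₀ ≤ k → ∃ x, P k x ∧ (p : R) ^ k ∣ L - x := by
  classical
  choose! g hg using hP
  let f : ℕ → R := fun k => Nat.rec x₀ (fun k x => g (k₀ + k) x) k
  have hf : ∀ k, P (k₀ + k) (f k) := by
    intro k
    induction k with
    | zero => exact h₀
    | succ k ih => exact (hg _ _ (Nat.le_add_right _ _) ih).1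
  have hf' : ∀ k, (p : R) ^ (k₀ + k) ∣ f (k + 1) - f k := fun k =>
    (hg _ _ (Nat.le_add_right _ _) (hf k)).2
  obtain ⟨L, hL⟩ := hR.lim f fun k => (pow_dvd_pow _ (Nat.le_add_left _ _)).trans (hf' k)
  have hstep : ∀ m k, (p : R) ^ (k₀ + k) ∣ f (k + m) - f k := by
    intro m k
    induction m with
    | zero => simp
    | succ m ih =>
      have := dvd_add ((pow_dvd_pow _ (by omega : k₀ + k ≤ k₀ + (k + m))).trans (hf' (k + m))) ih
      rwa [sub_add_sub_cancel] at this
  refine ⟨L, fun k hk => ⟨f (k - k₀), ?_, ?_⟩⟩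
  · have := hf (k - k₀)
    rwa [Nat.add_sub_cancel' hk] at this
  · have h1 := hL (k - k₀ + k₀)
    have h2 := hstep k₀ (k - k₀)
    rw [Nat.add_sub_cancel' hk] at h2
    rw [Nat.sub_add_cancel hk] at h1 h2
    have := dvd_add h1 h2
    rwa [sub_add_sub_cancel] at this

theorem natCast_pow_dvd_matrix_iff {p k : ℕ} {R ι : Type*} [CommRing R] [Fintype ι] [DecidableEq ι]
    {M : Matrix ι ι R} : (p : Matrix ι ι R) ^ k ∣ M ↔ ∀ a b, (p : R) ^ k ∣ M a b := by
  have key : ∀ Z : Matrix ι ι R, (p : Matrix ι ι R) ^ k * Z = (p : R) ^ k • Z := by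
    intro Z
    rw [← Nat.cast_pow, ← Nat.cast_pow, ← nsmul_eq_mul, Nat.cast_smul_eq_nsmul]
  constructor
  · rintro ⟨Z, rfl⟩ a b
    rw [key]
    exact ⟨Z a b, rfl⟩
  · intro h
    choose Z hZ using h
    exact ⟨Matrix.of Z, by rw [key]; ext a b; simp [hZ]⟩

theorem PadicallyComplete.matrix {p : ℕ} {R : Type*} [CommRing R] (hR : PadicallyComplete p R)
    (ι : Type*) [Fintype ι] [DecidableEq ι] : PadicallyComplete p (Matrix ι ι R) where
  sep M hM := by
    ext a b
    exact hR.sep _ fun k => natCast_pow_dvd_matrix_iff.1 (hM k) a b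
  lim f hf := by
    have : ∀ a b, ∃ L, ∀ k, (p : R) ^ k ∣ L - f k a b := fun a b =>
      hR.lim (fun k => f k a b) fun k => natCast_pow_dvd_matrix_iff.1 (hf k) a b
    choose L hL using this
    exact ⟨Matrix.of L, fun k => natCast_pow_dvd_matrix_iff.2 fun a b => hL a b k⟩

theorem natCast_pow_dvd_mvPowerSeries_iff {p k : ℕ} {R σ : Type*} [CommRing R]
    {f : MvPowerSeries σ R} :
    (p : MvPowerSeries σ R) ^ k ∣ f ↔ ∀ d, (p : R) ^ k ∣ coeff d f := by
  have key : ∀ Z : MvPowerSeries σ R, (p : MvPowerSeries σ R) ^ k * Z = (p : R) ^ k • Z := by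
    intro Z
    rw [← Nat.cast_pow, ← Nat.cast_pow, ← nsmul_eq_mul, Nat.cast_smul_eq_nsmul]
  constructor
  · rintro ⟨Z, rfl⟩ d
    rw [key]
    exact ⟨coeff d Z, by simp⟩
  · intro h
    choose Z hZ using h
    refine ⟨ofCoeff Z, ?_⟩
    rw [key]
    ext d
    rw [hZ, coeff_smul, coeff_ofCoeff]

theorem PadicallyComplete.mvPowerSeries {p : ℕ} {R : Type*} [CommRing R]
    (hR : PadicallyComplete p R) (σ : Type*) : PadicallyComplete p (MvPowerSeries σ R) where
  sep M hM := by
    ext d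
    exact hR.sep _ fun k => natCast_pow_dvd_mvPowerSeries_iff.1 (hM k) d
  lim f hf := by
    have : ∀ d, ∃ L, ∀ k, (p : R) ^ k ∣ L - coeff d (f k) := fun d =>
      hR.lim (fun k => coeff d (f k)) fun k => by
        have := natCast_pow_dvd_mvPowerSeries_iff.1 (hf k) d
        rwa [map_sub] at this
    choose L hL using this
    exact ⟨ofCoeff L, fun k => natCast_pow_dvd_mvPowerSeries_iff.2 fun d => by
      rw [map_sub, coeff_ofCoeff]; exact hL d k⟩

/-- This is the t-adic counterpart: in degree d the iterates of Φ are constant from step d + 1 on,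
so the limit can be read off coefficientwise without completeness of R. -/
theorem exists_fixedPoint_of_degree_contraction {σ ι R : Type*} [CommRing R]
    (Φ : Matrix ι ι (MvPowerSeries σ R) → Matrix ι ι (MvPowerSeries σ R))
    (hΦ : ∀ k X Y, (∀ a b d, d.degree < k → coeff d (X a b) = coeff d (Y a b)) →
      ∀ a b d, d.degree < k + 1 → coeff d (Φ X a b) = coeff d (Φ Y a b)) : ∃ X, Φ X = X := by
  have h1 : ∀ k a b d, d.degree < k →
      coeff d (Φ^[k + 1] 0 a b) = coeff d (Φ^[k] 0 a b) := by
    intro k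
    induction k with
    | zero => intro a b d hd; omega
    | succ k ih =>
      rw [Function.iterate_succ_apply', Function.iterate_succ_apply' _ k]
      rw [Function.iterate_succ_apply'] at ih
      exact hΦ _ _ _ ih
  have h2 : ∀ m k a b d, d.degree < k →
      coeff d (Φ^[k + m] 0 a b) = coeff d (Φ^[k] 0 a b) := by
    intro m k a b d hd
    induction m with
    | zero => rfl
    | succ m ih => rw [← ih, ← Nat.add_assoc]; exact h1 _ _ _ _ (by omega)
  let L : Matrix ι ι (MvPowerSeries σ R) := Matrix.of fun a b =>
    ofCoeff fun d => coeff d (Φ^[d.degree + 1] 0 a b)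
  have hL : ∀ k a b d, d.degree < k → coeff d (L a b) = coeff d (Φ^[k] 0 a b) := by
    intro k a b d hd
    obtain ⟨m, rfl⟩ := Nat.exists_eq_add_of_le (Nat.succ_le_of_lt hd)
    exact (h2 m (d.degree + 1) a b d (by omega)).symm
  refine ⟨L, ?_⟩
  ext a b d
  rw [hΦ _ _ _ (hL d.degree) a b d (by omega), ← Function.iterate_succ_apply' Φ,
    hL (d.degree + 1) a b d (by omega)]

end Complete

/-! ### Witt vectors of a perfect field -/

section Witt

variable {p : ℕ} [Fact p.Prime] {κ : Type*} [Field κ] [CharP κ p]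

instance charZero_wittVector : CharZero (WittVector p κ) := by
  refine charZero_of_inj_zero fun m => ?_
  induction m using Nat.strong_induction_on with
  | _ m ih =>
    intro hm
    have h1 : (m : κ) = 0 := by
      have := congrArg (WittVector.constantCoeff (p := p) (R := κ)) hm
      simpa using this
    obtain ⟨c, rfl⟩ := (CharP.cast_eq_zero_iff κ p m).1 h1
    by_contra hne
    have hc : c ≠ 0 := by rintro rfl; simp at hne
    have hp := (Fact.out : p.Prime).one_lt
    rw [Nat.cast_mul] at hm
    rcases mul_eq_zero.1 hm with h | h
    · exact WittVector.p_nonzero p κ h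
    · exact hc (ih c (by nlinarith [Nat.pos_of_ne_zero hc]) h)

instance charZero_fractionRing : CharZero (KK p κ) :=
  charZero_of_injective_algebraMap (IsFractionRing.injective (WittVector p κ) (KK p κ))

instance isDomain_PS (n : ℕ) : IsDomain (PS p κ n) := NoZeroDivisors.to_isDomain _

instance charZero_PS (n : ℕ) : CharZero (PS p κ n) :=
  charZero_of_injective_ringHom (f := MvPowerSeries.C (σ := Fin n) (R := WittVector p κ))
    MvPowerSeries.C_injective

variable [PerfectRing κ p]

theorem p_dvd_iff_constantCoeff (x : WittVector p κ) :
    (p : WittVector p κ) ∣ x ↔ WittVector.constantCoeff x = 0 := by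
  rw [← Ideal.mem_span_singleton, ← WittVector.ker_constantCoeff, RingHom.mem_ker]

theorem padicallyComplete_wittVector : PadicallyComplete p (WittVector p κ) where
  sep x hx := by
    refine IsHausdorff.haus (I := Ideal.span {(p : WittVector p κ)}) inferInstance x fun k => ?_
    rw [SModEq.zero, smul_eq_mul, Ideal.mul_top, Ideal.span_singleton_pow,
      Ideal.mem_span_singleton]
    exact hx k
  lim f hf := by
    have h1 : ∀ m k, (p : WittVector p κ) ^ k ∣ f (k + m) - f k := by
      intro m k
      induction m with
      | zero => simp
      | succ m ih =>
        have := dvd_add ((pow_dvd_pow _ (by omega : k ≤ k + m)).trans (hf (k + m))) ih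
        rwa [sub_add_sub_cancel] at this
    obtain ⟨L, hL⟩ := IsPrecomplete.prec (I := Ideal.span {(p : WittVector p κ)})
      inferInstance (f := f) (fun {m k} hmk => by
        rw [SModEq.sub_mem, smul_eq_mul, Ideal.mul_top, Ideal.span_singleton_pow,
          Ideal.mem_span_singleton, ← dvd_neg, neg_sub]
        obtain ⟨j, rfl⟩ := Nat.exists_eq_add_of_le hmk
        exact h1 j m)
    refine ⟨L, fun k => ?_⟩
    have := hL k
    rw [SModEq.sub_mem, smul_eq_mul, Ideal.mul_top, Ideal.span_singleton_pow,
      Ideal.mem_span_singleton, ← dvd_neg, neg_sub] at this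
    exact this

theorem padicallyComplete_PS (n : ℕ) : PadicallyComplete p (PS p κ n) :=
  padicallyComplete_wittVector.mvPowerSeries _

theorem isUnit_wittVector_iff (x : WittVector p κ) :
    IsUnit x ↔ WittVector.constantCoeff x ≠ 0 :=
  ⟨fun h => (h.map WittVector.constantCoeff).ne_zero,
    fun h => WittVector.isUnit_of_coeff_zero_ne_zero x h⟩

theorem isUnit_matrix_wittVector {ι : Type*} [Fintype ι] [DecidableEq ι]
    {M : Matrix ι ι (WittVector p κ)}
    (h : IsUnit ((WittVector.constantCoeff (p := p) (R := κ)).mapMatrix M)) : IsUnit M := by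
  rw [Matrix.isUnit_iff_isUnit_det] at h ⊢
  rw [isUnit_wittVector_iff, RingHom.map_det]
  exact h.ne_zero

end Witt

/-! ### Lang's theorem over the Witt vectors -/

section Lang

variable {p : ℕ} [Fact p.Prime] {κ : Type*} [Field κ] [CharP κ p] [IsAlgClosed κ]

/-- Lang's theorem for `GL` over the Witt vectors. -/
theorem exists_isUnit_mul_map_wittFrobenius_eq {ι : Type*} [Fintype ι] [DecidableEq ι]
    (B : Matrix ι ι (WittVector p κ)) (hB : IsUnit B) :
    ∃ C : Matrix ι ι (WittVector p κ), IsUnit C ∧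
      B * (WittVector.frobenius (p := p) (R := κ)).mapMatrix C = C := by
  set σ := (WittVector.frobenius (p := p) (R := κ)).mapMatrix (m := ι) with hσ
  set ρ := (WittVector.constantCoeff (p := p) (R := κ)).mapMatrix (m := ι) with hρ
  have hρσ : ∀ M, ρ (σ M) = (ρ M).map (frobenius κ p) := by
    intro M
    ext a b
    exact WittVector.coeff_frobenius_charP p (M a b) 0
  have hdvd : ∀ M, (p : Matrix ι ι (WittVector p κ)) ∣ M ↔ ρ M = 0 := by
    intro M
    have := natCast_pow_dvd_matrix_iff (p := p) (k := 1) (M := M)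
    rw [pow_one, pow_one] at this
    rw [this]
    simp_rw [p_dvd_iff_constantCoeff]
    exact ⟨fun h => by ext a b; exact h a b, fun h a b => congrFun (congrFun h a) b⟩
  have hsurj : Function.Surjective ρ := by
    intro M
    choose f hf using WittVector.constantCoeff_surjective (R := κ) p
    exact ⟨Matrix.of fun a b => f (M a b), by ext a b; exact hf _⟩
  obtain ⟨C₁, hC₁, hBC₁⟩ := exists_isUnit_mul_map_frobenius_eq (p := p) (ρ B) (hB.map ρ)
  obtain ⟨C₀, rfl⟩ := hsurj C₁
  have hpc := (padicallyComplete_wittVector (p := p) (κ := κ)).matrix ι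
  obtain ⟨L, hL⟩ := hpc.exists_limit
    (fun k X => ρ X = ρ C₀ ∧ (p : Matrix ι ι (WittVector p κ)) ^ k ∣ B * σ X - X) 1 C₀
    ⟨rfl, by rw [pow_one, hdvd, map_sub, map_mul, hρσ, hBC₁, sub_self]⟩ (by
      rintro k X hk ⟨hX, Y, hY⟩
      obtain ⟨D, hD⟩ := hC₁
      have hAS : ∀ c : κ, ∃ y : κ, y - y ^ p = c := exists_sub_pow_eq
      choose s hs using hAS
      -- With c = C₀⁻¹ Y modulo p and s - s^p = c entrywise, the correction Z = C₀ s satisfies B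
      -- σ(Z) - Z ≡ C₀ (s^p - s) = -Y, which cancels the error p^k Y modulo p^(k+1).
      obtain ⟨Z, hZ⟩ := hsurj (ρ C₀ * (((D⁻¹ : (Matrix ι ι κ)ˣ) : Matrix ι ι κ) * ρ Y).map s)
      refine ⟨X + (p : Matrix ι ι (WittVector p κ)) ^ k * Z, ⟨?_, ?_⟩, ?_⟩
      · rw [map_add, hX, add_eq_left, ← hdvd]
        exact (dvd_pow_self _ (by omega)).mul_right _
      · have e1 : B * σ (X + (p : Matrix ι ι (WittVector p κ)) ^ k * Z) -
            (X + (p : Matrix ι ι (WittVector p κ)) ^ k * Z) =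
            (p : Matrix ι ι (WittVector p κ)) ^ k * (Y + B * σ Z - Z) := by
          rw [map_add, map_mul, map_pow, map_natCast, mul_add, ← mul_assoc B,
            ← ((Nat.cast_commute p B).pow_left k).eq, mul_sub, mul_add, ← hY, mul_assoc]
          abel
        rw [e1, pow_succ]
        refine mul_dvd_mul_left _ ?_
        rw [hdvd, map_sub, map_add, map_mul, hρσ, hZ, Matrix.map_mul, ← mul_assoc, hBC₁,
          add_sub_assoc, ← mul_sub]
        have e2 : ((((D⁻¹ : (Matrix ι ι κ)ˣ) : Matrix ι ι κ) * ρ Y).map s).map (frobenius κ p) -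
            (((D⁻¹ : (Matrix ι ι κ)ˣ) : Matrix ι ι κ) * ρ Y).map s =
            -(((D⁻¹ : (Matrix ι ι κ)ˣ) : Matrix ι ι κ) * ρ Y) := by
          ext a b
          simp only [Matrix.sub_apply, Matrix.map_apply, Matrix.neg_apply, frobenius_def]
          rw [← neg_sub, hs]
        rw [e2, ← hD, mul_neg, ← mul_assoc, Units.mul_inv, one_mul, add_neg_cancel]
      · rw [add_sub_cancel_left]
        exact dvd_mul_right _ _)
  refine ⟨L, ?_, ?_⟩
  · obtain ⟨X, ⟨hX, -⟩, h⟩ := hL 1 le_rfl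
    rw [pow_one, hdvd, map_sub, sub_eq_zero] at h
    apply isUnit_matrix_wittVector
    change IsUnit (ρ L)
    rw [h, hX]
    exact hC₁
  · refine sub_eq_zero.1 (hpc.sep _ fun k => ?_)
    rcases Nat.eq_zero_or_pos k with rfl | hk
    · simp
    · obtain ⟨X, ⟨-, hX⟩, h⟩ := hL k hk
      have e : B * σ L - L = (B * σ X - X) + B * σ (L - X) - (L - X) := by
        rw [map_sub, mul_sub]; abel
      rw [e]
      exact dvd_sub (dvd_add hX (natCast_pow_dvd_mul_left _ (map_natCast_pow_dvd _ h))) h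

end Lang

/-! ### The semilinear substitution t_i ↦ t_i^p -/

section FrobExpand

variable {p : ℕ} (hp : p ≠ 0) {R S : Type*} [CommRing R] [CommRing S] {n : ℕ}

/-- The `σ`-semilinear endomorphism of `R[[t_1, …, t_n]]` with `t_i ↦ t_i ^ p`. -/
def frobExpand (σ : R →+* R) : MvPowerSeries (Fin n) R →+* MvPowerSeries (Fin n) R :=
  (expand p hp : MvPowerSeries (Fin n) R →ₐ[R] MvPowerSeries (Fin n) R).toRingHom.comp
    (MvPowerSeries.map σ)

theorem coeff_frobExpand_smul (σ : R →+* R) (f : MvPowerSeries (Fin n) R) (m : Fin n →₀ ℕ) :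
    coeff (p • m) (frobExpand hp σ f) = σ (coeff m f) := by
  change coeff (p • m) (expand p hp (MvPowerSeries.map σ f)) = _
  rw [coeff_expand_smul, coeff_map]

theorem coeff_frobExpand_eq_zero (σ : R →+* R) (f : MvPowerSeries (Fin n) R) {d : Fin n →₀ ℕ}
    (h : ∀ m : Fin n →₀ ℕ, d ≠ p • m) : coeff d (frobExpand hp σ f) = 0 := by
  change coeff d (expand p hp (MvPowerSeries.map σ f)) = _
  by_cases hd : ∀ i, p ∣ d i
  · choose m hm using hd
    exact absurd (by ext i; simp [hm i]) (h (Finsupp.equivFunOnFinite.symm m))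
  · push Not at hd
    obtain ⟨i, hi⟩ := hd
    exact coeff_expand_of_not_dvd p hp _ hi

theorem constantCoeff_frobExpand (σ : R →+* R) (f : MvPowerSeries (Fin n) R) :
    constantCoeff (frobExpand hp σ f) = σ (constantCoeff f) := by
  have := coeff_frobExpand_smul hp σ f 0
  rwa [smul_zero] at this

theorem frobExpand_C (σ : R →+* R) (r : R) :
    frobExpand (n := n) hp σ (C r) = C (σ r) := by
  change expand p hp (MvPowerSeries.map σ (C r)) = _
  rw [map_C, expand_C]

theorem frobExpand_X (σ : R →+* R) (i : Fin n) : frobExpand hp σ (X i) = X i ^ p := by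
  change expand p hp (MvPowerSeries.map σ (X i)) = _
  rw [map_X, expand_X]

theorem map_frobExpand (σ : R →+* R) (τ : S →+* S) (g : R →+* S) (h : g.comp σ = τ.comp g)
    (f : MvPowerSeries (Fin n) R) :
    MvPowerSeries.map g (frobExpand hp σ f) = frobExpand hp τ (MvPowerSeries.map g f) := by
  change MvPowerSeries.map g (expand p hp (MvPowerSeries.map σ f)) =
    expand p hp (MvPowerSeries.map τ (MvPowerSeries.map g f))
  rw [map_expand, MvPowerSeries.map_map, MvPowerSeries.map_map, h]

/-- This is the chain rule. Its factor p t_j^(p-1) is what makes horizontality a contraction. -/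
theorem pderiv_frobExpand (σ : R →+* R) (j : Fin n) (f : MvPowerSeries (Fin n) R) :
    pderiv R j (frobExpand hp σ f) = (p : MvPowerSeries (Fin n) R) * X j ^ (p - 1) * frobExpand hp σ (pderiv R j f) := by
  classical
  ext d
  rw [coeff_pderiv, mul_assoc, ← map_natCast (C (σ := Fin n) (R := R)), coeff_C_mul, X_pow_eq,
    coeff_monomial_mul]
  have hpos : 1 ≤ p := Nat.one_le_iff_ne_zero.2 hp
  by_cases h : ∃ m, d + Finsupp.single j 1 = p • m
  · obtain ⟨m, hm⟩ := h
    have hmj : m j ≠ 0 := by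
      intro h0
      have := DFunLike.congr_fun hm j
      simp [h0] at this
    obtain ⟨m', rfl⟩ : ∃ m', m = m' + Finsupp.single j 1 :=
      ⟨m - Finsupp.single j 1, (tsub_add_cancel_of_le (by simpa using Nat.one_le_iff_ne_zero.2 hmj)).symm⟩
    have hd : d = Finsupp.single j (p - 1) + p • m' := by
      have : d + Finsupp.single j 1 = (Finsupp.single j (p - 1) + p • m') + Finsupp.single j 1 := by
        rw [hm, add_right_comm, ← Finsupp.single_add, Nat.sub_add_cancel hpos, smul_add,
          Finsupp.smul_single, smul_eq_mul, mul_one, add_comm]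
      exact add_right_cancel this
    rw [hm, coeff_frobExpand_smul, hd, if_pos le_self_add, add_tsub_cancel_left,
      coeff_frobExpand_smul, coeff_pderiv, map_mul]
    simp only [Finsupp.add_apply, Finsupp.single_eq_same, Finsupp.smul_apply, smul_eq_mul, map_add,
      map_natCast, map_one, one_mul, Nat.cast_add, Nat.cast_mul, Nat.cast_sub hpos, Nat.cast_one]
    ring
  · rw [coeff_frobExpand_eq_zero hp σ f (fun m hm => h ⟨m, hm⟩), zero_mul]
    split_ifs with hle
    · rw [coeff_frobExpand_eq_zero, mul_zero, mul_zero]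
      intro m hm
      apply h
      refine ⟨m + Finsupp.single j 1, ?_⟩
      rw [smul_add, ← hm, Finsupp.smul_single, smul_eq_mul, mul_one]
      have : Finsupp.single j p = Finsupp.single j (p - 1) + Finsupp.single j 1 := by
        rw [← Finsupp.single_add, Nat.sub_add_cancel hpos]
      rw [this, ← add_assoc, tsub_add_cancel_of_le hle]
    · rw [mul_zero]

/-- A nonzero exponent p • m has strictly larger degree than m, so the substitution pushes
disagreement upwards. Only the constant term stays in place, hence its separate hypothesis. -/
theorem coeff_frobExpand_congr (h1 : 1 < p) (σ : R →+* R) {f g : MvPowerSeries (Fin n) R} {k : ℕ}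
    (h0 : constantCoeff f = constantCoeff g)
    (hfg : ∀ d : Fin n →₀ ℕ, d.degree < k → coeff d f = coeff d g) (d : Fin n →₀ ℕ)
    (hd : d.degree < k + 1) :
    coeff d (frobExpand hp σ f) = coeff d (frobExpand hp σ g) := by
  by_cases h : ∃ m, d = p • m
  · obtain ⟨m, rfl⟩ := h
    rw [coeff_frobExpand_smul, coeff_frobExpand_smul]
    by_cases hm : m = 0
    · subst hm
      exact congrArg σ h0
    · rw [hfg]
      have hm' : 0 < m.degree := Nat.pos_of_ne_zero fun h => hm ((Finsupp.degree_eq_zero_iff m).1 h)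
      have : (p • m).degree = p * m.degree := by rw [map_nsmul, smul_eq_mul]
      rw [this] at hd
      nlinarith
  · rw [coeff_frobExpand_eq_zero hp σ f (fun m hm => h ⟨m, hm⟩),
      coeff_frobExpand_eq_zero hp σ g (fun m hm => h ⟨m, hm⟩)]

theorem coeff_mul_congr {f f' g g' : MvPowerSeries (Fin n) R} {k : ℕ}
    (hf : ∀ d : Fin n →₀ ℕ, d.degree < k → coeff d f = coeff d f')
    (hg : ∀ d : Fin n →₀ ℕ, d.degree < k → coeff d g = coeff d g') (d : Fin n →₀ ℕ)
    (hd : d.degree < k) : coeff d (f * g) = coeff d (f' * g') := by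
  classical
  rw [coeff_mul, coeff_mul]
  refine Finset.sum_congr rfl fun x hx => ?_
  have : x.1.degree + x.2.degree = d.degree := by
    rw [← map_add, Finset.HasAntidiagonal.mem_antidiagonal.1 hx]
  rw [hf _ (by omega), hg _ (by omega)]

end FrobExpand

/-! ### The lift of Frobenius t_i ↦ t_i^p -/

section PowLift

variable {p : ℕ} [Fact p.Prime] {κ : Type*} [Field κ] [CharP κ p] [PerfectRing κ p]

variable (p κ) in
/-- The lift of Frobenius with `t_i ↦ t_i ^ p`. -/
def powLift (n : ℕ) : FrobLift p κ n where
  toRingHom := frobExpand (Fact.out : p.Prime).ne_zero WittVector.frobenius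
  map_C w := frobExpand_C _ _ w
  mod_p a := by
    have hp : p ≠ 0 := (Fact.out : p.Prime).ne_zero
    have hc : (WittVector.constantCoeff (p := p) (R := κ)).comp WittVector.frobenius =
        (frobenius κ p).comp WittVector.constantCoeff := by
      ext x
      exact WittVector.coeff_frobenius_charP p x 0
    have key : MvPowerSeries.map (WittVector.constantCoeff (p := p) (R := κ))
        (frobExpand hp WittVector.frobenius a - a ^ p) = 0 := by
      rw [map_sub, map_frobExpand hp _ (frobenius κ p) _ hc, map_pow,
        ← map_frobenius_expand p hp, map_expand]
      exact sub_self _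
    have := natCast_pow_dvd_mvPowerSeries_iff (p := p) (k := 1)
      (f := frobExpand hp (WittVector.frobenius (p := p) (R := κ)) a - a ^ p)
    rw [pow_one, pow_one] at this
    rw [this]
    intro d
    rw [p_dvd_iff_constantCoeff, ← coeff_map, key, map_zero]

theorem powLift_X (n : ℕ) (i : Fin n) : (powLift p κ n).toRingHom (X i) = X i ^ p :=
  frobExpand_X _ _ i

theorem isUnit_matrix_PS {ι : Type*} [Fintype ι] [DecidableEq ι] {n : ℕ}
    {M : Matrix ι ι (PS p κ n)}
    (h : IsUnit ((MvPowerSeries.constantCoeff (σ := Fin n) (R := WittVector p κ)).mapMatrix M)) :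
    IsUnit M := by
  rw [Matrix.isUnit_iff_isUnit_det] at h ⊢
  rw [MvPowerSeries.isUnit_iff_constantCoeff, RingHom.map_det]
  exact h

end PowLift

/-! ### Lang's theorem over W(κ)[[t_1, …, t_n]] -/

section Lang

variable {p : ℕ} [Fact p.Prime] {κ : Type*} [Field κ] [CharP κ p] [IsAlgClosed κ]

/-- Lang's theorem for `GL` over `W(κ)[[t_1, …, t_n]]`. -/
theorem exists_isUnit_mul_map_powLift_eq {ι : Type*} [Fintype ι] [DecidableEq ι] {n : ℕ}
    (B : Matrix ι ι (PS p κ n)) (hB : IsUnit B) :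
    ∃ C : Matrix ι ι (PS p κ n), IsUnit C ∧ B * (powLift p κ n).toRingHom.mapMatrix C = C := by
  classical
  have hp : p ≠ 0 := (Fact.out : p.Prime).ne_zero
  set c := (MvPowerSeries.constantCoeff (σ := Fin n) (R := WittVector p κ)).mapMatrix (m := ι)
  obtain ⟨C₀, hC₀, hBC₀⟩ := exists_isUnit_mul_map_wittFrobenius_eq (p := p) (c B) (hB.map c)
  -- The substitution is a contraction only in positive degrees. So `r` overwrites the constant
  -- terms by the solution C₀ already found over the Witt vectors, and the equation in degree 0 is
  -- checked separately at the end.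
  let r : Matrix ι ι (PS p κ n) → Matrix ι ι (PS p κ n) := fun X => Matrix.of fun a b =>
    X a b - C (constantCoeff (X a b)) + C (C₀ a b)
  have hr0 : ∀ X a b, constantCoeff (r X a b) = C₀ a b := by
    intro X a b
    simp [r]
  have hr1 : ∀ X a b (d : Fin n →₀ ℕ), d ≠ 0 → coeff d (r X a b) = coeff d (X a b) := by
    intro X a b d hd
    simp [r, coeff_C, hd]
  obtain ⟨X, hX⟩ := exists_fixedPoint_of_degree_contraction
    (fun X => r (B * (powLift p κ n).toRingHom.mapMatrix (r X))) (by
      intro k X Y hXY a b d hd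
      by_cases hd0 : d = 0
      · subst hd0
        exact (hr0 _ _ _).trans (hr0 _ _ _).symm
      · rw [hr1 _ _ _ _ hd0, hr1 _ _ _ _ hd0, Matrix.mul_apply, Matrix.mul_apply, map_sum, map_sum]
        refine Finset.sum_congr rfl fun x _ => ?_
        refine coeff_mul_congr (fun _ _ => rfl) (fun e he => ?_) d hd
        refine coeff_frobExpand_congr hp (Fact.out : p.Prime).one_lt _ ?_ (fun e' he' => ?_) e he
        · rw [hr0, hr0]
        · by_cases he0 : e' = 0
          · subst he0
            exact (hr0 _ _ _).trans (hr0 _ _ _).symm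
          · rw [hr1 _ _ _ _ he0, hr1 _ _ _ _ he0, hXY _ _ _ he'])
  have hrX : r X = X := by
    conv_rhs => rw [← hX]
    ext a b d : 2
    by_cases hd : d = 0
    · subst hd
      exact (hr0 _ _ _).trans (hr0 _ _ _).symm
    · rw [hr1 _ _ _ _ hd, hr1 _ _ _ _ hd, ← hr1 (B * _) _ _ _ hd]
      exact (congrArg (fun M : Matrix ι ι (PS p κ n) => coeff d (M a b)) hX).symm
  have hcX : c X = C₀ := by
    ext1 a b
    rw [← hrX]
    exact hr0 _ _ _
  refine ⟨X, isUnit_matrix_PS (by change IsUnit (c X); rw [hcX]; exact hC₀), ?_⟩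
  have hX' : r (B * (powLift p κ n).toRingHom.mapMatrix X) = X := by
    have := hX
    simp only [hrX] at this
    exact this
  ext a b d : 2
  by_cases hd : d = 0
  · subst hd
    have e1 : c (B * (powLift p κ n).toRingHom.mapMatrix X) = c X := by
      rw [map_mul, hcX]
      conv_rhs => rw [← hBC₀]
      congr 1
      ext1 a b
      change constantCoeff (frobExpand hp _ (X a b)) = _
      rw [constantCoeff_frobExpand, ← hcX]
      rfl
    exact congrFun (congrFun e1 a) b
  · conv_rhs => rw [← hX']
    rw [hr1 _ _ _ _ hd]

end Lang

/-! ### Finite free modules over W(κ)[[t]] and their reduction modulo p -/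

section Modules

variable {p : ℕ} [Fact p.Prime] {κ : Type v} [Field κ] [CharP κ p] {n : ℕ}
  {H : Type u} [AddCommGroup H] [Module (PS p κ n) H]

theorem p_ne_zero_PS : (p : PS p κ n) ≠ 0 := Nat.cast_ne_zero.2 (Fact.out : p.Prime).ne_zero

theorem nsmul_pow_eq_smul (k : ℕ) (x : H) : p ^ k • x = ((p : PS p κ n) ^ k) • x := by
  rw [← Nat.cast_pow, Nat.cast_smul_eq_nsmul]

theorem nsmul_pow_injective (κ : Type v) [Field κ] [CharP κ p] (n : ℕ) {H : Type u} [AddCommGroup H]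
    [Module (PS p κ n) H] [Module.Free (PS p κ n) H] (k : ℕ) :
    Function.Injective fun x : H => p ^ k • x := by
  intro x y h
  simp only [nsmul_pow_eq_smul (κ := κ) (n := n)] at h
  exact smul_right_injective H (pow_ne_zero k p_ne_zero_PS) h

theorem dvd_repr_of_eq_nsmul {ι : Type*} (e : Module.Basis ι (PS p κ n) H) {k : ℕ} {x y : H}
    (h : x = p ^ k • y) (a : ι) : (p : PS p κ n) ^ k ∣ e.repr x a := by
  rw [h, nsmul_pow_eq_smul (κ := κ) (n := n), map_smul]
  exact ⟨e.repr y a, rfl⟩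

variable [PerfectRing κ p]

theorem eq_zero_of_forall_eq_nsmul [Module.Free (PS p κ n) H] {x : H}
    (h : ∀ k : ℕ, ∃ y : H, x = p ^ k • y) : x = 0 := by
  let e := Module.Free.chooseBasis (PS p κ n) H
  apply e.ext_elem
  intro a
  rw [map_zero, Finsupp.zero_apply]
  refine (padicallyComplete_PS n).sep _ fun k => ?_
  obtain ⟨y, hy⟩ := h k
  exact dvd_repr_of_eq_nsmul e hy a

theorem pIdeal_le_jacobson : pIdeal p κ n ≤ (⊥ : Ideal (PS p κ n)).jacobson := by
  rw [IsLocalRing.jacobson_eq_maximalIdeal _ bot_ne_top, Ideal.span_singleton_le_iff_mem,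
    IsLocalRing.mem_maximalIdeal, mem_nonunits_iff, MvPowerSeries.isUnit_iff_constantCoeff,
    map_natCast, isUnit_wittVector_iff, map_natCast, CharP.cast_eq_zero]
  simp

/-- Nakayama's lemma, p being in the Jacobson radical. -/
theorem le_of_forall_exists_add_nsmul {S N : Submodule (PS p κ n) H} (hN : N.FG)
    (h : ∀ x ∈ N, ∃ s ∈ S, ∃ y ∈ N, x = s + p • y) : N ≤ S := by
  refine Submodule.le_of_le_smul_of_le_jacobson_bot hN pIdeal_le_jacobson fun x hx => ?_
  obtain ⟨s, hs, y, hy, rfl⟩ := h x hx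
  refine Submodule.add_mem_sup hs ?_
  rw [← Nat.cast_smul_eq_nsmul (PS p κ n)]
  exact Submodule.smul_mem_smul (Ideal.mem_span_singleton_self _) hy

theorem mem_pIdeal_smul_top_iff (x : H) :
    x ∈ pIdeal p κ n • (⊤ : Submodule (PS p κ n) H) ↔ ∃ y : H, x = p • y := by
  rw [Submodule.ideal_span_singleton_smul, Submodule.mem_smul_pointwise_iff_exists]
  simp only [Submodule.mem_top, true_and, Nat.cast_smul_eq_nsmul, eq_comm]

theorem red_eq_zero_iff (x : H) : red p κ n H x = 0 ↔ ∃ y : H, x = p • y := by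
  rw [← mem_pIdeal_smul_top_iff (κ := κ) (n := n)]
  exact Submodule.Quotient.mk_eq_zero _

theorem red_eq_iff (x y : H) : red p κ n H x = red p κ n H y ↔ ∃ z : H, x = y + p • z := by
  rw [← sub_eq_zero, ← map_sub, red_eq_zero_iff]
  exact exists_congr fun z => sub_eq_iff_eq_add'

theorem red_surjective : Function.Surjective (red p κ n H) := Submodule.mkQ_surjective _

/-- A finite family that reduces to a basis modulo `p` is a basis. -/
theorem exists_basis_of_red {ι : Type*} [Fintype ι] [Module.Free (PS p κ n) H]
    [Module.Finite (PS p κ n) H] (b : Module.Basis ι (PS0 p κ n) (Red p κ n H)) (f : ι → H)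
    (hf : ∀ i, red p κ n H (f i) = b i) :
    ∃ e : Module.Basis ι (PS p κ n) H, ⇑e = f := by
  have hsurj : Function.Surjective (Ideal.Quotient.mk (pIdeal p κ n)) := Ideal.Quotient.mk_surjective
  have hspan : (⊤ : Submodule (PS p κ n) H) ≤ Submodule.span (PS p κ n) (Set.range f) := by
    refine le_of_forall_exists_add_nsmul Module.Finite.fg_top fun x _ => ?_
    choose c hc using fun i => hsurj (b.repr (red p κ n H x) i)
    have : red p κ n H x = red p κ n H (∑ i, c i • f i) := by
      rw [map_sum, ← b.sum_repr (red p κ n H x)]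
      refine Finset.sum_congr rfl fun i _ => ?_
      rw [map_smulₛₗ, hc, hf]
    obtain ⟨z, hz⟩ := (red_eq_iff x _).1 this
    exact ⟨_, Submodule.sum_mem _ fun i _ => Submodule.smul_mem _ _
      (Submodule.subset_span ⟨i, rfl⟩), z, trivial, hz⟩
  -- A relation is trivial modulo p, so its coefficients are divisible by p. Dividing by p gives
  -- another relation, and the descent never stops.
  have key : ∀ (k : ℕ) (c : ι → PS p κ n), ∑ i, c i • f i = 0 → ∀ i, (p : PS p κ n) ^ k ∣ c i := by
    intro k
    induction k with
    | zero => intro c _ i; simp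
    | succ k ih =>
      intro c hc
      have h1 : ∀ i, ∃ d, c i = p * d := by
        intro i
        have h2 := congrArg (red p κ n H) hc
        rw [map_sum, map_zero] at h2
        simp_rw [map_smulₛₗ, hf] at h2
        have h3 := (Fintype.linearIndependent_iff.1 b.linearIndependent) _ h2 i
        rw [Ideal.Quotient.eq_zero_iff_mem, Ideal.mem_span_singleton] at h3
        exact h3
      choose d hd using h1
      have h4 : ∑ i, d i • f i = 0 := by
        refine smul_right_injective H (p_ne_zero_PS (p := p) (κ := κ) (n := n)) ?_
        simp only [smul_zero, Finset.smul_sum, ← mul_smul, ← hd, hc]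
      intro i
      rw [hd, pow_succ']
      exact mul_dvd_mul_left _ (ih d h4 i)
  have hli : LinearIndependent (PS p κ n) f := by
    rw [Fintype.linearIndependent_iff]
    intro c hc i
    exact (padicallyComplete_PS n).sep _ fun k => key k c hc i
  exact ⟨Module.Basis.mk hli hspan, Module.Basis.coe_mk _ _⟩

end Modules

/-! ### Divisibility of divided powers -/

section DividedPowers

variable {p : ℕ} [Fact p.Prime] {κ : Type v} [Field κ] [CharP κ p] {n : ℕ}

theorem dpow_zero {x : PS p κ n} (hx : (p : PS p κ n) ∣ x) : dpow x 0 = 1 := by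
  simpa using factorial_mul_dpow hx 0

/-- For m < p the factorial is prime to p. For m ≥ p, Legendre's formula and a positive digit sum
give (p - 1) v ≤ m - 1 for the valuation v of m!, which suffices. The consequence is that x^m / m!
is divisible by p^min(m, p-1) when p divides x. -/
theorem le_sub_padicValNat_factorial (m : ℕ) :
    min m (p - 1) + padicValNat p m.factorial ≤ m := by
  have hp := (Fact.out : p.Prime).two_le
  rcases lt_or_ge m p with h | h
  · rw [padicValNat.eq_zero_of_not_dvd]
    · exact min_le_left _ _
    · rw [(Fact.out : p.Prime).dvd_factorial]; omega
  · have h1 := sub_one_mul_padicValNat_factorial (p := p) m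
    have h2 : 0 < (Nat.digits p m).sum := by
      rw [Nat.pos_iff_ne_zero]
      intro h0
      rw [List.sum_eq_zero_iff] at h0
      have hm : m ≠ 0 := by omega
      exact Nat.getLast_digit_ne_zero p hm (h0 _ (List.getLast_mem (Nat.digits_ne_nil_iff_ne_zero.2 hm)))
    obtain ⟨q, rfl⟩ : ∃ q, p = q + 1 := ⟨p - 1, by omega⟩
    simp only [Nat.add_sub_cancel] at h1 ⊢
    have h3 : q * padicValNat (q + 1) m.factorial + 1 ≤ m := by
      have : (Nat.digits (q + 1) m).sum ≤ m := Nat.digit_sum_le _ _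
      omega
    have h4 : min m q ≤ q := min_le_right _ _
    by_contra hc
    push Not at hc
    set w := padicValNat (q + 1) m.factorial
    have h5 : m + 1 ≤ q + w := by omega
    have h6 : q * (m + 1) ≤ q * q + q * w := by rw [← mul_add]; exact Nat.mul_le_mul_left _ h5
    nlinarith

theorem pow_min_dvd_dpow {x : PS p κ n} (hx : (p : PS p κ n) ∣ x) (m : ℕ) :
    (p : PS p κ n) ^ min m (p - 1) ∣ dpow x m := by
  have hp : p.Prime := Fact.out
  have h1 := factorial_mul_dpow hx m
  obtain ⟨z, rfl⟩ := hx
  obtain ⟨c, hc⟩ : p ^ padicValNat p m.factorial ∣ m.factorial := pow_padicValNat_dvd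
  have hcp : ¬ p ∣ c := by
    rintro ⟨d, rfl⟩
    have : p ^ (padicValNat p m.factorial + 1) ∣ m.factorial :=
      ⟨d, by rw [pow_succ, mul_assoc]; exact hc⟩
    exact pow_succ_padicValNat_not_dvd (Nat.factorial_ne_zero m) this
  have hcop : IsCoprime ((p : PS p κ n) ^ min m (p - 1)) (c : PS p κ n) := by
    apply IsCoprime.pow_left
    have : IsCoprime (p : ℤ) c := Nat.isCoprime_iff_coprime.2 ((Nat.Prime.coprime_iff_not_dvd hp).2 hcp)
    simpa using this.map (Int.castRingHom (PS p κ n))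
  apply hcop.dvd_of_dvd_mul_left
  set w := padicValNat p m.factorial with hw
  have hle : min m (p - 1) ≤ m - w := by
    have := le_sub_padicValNat_factorial (p := p) m
    omega
  have hw' : w ≤ m := by
    have := le_sub_padicValNat_factorial (p := p) m
    omega
  have h2 : (p : PS p κ n) ^ w * (c * dpow ((p : PS p κ n) * z) m) =
      (p : PS p κ n) ^ w * (p ^ (m - w) * z ^ m) := by
    rw [← mul_assoc, ← mul_assoc, ← pow_add, Nat.add_sub_cancel' hw', ← mul_pow, ← h1]
    congr 1
    rw [hc]
    push_cast
    rfl
  rw [mul_left_cancel₀ (pow_ne_zero _ p_ne_zero_PS) h2]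
  exact (pow_dvd_pow _ hle).mul_right _

theorem p_dvd_frobLift_sub (φ ψ : FrobLift p κ n) (a : PS p κ n) :
    (p : PS p κ n) ∣ φ.toRingHom a - ψ.toRingHom a := by
  have := dvd_sub (φ.mod_p a) (ψ.mod_p a)
  rwa [sub_sub_sub_cancel_right] at this

/-- The coefficients `∏_j (φ(t_j) - ψ(t_j)) ^ m_j / m_j!` of the Taylor expansion. -/
def taylorCoeff (φ ψ : FrobLift p κ n) (m : Fin n →₀ ℕ) : PS p κ n :=
  ∏ j : Fin n, dpow (φ.toRingHom (X j) - ψ.toRingHom (X j)) (m j)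

theorem taylorCoeff_zero (φ ψ : FrobLift p κ n) : taylorCoeff φ ψ 0 = 1 :=
  Finset.prod_eq_one fun _ _ => dpow_zero (p_dvd_frobLift_sub φ ψ _)

theorem pow_min_dvd_taylorCoeff (φ ψ : FrobLift p κ n) (m : Fin n →₀ ℕ) :
    (p : PS p κ n) ^ min m.degree (p - 1) ∣ taylorCoeff φ ψ m := by
  have h1 : (p : PS p κ n) ^ ∑ j : Fin n, min (m j) (p - 1) ∣ taylorCoeff φ ψ m := by
    rw [← Finset.prod_pow_eq_pow_sum]
    exact Finset.prod_dvd_prod_of_dvd _ _ fun j _ =>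
      pow_min_dvd_dpow (p_dvd_frobLift_sub φ ψ _) _
  refine (pow_dvd_pow _ ?_).trans h1
  rw [Finsupp.degree_eq_sum]
  generalize p - 1 = q
  have : ∀ s : Finset (Fin n), min (∑ j ∈ s, m j) q ≤ ∑ j ∈ s, min (m j) q := by
    intro s
    induction s using Finset.induction_on with
    | empty => simp
    | insert a s ha ih => rw [Finset.sum_insert ha, Finset.sum_insert ha]; omega
  exact this _

end DividedPowers

/-! ### Iterated derivations -/

section IterD

variable {H V : Type*} [AddCommGroup H] [AddCommGroup V] {n : ℕ}

theorem end_mul_apply (f g : AddMonoid.End H) (x : H) : (f * g) x = f (g x) := rfl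

/-- `D_1 ^ m_1 ⋯ D_n ^ m_n`. -/
def iterD (D : Fin n → AddMonoid.End H) (m : Fin n →₀ ℕ) : AddMonoid.End H :=
  (List.ofFn fun j : Fin n => D j ^ m j).prod

theorem iterD_zero (D : Fin n → AddMonoid.End H) : iterD D 0 = 1 := by
  simp [iterD]

theorem iterD_map (q : H →+ V) (D : Fin n → AddMonoid.End H) (D' : Fin n → AddMonoid.End V)
    (h : ∀ j x, q (D j x) = D' j (q x)) (m : Fin n →₀ ℕ) (x : H) :
    q (iterD D m x) = iterD D' m (q x) := by
  have hpow : ∀ j k x, q ((D j ^ k) x) = (D' j ^ k) (q x) := by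
    intro j k x
    induction k generalizing x with
    | zero => rfl
    | succ k ih => rw [pow_succ, pow_succ, end_mul_apply, end_mul_apply, ih, h]
  have hl : ∀ (l : List (Fin n)) (x : H), q ((l.map fun j => D j ^ m j).prod x) =
      (l.map fun j => D' j ^ m j).prod (q x) := by
    intro l
    induction l with
    | nil => intro x; rfl
    | cons a l ih =>
      intro x
      rw [List.map_cons, List.map_cons, List.prod_cons, List.prod_cons, end_mul_apply,
        end_mul_apply, hpow, ih]
  have := hl (List.finRange n) x
  rwa [← List.ofFn_eq_map, ← List.ofFn_eq_map] at this

/-- Iterating operators that lower a decreasing filtration by one step. -/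
theorem iterD_mem_of_lowering (D : Fin n → AddMonoid.End H) {S : Type*} [SetLike S H]
    (Fil : ℕ → S) (h : ∀ i j x, x ∈ Fil i → D j x ∈ Fil (i - 1)) (m : Fin n →₀ ℕ) (i : ℕ) {x : H}
    (hx : x ∈ Fil i) : iterD D m x ∈ Fil (i - m.degree) := by
  have hpow : ∀ j k i x, x ∈ Fil i → (D j ^ k) x ∈ Fil (i - k) := by
    intro j k
    induction k with
    | zero => intro i x hx; simpa using hx
    | succ k ih =>
      intro i x hx
      rw [pow_succ, end_mul_apply]
      have := ih _ _ (h i j x hx)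
      rwa [Nat.sub_sub, Nat.add_comm] at this
  have hl : ∀ (l : List (Fin n)) (i : ℕ) (x : H), x ∈ Fil i →
      (l.map fun j => D j ^ m j).prod x ∈ Fil (i - (l.map m).sum) := by
    intro l
    induction l with
    | nil => intro i x hx; simpa using hx
    | cons a l ih =>
      intro i x hx
      rw [List.map_cons, List.map_cons, List.prod_cons, end_mul_apply, List.sum_cons,
        Nat.add_comm, ← Nat.sub_sub]
      exact hpow _ _ _ _ (ih i x hx)
  have := hl (List.finRange n) i x hx
  rw [← List.ofFn_eq_map, ← List.ofFn_eq_map, List.sum_ofFn, ← Finsupp.degree_eq_sum] at this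
  exact this

theorem iterD_mem (D : Fin n → AddMonoid.End H) {S : Type*} [SetLike S H] (U : S)
    (h : ∀ j, ∀ x ∈ U, D j x ∈ U) (m : Fin n →₀ ℕ) {x : H} (hx : x ∈ U) : iterD D m x ∈ U :=
  iterD_mem_of_lowering D (fun _ => U) (fun _ j x hx => h j x hx) m 0 hx

end IterD

/-! ### Restriction, quotients and change of the Frobenius lift for F-crystals -/

section Crystal

variable {p : ℕ} [Fact p.Prime] {κ : Type v} [Field κ] [CharP κ p] {n : ℕ}
  {H : Type u} [AddCommGroup H] [Module (PS p κ n) H]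

theorem FCrystal.exists_taylor (Cr : FCrystal p κ n H) (φ ψ : FrobLift p κ n) (x : H) (r : ℕ) :
    ∃ S : Finset (Fin n →₀ ℕ), 0 ∈ S ∧ ∃ h : H,
      Cr.frob φ x = ∑ m ∈ S, taylorCoeff φ ψ m • Cr.frob ψ (iterD Cr.D m x) + p ^ r • h := by
  classical
  obtain ⟨S₀, hS⟩ := Cr.taylor φ ψ x r
  obtain ⟨h, hh⟩ := hS (insert 0 S₀) (Finset.subset_insert _ _)
  exact ⟨_, Finset.mem_insert_self _ _, h, sub_eq_iff_eq_add'.1 hh⟩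

/-- Approximating F modulo p^(m+1) is enough: from p^m x = s + p^(m+1) z one gets p^m (x - p z) ∈ M,
and Nakayama applies to the submodule of all x with p^m x ∈ M. -/
theorem mem_span_of_approx [PerfectRing κ p] [Module.Finite (PS p κ n) H]
    [Module.Free (PS p κ n) H] {M : Submodule (PS p κ n) H} {F : H → H}
    (h1 : ∀ x r, ∃ s ∈ M, ∃ h, F x = s + p ^ r • h) {m : ℕ}
    (h2 : ∀ x, p ^ m • x ∈ Submodule.span (PS p κ n) (Set.range F)) (x : H) : p ^ m • x ∈ M := by
  let M' : Submodule (PS p κ n) H := M.comap (LinearMap.lsmul (PS p κ n) H ((p : PS p κ n) ^ m))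
  have hM' : ∀ x, x ∈ M' ↔ p ^ m • x ∈ M := by
    intro x
    rw [nsmul_pow_eq_smul (κ := κ) (n := n)]
    rfl
  have h3 : ∀ y ∈ Submodule.span (PS p κ n) (Set.range F), ∃ s ∈ M, ∃ h, y = s + p ^ (m + 1) • h := by
    intro y hy
    induction hy using Submodule.span_induction with
    | mem y hy => obtain ⟨x, rfl⟩ := hy; exact h1 x _
    | zero => exact ⟨0, M.zero_mem, 0, by simp⟩
    | add y y' _ _ h h' =>
      obtain ⟨s, hs, z, rfl⟩ := h
      obtain ⟨s', hs', z', rfl⟩ := h'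
      exact ⟨s + s', M.add_mem hs hs', z + z', by rw [smul_add]; abel⟩
    | smul a y _ h =>
      obtain ⟨s, hs, z, rfl⟩ := h
      exact ⟨a • s, M.smul_mem _ hs, a • z, by rw [smul_add, smul_comm]⟩
  have : (⊤ : Submodule (PS p κ n) H) ≤ M' := by
    refine le_of_forall_exists_add_nsmul Module.Finite.fg_top fun x _ => ?_
    obtain ⟨s, hs, z, hz⟩ := h3 _ (h2 x)
    refine ⟨x - p • z, ?_, z, trivial, by abel⟩
    rw [hM', smul_sub, hz, ← mul_smul, ← pow_succ, add_sub_cancel_right]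
    exact hs
  exact (hM' x).1 (this trivial)

/-- The restriction of an `F`-crystal to a saturated stable submodule. -/
def FCrystal.restrict [PerfectRing κ p] (Cr : FCrystal p κ n H) (S : Submodule (PS p κ n) H)
    (hfree : Module.Free (PS p κ n) S) (hfin : Module.Finite (PS p κ n) S)
    (hsat : ∀ (k : ℕ) (x : H), p ^ k • x ∈ S → x ∈ S) (hD : ∀ j, ∀ x ∈ S, Cr.D j x ∈ S)
    (hF : ∀ φ, ∀ x ∈ S, Cr.frob φ x ∈ S) (φ₀ : FrobLift p κ n) (m₀ : ℕ)
    (hiso : ∀ x ∈ S, p ^ m₀ • x ∈ Submodule.span (PS p κ n) (Cr.frob φ₀ '' S)) :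
    FCrystal p κ n S :=
  let D' : Fin n → AddMonoid.End S := fun j =>
    { toFun := fun x => ⟨Cr.D j x, hD j x x.2⟩
      map_zero' := Subtype.ext (map_zero (Cr.D j))
      map_add' := fun x y => Subtype.ext (map_add (Cr.D j) (x : H) y) }
  let F' : ∀ φ : FrobLift p κ n, S →ₛₗ[φ.toRingHom] S := fun φ =>
    { toFun := fun x => ⟨Cr.frob φ x, hF φ x x.2⟩
      map_add' := fun x y => Subtype.ext (map_add (Cr.frob φ) (x : H) y)
      map_smul' := fun a x => Subtype.ext (map_smulₛₗ (Cr.frob φ) a (x : H)) }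
  have hiter : ∀ m (x : S), ((iterD D' m x : S) : H) = iterD Cr.D m x := fun m x =>
    iterD_map S.subtype.toAddMonoidHom D' Cr.D (fun _ _ => rfl) m x
  have htaylor : ∀ (φ ψ : FrobLift p κ n) (x : S),
      HasPadicSum p (fun m : Fin n →₀ ℕ => taylorCoeff φ ψ m • F' ψ (iterD D' m x)) (F' φ x) := by
    intro φ ψ x r
    obtain ⟨S₀, hS₀⟩ := Cr.taylor φ ψ x r
    refine ⟨S₀, fun S' hS' => ?_⟩
    obtain ⟨h, hh⟩ := hS₀ S' hS'
    have e : ((F' φ x - ∑ m ∈ S', taylorCoeff φ ψ m • F' ψ (iterD D' m x) : S) : H) =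
        p ^ r • h := by
      rw [← hh, Submodule.coe_sub, AddSubmonoidClass.coe_finsetSum]
      congr 1
      refine Finset.sum_congr rfl fun m _ => ?_
      change _ = taylorCoeff φ ψ m • Cr.frob ψ (iterD Cr.D m x)
      rw [← hiter]
      rfl
    have hmem : h ∈ S := hsat r h (by rw [← e]; exact Subtype.coe_prop _)
    exact ⟨⟨h, hmem⟩, Subtype.ext e⟩
  { free := hfree
    finite := hfin
    D := D'
    leibniz := fun i a x => Subtype.ext (Cr.leibniz i a x)
    comm := fun i j => by
      ext x
      exact congrArg (fun f : AddMonoid.End H => f x) (Cr.comm i j)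
    nilp := fun i r => by
      obtain ⟨M, hM⟩ := Cr.nilp i r
      refine ⟨M, fun m hm x => ?_⟩
      obtain ⟨y, hy⟩ := hM m hm x
      have e : ((D' i ^ m) x : H) = (Cr.D i ^ m) x := by
        clear hy hm
        induction m generalizing x with
        | zero => rfl
        | succ m ih =>
          rw [pow_succ, pow_succ, end_mul_apply, end_mul_apply, ih]
          rfl
      have hmem : y ∈ S := hsat r y (by rw [← hy, ← e]; exact Subtype.coe_prop _)
      exact ⟨⟨y, hmem⟩, Subtype.ext (e.trans hy)⟩
    frob := F'
    horizontal := fun φ j x => by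
      apply Subtype.ext
      rw [AddSubmonoidClass.coe_finsetSum]
      exact Cr.horizontal φ j x
    taylor := htaylor
    -- Only φ₀ is known to be an isogeny on S. The Taylor formula approximates its values by the
    -- span of those of ψ, with the same exponent m₀.
    isogeny := fun ψ => by
      refine ⟨m₀, fun x => mem_span_of_approx (F := F' φ₀) (fun x r => ?_) (fun x => ?_) x⟩
      · obtain ⟨S₀, hS₀⟩ := htaylor φ₀ ψ x r
        obtain ⟨h, hh⟩ := hS₀ S₀ subset_rfl
        exact ⟨_, Submodule.sum_mem _ fun m _ => Submodule.smul_mem _ _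
          (Submodule.subset_span ⟨_, rfl⟩), h, sub_eq_iff_eq_add'.1 hh⟩
      · have h1 := hiso x x.2
        have h2 : Cr.frob φ₀ '' S = S.subtype '' Set.range (F' φ₀) := by
          ext y
          constructor
          · rintro ⟨z, hz, rfl⟩
            exact ⟨_, ⟨⟨z, hz⟩, rfl⟩, rfl⟩
          · rintro ⟨_, ⟨z, rfl⟩, rfl⟩
            exact ⟨z, z.2, rfl⟩
        rw [h2, ← Submodule.map_span] at h1
        obtain ⟨y, hy, hy'⟩ := h1
        have : y = p ^ m₀ • x := Subtype.ext hy'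
        rwa [← this] }

/-- An `F`-crystal structure on a quotient, with Frobenius divided by `p ^ i`. -/
def FCrystal.quotient [PerfectRing κ p] (Cr : FCrystal p κ n H) {V : Type u} [AddCommGroup V]
    [Module (PS p κ n) V] (hfree : Module.Free (PS p κ n) V) (hfin : Module.Finite (PS p κ n) V)
    (q : H →ₗ[PS p κ n] V) (hq : Function.Surjective q) (i : ℕ) (D' : Fin n → AddMonoid.End V)
    (F' : ∀ φ : FrobLift p κ n, V →ₛₗ[φ.toRingHom] V)
    (hD : ∀ j x, q (Cr.D j x) = D' j (q x)) (hF : ∀ φ x, q (Cr.frob φ x) = p ^ i • F' φ (q x))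
    (hunit : ∀ φ x, x ∈ Submodule.span (PS p κ n) (Set.range (F' φ))) : FCrystal p κ n V where
  free := hfree
  finite := hfin
  D := D'
  leibniz j a x := by
    obtain ⟨x, rfl⟩ := hq x
    rw [← map_smul, ← hD, Cr.leibniz, map_add, map_smul, map_smul, hD]
  comm j k := by
    ext x
    obtain ⟨x, rfl⟩ := hq x
    rw [end_mul_apply, end_mul_apply, ← hD, ← hD, ← hD, ← hD]
    exact congrArg (fun f : AddMonoid.End H => q (f x)) (Cr.comm j k)
  nilp j r := by
    obtain ⟨M, hM⟩ := Cr.nilp j r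
    refine ⟨M, fun m hm x => ?_⟩
    obtain ⟨x, rfl⟩ := hq x
    obtain ⟨y, hy⟩ := hM m hm x
    refine ⟨q y, ?_⟩
    rw [← map_nsmul, ← hy]
    clear hy hm
    induction m generalizing x with
    | zero => rfl
    | succ m ih =>
      rw [pow_succ, pow_succ, end_mul_apply, end_mul_apply, ← hD, ih]
  frob := F'
  horizontal φ j x := by
    obtain ⟨x, rfl⟩ := hq x
    -- V is torsion-free, so an identity for F' may be checked after multiplication by p^i, where F'
    -- becomes the image of the given Frobenius.
    apply nsmul_pow_injective κ n i
    change p ^ i • D' j (F' φ (q x)) = p ^ i • _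
    rw [← map_nsmul, ← hF, ← hD, Cr.horizontal, map_sum, Finset.smul_sum]
    refine Finset.sum_congr rfl fun k _ => ?_
    rw [map_smul, hF, hD, smul_comm]
  taylor φ ψ x := by
    intro r
    obtain ⟨x, rfl⟩ := hq x
    obtain ⟨S₀, hS₀⟩ := Cr.taylor φ ψ x (i + r)
    refine ⟨S₀, fun S hS => ?_⟩
    obtain ⟨h, hh⟩ := hS₀ S hS
    refine ⟨q h, nsmul_pow_injective κ n i ?_⟩
    change p ^ i • _ = p ^ i • _
    rw [← mul_smul, ← pow_add, ← map_nsmul, ← hh, map_sub, map_sum, smul_sub, hF, Finset.smul_sum]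
    congr 1
    refine Finset.sum_congr rfl fun m _ => ?_
    rw [map_smul, hF, smul_comm]
    congr 3
    exact (iterD_map q.toAddMonoidHom Cr.D D' hD m x).symm
  isogeny φ := ⟨0, fun x => by rw [pow_zero, one_smul]; exact hunit φ x⟩

variable [PerfectRing κ p]

/-- The image of `F(φ)` does not depend on `φ`. -/
theorem FCrystal.imF_le (Cr : FCrystal p κ n H) (φ ψ : FrobLift p κ n) : Cr.imF φ ≤ Cr.imF ψ := by
  obtain ⟨m, hm⟩ := Cr.isogeny ψ
  refine Submodule.span_le.2 ?_
  rintro _ ⟨x, rfl⟩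
  -- Truncating modulo p^m puts the remainder in p^m H, which already lies in the image of F(ψ).
  obtain ⟨S, -, h, hh⟩ := Cr.exists_taylor φ ψ x m
  rw [hh]
  exact Submodule.add_mem _ (Submodule.sum_mem _ fun m _ => Submodule.smul_mem _ _
    (Submodule.subset_span ⟨_, rfl⟩)) (hm h)

theorem FCrystal.imF_eq (Cr : FCrystal p κ n H) (φ ψ : FrobLift p κ n) : Cr.imF φ = Cr.imF ψ :=
  le_antisymm (Cr.imF_le φ ψ) (Cr.imF_le ψ φ)

/-- For this lift φ(t_i) involves t_i alone, so the sum in horizontality has one term. Its factor p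
t_j^(p-1) drives the later contraction arguments. -/
theorem FCrystal.D_frob_powLift (Cr : FCrystal p κ n H) (j : Fin n) (x : H) :
    Cr.D j (Cr.frob (powLift p κ n) x) =
      ((p : PS p κ n) * X j ^ (p - 1)) • Cr.frob (powLift p κ n) (Cr.D j x) := by
  classical
  rw [Cr.horizontal, Finset.sum_eq_single j]
  · rw [powLift_X, pderiv_pow, pderiv_X_self, mul_one]
  · intro i _ hij
    rw [powLift_X, pderiv_pow, pderiv_X_of_ne hij, mul_zero, zero_smul]
  · simp

/-- A divisible Hodge filtration is divisible for all lifts of Frobenius. -/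
theorem FCrystal.frob_mem_of_divisible (Cr : FCrystal p κ n H)
    (Fil : ℕ → Submodule (PS p κ n) H) {N : ℕ} (hN : N < p) (h0 : Fil 0 = ⊤)
    (hgr : ∀ (i : ℕ) (j : Fin n), ∀ x ∈ Fil (i + 1), Cr.D j x ∈ Fil i)
    (hdiv : Cr.IsDivisible Fil N) (ψ : FrobLift p κ n) {i : ℕ} (hi : i ≤ N) {x : H}
    (hx : x ∈ Fil i) : ∃ y, Cr.frob ψ x = p ^ i • y := by
  obtain ⟨φ', hφ'⟩ := hdiv
  obtain ⟨S, -, h, hh⟩ := Cr.exists_taylor ψ φ' x i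
  have hterm : ∀ m, ∃ y, taylorCoeff ψ φ' m • Cr.frob φ' (iterD Cr.D m x) = p ^ i • y := by
    intro m
    have h1 : iterD Cr.D m x ∈ Fil (i - m.degree) := by
      refine iterD_mem_of_lowering Cr.D Fil (fun k j x hx => ?_) m i hx
      cases k with
      | zero => rw [Nat.zero_sub, h0]; trivial
      | succ k => exact hgr k j x hx
    obtain ⟨y, hy⟩ := hφ' _ (by omega) _ h1
    obtain ⟨c, hc⟩ := pow_min_dvd_taylorCoeff ψ φ' m
    -- Griffiths transversality loses |m| filtration steps and the divided powers give back min(|m|,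
    -- p - 1). The balance is at least i because i ≤ N ≤ p - 1.
    have hmin : i ≤ min m.degree (p - 1) + (i - m.degree) := by omega
    obtain ⟨k, hk⟩ := Nat.exists_eq_add_of_le hmin
    refine ⟨(c * p ^ k) • y, ?_⟩
    rw [hy, hc, nsmul_pow_eq_smul (κ := κ) (n := n), nsmul_pow_eq_smul (κ := κ) (n := n),
      ← mul_smul, ← mul_smul]
    congr 1
    calc (p : PS p κ n) ^ min m.degree (p - 1) * c * p ^ (i - m.degree)
        = p ^ (min m.degree (p - 1) + (i - m.degree)) * c := by rw [pow_add]; ring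
      _ = p ^ i * (c * p ^ k) := by rw [hk, pow_add]; ring
  choose y hy using hterm
  refine ⟨∑ m ∈ S, y m + h, ?_⟩
  rw [hh, smul_add, Finset.smul_sum]
  congr 1
  exact Finset.sum_congr rfl fun m _ => hy m

end Crystal

/-! ### Triangular normal form of an ordinary Frobenius matrix -/

section Factorization

variable {p : ℕ} [Fact p.Prime] {κ : Type*} [Field κ] [CharP κ p] {n : ℕ}

/-- Invertibility is detected over the residue field κ, where M and M' coincide. -/
theorem isUnit_matrix_of_dvd_sub [PerfectRing κ p] {ι : Type*} [Fintype ι] [DecidableEq ι]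
    {M M' : Matrix ι ι (PS p κ n)} (hM : IsUnit M) (h : (p : Matrix ι ι (PS p κ n)) ∣ M - M') :
    IsUnit M' := by
  apply isUnit_matrix_PS
  apply isUnit_matrix_wittVector
  rw [← RingHom.comp_apply]
  set ρ := ((WittVector.constantCoeff (p := p) (R := κ)).mapMatrix (m := ι)).comp
    ((MvPowerSeries.constantCoeff (σ := Fin n) (R := WittVector p κ)).mapMatrix (m := ι))
  obtain ⟨Z, hZ⟩ := h
  have h1 : ρ M = ρ M' := by
    rw [← sub_eq_zero, ← map_sub, hZ, map_mul, map_natCast]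
    have : ((p : ℕ) : Matrix ι ι κ) = 0 := by
      ext a b
      rw [Matrix.natCast_apply]
      simp
    rw [this, zero_mul]
  rw [← h1]
  exact hM.map ρ

/-- The strictly lower triangular part of a matrix with respect to `deg`. -/
def lowerPart {ι R : Type*} [Zero R] (deg : ι → ℕ) (M : Matrix ι ι R) : Matrix ι ι R :=
  Matrix.of fun a b => if deg b < deg a then M a b else 0

/-- The upper triangular part of a matrix with respect to `deg`. -/
def upperPart {ι R : Type*} [Zero R] (deg : ι → ℕ) (M : Matrix ι ι R) : Matrix ι ι R :=
  Matrix.of fun a b => if deg b < deg a then 0 else M a b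

theorem lowerPart_add_upperPart {ι R : Type*} [Ring R] (deg : ι → ℕ) (M : Matrix ι ι R) :
    lowerPart deg M + upperPart deg M = M := by
  ext a b
  by_cases h : deg b < deg a <;> simp [lowerPart, upperPart, h]

theorem blockTriangular_upperPart {ι R : Type*} [Zero R] (deg : ι → ℕ) (M : Matrix ι ι R) :
    (upperPart deg M).BlockTriangular deg := fun a b h => by simp [upperPart, h]

theorem natCast_pow_dvd_matrix_of {k : ℕ} {ι R : Type*} [CommRing R] [Fintype ι] [DecidableEq ι]
    {M M' : Matrix ι ι R} (h : (p : Matrix ι ι R) ^ k ∣ M)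
    (hM : ∀ a b, M' a b = 0 ∨ M a b ∣ M' a b) : (p : Matrix ι ι R) ^ k ∣ M' := by
  rw [natCast_pow_dvd_matrix_iff] at h ⊢
  intro a b
  rcases hM a b with h0 | h0
  · rw [h0]; exact dvd_zero _
  · exact (h a b).trans h0

/-- If `G` is invertible and block upper triangular modulo `p`, then Frobenius with matrix `G P`,
`P = diag(p ^ deg)`, can be made block upper triangular by a lower unitriangular change of basis. -/
theorem exists_lower_mul_upper [PerfectRing κ p] {ι : Type*} [Fintype ι] [DecidableEq ι]
    (φ : PS p κ n →+* PS p κ n) (deg : ι → ℕ) (G : Matrix ι ι (PS p κ n)) (hG : IsUnit G)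
    (hlow : ∀ a b, deg b < deg a → (p : PS p κ n) ∣ G a b) :
    ∃ L R : Matrix ι ι (PS p κ n), IsUnit L ∧ IsUnit R ∧ R.BlockTriangular deg ∧
      (∀ a b, deg a < deg b → L a b = 0) ∧
      G * Matrix.diagonal (fun a => (p : PS p κ n) ^ deg a) * φ.mapMatrix L =
        L * R * Matrix.diagonal (fun a => (p : PS p κ n) ^ deg a) := by
  set P : Matrix ι ι (PS p κ n) := Matrix.diagonal (fun a => (p : PS p κ n) ^ deg a) with hP
  let U := upperPart deg G
  obtain ⟨G', hG'⟩ : (p : Matrix ι ι (PS p κ n)) ∣ G - U := by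
    have := natCast_pow_dvd_matrix_iff (p := p) (k := 1) (M := G - U)
    rw [pow_one, pow_one] at this
    rw [this]
    intro a b
    by_cases h : deg b < deg a
    · simpa [U, upperPart, h] using hlow a b h
    · simp [U, upperPart, h]
  have hU : IsUnit U := isUnit_matrix_of_dvd_sub hG ⟨G', hG'⟩
  obtain ⟨V, hV⟩ := hU
  -- `θ` is chosen so that P φ(ℓ) = p θ P, where ℓ is the strictly lower part: moving P past a lower
  -- entry produces p^(deg a - deg b), at least one factor p, of which one is split off.
  let θ : Matrix ι ι (PS p κ n) → Matrix ι ι (PS p κ n) := fun X => Matrix.of fun a b =>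
    if deg b < deg a then (p : PS p κ n) ^ (deg a - deg b - 1) * φ (X a b) else 0
  have hθ : ∀ k X Y, (p : Matrix ι ι (PS p κ n)) ^ k ∣ X - Y →
      (p : Matrix ι ι (PS p κ n)) ^ k ∣ θ X - θ Y := by
    intro k X Y h
    refine natCast_pow_dvd_matrix_of (map_natCast_pow_dvd φ.mapMatrix h) fun a b => ?_
    by_cases hab : deg b < deg a
    · right
      refine ⟨(p : PS p κ n) ^ (deg a - deg b - 1), ?_⟩
      simp only [θ, Matrix.sub_apply, Matrix.of_apply, if_pos hab, RingHom.mapMatrix_apply,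
        Matrix.map_apply, map_sub]
      ring
    · left
      simp [θ, hab]
  have hl : ∀ k X Y, (p : Matrix ι ι (PS p κ n)) ^ k ∣ X - Y →
      (p : Matrix ι ι (PS p κ n)) ^ k ∣ lowerPart deg X - lowerPart deg Y := fun k X Y h =>
    natCast_pow_dvd_matrix_of h fun a b => by by_cases hab : deg b < deg a <;> simp [lowerPart, hab]
  have hu : ∀ k X Y, (p : Matrix ι ι (PS p κ n)) ^ k ∣ X - Y →
      (p : Matrix ι ι (PS p κ n)) ^ k ∣ upperPart deg X - upperPart deg Y := fun k X Y h =>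
    natCast_pow_dvd_matrix_of h fun a b => by by_cases hab : deg b < deg a <;> simp [upperPart, hab]
  -- Put G = U + p G', L = 1 + p ℓ(Q) and R = (1 + p u(Q)) U, with ℓ and u the lower and upper
  -- parts. The desired identity, divided by p, becomes Q U = G' + p (G θ(Q) - ℓ(Q) u(Q) U). The
  -- extra factor p makes it a contraction in Q.
  obtain ⟨Q, hQ⟩ := ((padicallyComplete_PS n).matrix ι).exists_fixedPoint
    (fun Q => (G' + (p : Matrix ι ι (PS p κ n)) *
      (G * θ Q - lowerPart deg Q * upperPart deg Q * U)) * (V⁻¹ : (Matrix ι ι (PS p κ n))ˣ)) (by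
    intro k X Y h
    rw [← sub_mul, add_sub_add_left_eq_sub, ← mul_sub, pow_succ']
    refine Dvd.dvd.mul_right (mul_dvd_mul_left _ ?_) _
    have e : G * θ X - lowerPart deg X * upperPart deg X * U -
        (G * θ Y - lowerPart deg Y * upperPart deg Y * U) =
        G * (θ X - θ Y) - ((lowerPart deg X - lowerPart deg Y) * (upperPart deg X * U) +
          lowerPart deg Y * ((upperPart deg X - upperPart deg Y) * U)) := by noncomm_ring
    rw [e]
    exact dvd_sub (natCast_pow_dvd_mul_left _ (hθ _ _ _ h)) (dvd_add ((hl _ _ _ h).mul_right _)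
      (natCast_pow_dvd_mul_left _ ((hu _ _ _ h).mul_right _))))
  have hQ' : Q * U = G' + (p : Matrix ι ι (PS p κ n)) *
      (G * θ Q - lowerPart deg Q * upperPart deg Q * U) := by
    conv_lhs => rw [← hQ, ← hV]
    rw [Units.inv_mul_cancel_right, hV]
  have hpc : ∀ M : Matrix ι ι (PS p κ n), M * (p : Matrix ι ι (PS p κ n)) =
      (p : Matrix ι ι (PS p κ n)) * M := fun M => ((Nat.cast_commute p M).eq).symm
  have hLu : IsUnit (1 + (p : Matrix ι ι (PS p κ n)) * lowerPart deg Q) :=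
    isUnit_matrix_of_dvd_sub isUnit_one ⟨-lowerPart deg Q, by rw [mul_neg]; abel⟩
  have hRu : IsUnit (1 + (p : Matrix ι ι (PS p κ n)) * upperPart deg Q) :=
    isUnit_matrix_of_dvd_sub isUnit_one ⟨-upperPart deg Q, by rw [mul_neg]; abel⟩
  have hpsmul : ∀ M : Matrix ι ι (PS p κ n), (p : Matrix ι ι (PS p κ n)) * M = (p : PS p κ n) • M := by
    intro M
    rw [← nsmul_eq_mul, Nat.cast_smul_eq_nsmul]
  refine ⟨1 + (p : Matrix ι ι (PS p κ n)) * lowerPart deg Q,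
    (1 + (p : Matrix ι ι (PS p κ n)) * upperPart deg Q) * U, hLu, hRu.mul ⟨V, hV⟩, ?_, ?_, ?_⟩
  · refine Matrix.BlockTriangular.mul ?_ (blockTriangular_upperPart deg G)
    refine (Matrix.blockTriangular_one).add ?_
    intro a b hab
    rw [hpsmul, Matrix.smul_apply, blockTriangular_upperPart deg Q hab, smul_zero]
  · intro a b hab
    rw [hpsmul, Matrix.add_apply, Matrix.smul_apply, Matrix.one_apply_ne (by rintro rfl; omega)]
    simp [lowerPart, hab.le]
  · have h1 : P * φ.mapMatrix (lowerPart deg Q) = (p : Matrix ι ι (PS p κ n)) * θ Q * P := by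
      ext1 a b
      rw [hpsmul, hP, Matrix.diagonal_mul, Matrix.mul_diagonal, Matrix.smul_apply]
      by_cases hab : deg b < deg a
      · simp only [θ, lowerPart, Matrix.of_apply, if_pos hab, RingHom.mapMatrix_apply,
          Matrix.map_apply, smul_eq_mul]
        have : deg a = 1 + (deg a - deg b - 1) + deg b := by omega
        conv_lhs => rw [this, pow_add, pow_add, pow_one]
        ring
      · simp [θ, lowerPart, hab]
    have h2 : G = U + (p : Matrix ι ι (PS p κ n)) * G' := by rw [← hG']; abel
    have h4 : G * P * ((p : Matrix ι ι (PS p κ n)) * φ.mapMatrix (lowerPart deg Q)) =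
        (p : Matrix ι ι (PS p κ n)) * ((p : Matrix ι ι (PS p κ n)) * (G * θ Q)) * P := by
      rw [← mul_assoc, hpc (G * P), mul_assoc, mul_assoc G P, h1, mul_assoc _ (θ Q), ← mul_assoc G,
        hpc G]
      noncomm_ring
    rw [map_add, map_one, map_mul, map_natCast, mul_add, mul_one, h4]
    have h3 : (1 + (p : Matrix ι ι (PS p κ n)) * lowerPart deg Q) *
        ((1 + (p : Matrix ι ι (PS p κ n)) * upperPart deg Q) * U) =
        U + (p : Matrix ι ι (PS p κ n)) * ((lowerPart deg Q + upperPart deg Q) * U) +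
        (p : Matrix ι ι (PS p κ n)) * ((p : Matrix ι ι (PS p κ n)) *
          (lowerPart deg Q * upperPart deg Q * U)) := by
      have : lowerPart deg Q * ((p : Matrix ι ι (PS p κ n)) * upperPart deg Q) =
        (p : Matrix ι ι (PS p κ n)) * (lowerPart deg Q * upperPart deg Q) := by
        rw [← mul_assoc, hpc, mul_assoc]
      calc _ = U + (p : Matrix ι ι (PS p κ n)) * ((lowerPart deg Q + upperPart deg Q) * U) +
            (p : Matrix ι ι (PS p κ n)) *
              (lowerPart deg Q * ((p : Matrix ι ι (PS p κ n)) * upperPart deg Q)) * U := by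
            noncomm_ring
        _ = _ := by rw [this]; noncomm_ring
    rw [h3, lowerPart_add_upperPart, hQ']
    have h5 : G * P = (U + (p : Matrix ι ι (PS p κ n)) * G') * P := by rw [← h2]
    rw [h5]
    noncomm_ring

/-- The `i`-th diagonal block. -/
def diagBlock {N : ℕ} {h : Fin N → ℕ} {R : Type*} (i : Fin N)
    (M : Matrix (Σ i : Fin N, Fin (h i)) (Σ i : Fin N, Fin (h i)) R) :
    Matrix (Fin (h i)) (Fin (h i)) R :=
  M.submatrix (fun x => ⟨i, x⟩) (fun x => ⟨i, x⟩)

theorem diagBlock_mul {N : ℕ} {h : Fin N → ℕ} {R : Type*} [Ring R] (i : Fin N)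
    {M M' : Matrix (Σ i : Fin N, Fin (h i)) (Σ i : Fin N, Fin (h i)) R}
    (hM : M.BlockTriangular Sigma.fst) (hM' : M'.BlockTriangular Sigma.fst) :
    diagBlock i (M * M') = diagBlock i M * diagBlock i M' := by
  ext x y
  simp only [diagBlock, Matrix.submatrix_apply, Matrix.mul_apply]
  rw [Fintype.sum_sigma, Finset.sum_eq_single i]
  · intro j _ hj
    refine Finset.sum_eq_zero fun z _ => ?_
    rcases lt_or_gt_of_ne hj with hlt | hlt
    · rw [hM (show Sigma.fst (⟨j, z⟩ : Σ i : Fin N, Fin (h i)) < _ from hlt), zero_mul]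
    · rw [hM' (show _ < Sigma.fst (⟨j, z⟩ : Σ i : Fin N, Fin (h i)) from hlt), mul_zero]
  · simp

theorem diagBlock_one {N : ℕ} {h : Fin N → ℕ} {R : Type*} [Ring R] (i : Fin N) :
    diagBlock i (1 : Matrix (Σ i : Fin N, Fin (h i)) (Σ i : Fin N, Fin (h i)) R) = 1 :=
  Matrix.submatrix_one _ fun x y hxy => by simpa using hxy

theorem diagBlock_blockDiagonal' {N : ℕ} {h : Fin N → ℕ} {R : Type*} [Ring R] (i : Fin N)
    (C : ∀ i, Matrix (Fin (h i)) (Fin (h i)) R) :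
    diagBlock i (Matrix.blockDiagonal' C) = C i := by
  ext x y
  exact Matrix.blockDiagonal'_apply_eq C i x y

/-- Normal form of the matrix of an ordinary Frobenius. -/
theorem exists_unitriangular_frobenius [IsAlgClosed κ] {N : ℕ} {h : Fin N → ℕ}
    (G : Matrix (Σ i : Fin N, Fin (h i)) (Σ i : Fin N, Fin (h i)) (PS p κ n)) (hG : IsUnit G)
    (hlow : ∀ a b, b.1 < a.1 → (p : PS p κ n) ∣ G a b) :
    ∃ E r : Matrix (Σ i : Fin N, Fin (h i)) (Σ i : Fin N, Fin (h i)) (PS p κ n), IsUnit E ∧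
      (∀ a b, a.1 < b.1 → E a b = 0) ∧ (∀ a b, b.1 < a.1 → r a b = 0) ∧
      (∀ a b, a.1 = b.1 → r a b = if a = b then 1 else 0) ∧
      G * Matrix.diagonal (fun a => (p : PS p κ n) ^ (a.1 : ℕ)) *
        (powLift p κ n).toRingHom.mapMatrix E =
        E * r * Matrix.diagonal (fun a => (p : PS p κ n) ^ (a.1 : ℕ)) := by
  set P : Matrix (Σ i : Fin N, Fin (h i)) (Σ i : Fin N, Fin (h i)) (PS p κ n) :=
    Matrix.diagonal (fun a => (p : PS p κ n) ^ (a.1 : ℕ)) with hP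
  obtain ⟨L, R, hL, hR, hRt, hLt, hLR⟩ := exists_lower_mul_upper (powLift p κ n).toRingHom
    (fun a : Σ i : Fin N, Fin (h i) => (a.1 : ℕ)) G hG hlow
  have hRt' : R.BlockTriangular Sigma.fst := fun a b hab => hRt hab
  have hblk : ∀ i, IsUnit (diagBlock i R) := by
    intro i
    have : Invertible R := hR.invertible
    have hinv := Matrix.blockTriangular_inv_of_blockTriangular hRt'
    have e := diagBlock_mul i hRt' hinv
    rw [Matrix.mul_inv_of_invertible, diagBlock_one] at e
    exact (Matrix.isUnit_iff_isUnit_det _).2 (Matrix.isUnit_det_of_right_inverse e.symm)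
  -- Lang's theorem solves R_ii φ(C_i) = C_i for each diagonal block. The block diagonal matrix D of
  -- the C_i has φ(D) commuting with P, so conjugating by D replaces R by D⁻¹ R φ(D), whose diagonal
  -- blocks are 1.
  choose C hC hRC using fun i => exists_isUnit_mul_map_powLift_eq (p := p) (diagBlock i R) (hblk i)
  choose C' hC' using hC
  have hCC' : Matrix.blockDiagonal' C * Matrix.blockDiagonal' (fun i => ((C' i)⁻¹ : (Matrix _ _ (PS p κ n))ˣ).val) = 1 := by
    rw [← Matrix.blockDiagonal'_mul]
    simp only [← hC', Units.mul_inv]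
    exact Matrix.blockDiagonal'_one
  have hmap : (powLift p κ n).toRingHom.mapMatrix (Matrix.blockDiagonal' C) =
      Matrix.blockDiagonal' fun i => (powLift p κ n).toRingHom.mapMatrix (C i) := by
    rw [RingHom.mapMatrix_apply, Matrix.blockDiagonal'_map _ _ (map_zero _)]
    rfl
  set D := Matrix.blockDiagonal' C with hD
  set D' := Matrix.blockDiagonal' (fun i => ((C' i)⁻¹ : (Matrix _ _ (PS p κ n))ˣ).val) with hD'
  have hDu : IsUnit D :=
    (Matrix.isUnit_iff_isUnit_det _).2 (Matrix.isUnit_det_of_right_inverse hCC')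
  have hbt : ∀ M : ∀ i, Matrix (Fin (h i)) (Fin (h i)) (PS p κ n),
      (Matrix.blockDiagonal' M).BlockTriangular Sigma.fst := fun M =>
    Matrix.blockTriangular_blockDiagonal' M
  have hrt : (D' * R * (powLift p κ n).toRingHom.mapMatrix D).BlockTriangular Sigma.fst := by
    rw [hmap]
    exact ((hbt _).mul hRt').mul (hbt _)
  refine ⟨L * D, D' * R * (powLift p κ n).toRingHom.mapMatrix D, hL.mul hDu, ?_, ?_, ?_, ?_⟩
  · intro a b hab
    rw [Matrix.mul_apply]
    refine Finset.sum_eq_zero fun c _ => ?_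
    by_cases hc : c.1 = b.1
    · rw [hLt a c (by rw [hc]; exact hab), zero_mul]
    · obtain ⟨i, x⟩ := c
      obtain ⟨j, y⟩ := b
      rw [hD, Matrix.blockDiagonal'_apply_ne C x y hc, mul_zero]
  · intro a b hab
    exact hrt hab
  · rintro ⟨i, x⟩ ⟨j, y⟩ hij
    obtain rfl : i = j := hij
    have e : diagBlock i (D' * R * (powLift p κ n).toRingHom.mapMatrix D) = 1 := by
      rw [hmap, diagBlock_mul i ((hbt _).mul hRt') (hbt _), diagBlock_mul i (hbt _) hRt',
        diagBlock_blockDiagonal', diagBlock_blockDiagonal', mul_assoc, hRC, ← hC', Units.inv_mul]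
    rw [← diagBlock_one i] at e
    exact (congrFun (congrFun e x) y).trans Matrix.one_apply
  · rw [map_mul, ← mul_assoc, hLR]
    have hcomm : P * (powLift p κ n).toRingHom.mapMatrix D =
        (powLift p κ n).toRingHom.mapMatrix D * P := by
      ext1 ⟨i, x⟩ ⟨j, y⟩
      rw [hmap, hP, Matrix.diagonal_mul, Matrix.mul_diagonal]
      by_cases hij : i = j
      · subst hij; ring
      · rw [Matrix.blockDiagonal'_apply_ne _ _ _ hij]; ring
    rw [mul_assoc (L * R), hcomm, mul_assoc L D, mul_assoc D' R, ← mul_assoc D D', hCC', one_mul]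
    noncomm_ring

end Factorization

/-! ### Opposite filtrations -/

section Opposite

variable {R M : Type*} [Ring R] [AddCommGroup M] [Module R M]

/-- If x ∈ S_i equals y + z with y ∈ C_{i-1} and z ∈ B_{i+1}, then z = x - y lies in C_i ∩ B_{i+1} =
0, so x = y lies in C_{i-1} ∩ B_i = 0. No spanning is needed, so this also applies to the
filtrations of H itself. -/
theorem iSupIndep_of_opposite {N : ℕ} {C B : ℕ → Submodule R M} (hC : Monotone C) (hB : Antitone B)
    (hd : ∀ i, Disjoint (C i) (B (i + 1))) {S : Fin N → Submodule R M} (hSC : ∀ i, S i ≤ C i)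
    (hSB : ∀ i, S i ≤ B i) : iSupIndep S := by
  intro i
  rw [Submodule.disjoint_def]
  intro x hx hx'
  have h1 : (⨆ (j) (_ : j ≠ i), S j) ≤
      (match (i : ℕ) with | 0 => ⊥ | k + 1 => C k) ⊔ B (i + 1) := by
    refine iSup₂_le fun j hj => ?_
    rcases lt_or_gt_of_ne hj with h | h
    · refine le_sup_of_le_left ((hSC j).trans ?_)
      obtain ⟨k, hk⟩ : ∃ k, (i : ℕ) = k + 1 := ⟨i - 1, by have : (j : ℕ) < i := h; omega⟩
      rw [hk]
      exact hC (by have : (j : ℕ) < i := h; omega)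
    · exact le_sup_of_le_right ((hSB j).trans (hB h))
  obtain ⟨y, hy, z, hz, rfl⟩ := Submodule.mem_sup.1 (h1 hx')
  have hyC : y ∈ C i := by
    revert hy
    generalize (i : ℕ) = m
    cases m with
    | zero => intro hy; rw [(Submodule.mem_bot R).1 hy]; exact Submodule.zero_mem _
    | succ k => intro hy; exact hC (Nat.le_succ k) hy
  have hz0 : z = 0 := by
    refine Submodule.disjoint_def.1 (hd i) z ?_ hz
    have := Submodule.sub_mem _ (hSC i hx) hyC
    rwa [add_sub_cancel_left] at this
  subst hz0
  rw [add_zero] at hx ⊢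
  have hyB := hSB i hx
  revert hy hyB
  generalize (i : ℕ) = m
  cases m with
  | zero => intro hy _; exact (Submodule.mem_bot R).1 hy
  | succ k => intro hy hyB; exact Submodule.disjoint_def.1 (hd k) y hy hyB

theorem sup_inf_of_opposite {C B : ℕ → Submodule R M} (hC : Monotone C)
    (hc : ∀ i, IsCompl (C i) (B (i + 1))) (i : ℕ) : C i ⊔ C (i + 1) ⊓ B (i + 1) = C (i + 1) := by
  rw [inf_comm, ← sup_inf_assoc_of_le _ (hC (Nat.le_succ i)), (hc i).sup_eq_top, top_inf_eq]

theorem isInternal_of_opposite {N : ℕ} {C B : ℕ → Submodule R M} (hC : Monotone C)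
    (hB : Antitone B) (hc : ∀ i, IsCompl (C i) (B (i + 1))) (h0 : B 0 = ⊤) (hN : C N = ⊤) :
    DirectSum.IsInternal (fun i : Fin (N + 1) => C i ⊓ B i) := by
  rw [DirectSum.isInternal_submodule_iff_iSupIndep_and_iSup_eq_top]
  refine ⟨iSupIndep_of_opposite hC hB (fun i => (hc i).disjoint) (fun i => inf_le_left)
    fun i => inf_le_right, ?_⟩
  have : ∀ i ≤ N, C i ≤ ⨆ i : Fin (N + 1), C i ⊓ B i := by
    intro i hi
    induction i with
    | zero =>
      refine le_trans ?_ (le_iSup _ (0 : Fin (N + 1)))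
      simp [h0]
    | succ i ih =>
      rw [← sup_inf_of_opposite hC hc i]
      refine sup_le (ih (by omega)) ?_
      exact le_iSup (fun i : Fin (N + 1) => C i ⊓ B i) ⟨i + 1, by omega⟩
  exact top_le_iff.1 (hN ▸ this N le_rfl)

/-- `E / E' ≃ S` if `E = E' ⊕ S`. -/
def quotientEquivOfDisjointSup {E E' S : Submodule R M} (hE' : E' ≤ E) (hS : S ≤ E)
    (hd : Disjoint E' S) (hs : E' ⊔ S = E) : (↥E ⧸ E'.submoduleOf E) ≃ₗ[R] S :=
  (Submodule.quotientEquivOfIsCompl _ (S.submoduleOf E) (by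
    constructor
    · rw [Submodule.disjoint_def]
      rintro ⟨x, hx⟩ h1 h2
      exact Subtype.ext (Submodule.disjoint_def.1 hd x h1 h2)
    · rw [codisjoint_iff, eq_top_iff]
      rintro ⟨x, hx⟩ -
      obtain ⟨y, hy, z, hz, rfl⟩ := Submodule.mem_sup.1 (hs.symm ▸ hx)
      exact Submodule.mem_sup.2 ⟨⟨y, hE' hy⟩, hy, ⟨z, hS hz⟩, hz, rfl⟩)).trans
    (Submodule.submoduleOfEquivOfLe hS)

end Opposite

/-! ### Bases adapted to the Hodge and conjugate filtrations -/

section Adapted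

variable {p : ℕ} [Fact p.Prime] {κ : Type v} [Field κ] [CharP κ p] {n : ℕ}
  {H : Type u} [AddCommGroup H] [Module (PS p κ n) H]

instance nontrivial_PS0 [PerfectRing κ p] : Nontrivial (PS0 p κ n) :=
  Ideal.Quotient.nontrivial_iff.2 fun h => by
    have h1 := pIdeal_le_jacobson (p := p) (κ := κ) (n := n)
    rw [h, top_le_iff, Ideal.jacobson_eq_top_iff] at h1
    exact bot_ne_top h1

theorem FCrystal.conjFil_mono (Cr : FCrystal p κ n H) (φ : FrobLift p κ n) :
    Monotone (Cr.conjFil φ) := by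
  refine monotone_nat_of_le_succ fun i => Submodule.map_mono fun x hx => ?_
  rw [Submodule.mem_comap, LinearMap.lsmul_apply] at hx ⊢
  rw [pow_succ', mul_smul]
  exact Submodule.smul_mem _ _ hx

variable [PerfectRing κ p]

theorem FCrystal.conjFil_eq (Cr : FCrystal p κ n H) (φ ψ : FrobLift p κ n) (i : ℕ) :
    Cr.conjFil φ i = Cr.conjFil ψ i := by
  rw [conjFil, conjFil, Cr.imF_eq φ ψ]

/-- A basis adapted to the Hodge filtration whose reduction is adapted to the
conjugate filtration. -/
theorem FCrystal.exists_adapted_basis (Cr : FCrystal p κ n H) {φ : FrobLift p κ n} {N : ℕ}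
    {Fil : ℕ → Submodule (PS p κ n) H} (hFil : Cr.IsHodgeFiltration φ Fil)
    (hord : Cr.IsOrdinary φ) (hlev : Cr.LevelLE φ N) :
    ∃ f : Module.Basis (Σ i : Fin (N + 1), Fin (Cr.hodgeNumber φ i)) (PS p κ n) H,
      (∀ a, f a ∈ Fil a.1) ∧ (∀ a, red p κ n H (f a) ∈ Cr.conjFil φ a.1) ∧
      ∀ (i : ℕ) (y : H), red p κ n H y ∈ Cr.conjFil φ i →
        ∀ a, i < (a.1 : ℕ) → (p : PS p κ n) ∣ f.repr y a := by
  have := Cr.free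
  have := Cr.finite
  set C := Cr.conjFil φ with hCdef
  set B := Cr.hodgeFil φ with hBdef
  have hC : Monotone C := Cr.conjFil_mono φ
  have hmapB : ∀ i, Submodule.map (red p κ n H) (Fil i) = B i := fun i => (hFil.lifts i).2
  have hB : Antitone B := fun i j hij => by
    rw [← hmapB, ← hmapB]
    exact Submodule.map_mono (hFil.anti hij)
  have hB0 : B 0 = ⊤ := by
    rw [← hmapB, hFil.zero, Submodule.map_top, LinearMap.range_eq_top]
    exact red_surjective
  have hint := isInternal_of_opposite hC hB hord.2 hB0 hlev.1
  have hfin : ∀ i, Module.Finite (PS0 p κ n) (C i) := fun i =>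
    have : Module.Finite (PS0 p κ n) (Red p κ n H) :=
      Module.Finite.of_surjective (red p κ n H) red_surjective
    Module.Finite.equiv (Submodule.quotientEquivOfIsCompl _ _ (hord.2 i).symm)
  -- Oppositeness at i - 1 makes C_i ∩ B_i a complement of C_{i-1} in C_i, so it inherits freeness
  -- from the graded piece.
  have heq : ∀ i, Nonempty (Cr.conjGr φ i ≃ₗ[PS0 p κ n] ↥(C i ⊓ B i)) := by
    intro i
    cases i with
    | zero => exact ⟨quotientEquivOfDisjointSup bot_le inf_le_left disjoint_bot_left (by
        rw [hB0, inf_top_eq]; exact bot_sup_eq _)⟩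
    | succ i => exact ⟨quotientEquivOfDisjointSup (hC (Nat.le_succ i)) inf_le_left
        ((hord.2 i).disjoint.mono_right inf_le_right) (sup_inf_of_opposite hC hord.2 i)⟩
  have hbas : ∀ i, Nonempty (Module.Basis (Fin (Cr.hodgeNumber φ i)) (PS0 p κ n)
      ↥(C i ⊓ B i)) := by
    intro i
    have := hord.1 i
    have := hfin i
    obtain ⟨q⟩ := heq i
    exact ⟨(Module.finBasis (PS0 p κ n) (Cr.conjGr φ i)).map q⟩
  let x := hint.collectedBasis fun i => (hbas i).some
  have hx : ∀ a, x a ∈ C a.1 ⊓ B a.1 := fun a => hint.collectedBasis_mem _ a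
  have hlift : ∀ a, ∃ y ∈ Fil a.1, red p κ n H y = x a := by
    intro a
    have := (hx a).2
    rw [← hmapB] at this
    exact this
  choose f hf hfx using hlift
  obtain ⟨e, rfl⟩ := exists_basis_of_red x f hfx
  refine ⟨e, hf, fun a => by rw [hfx]; exact (hx a).1, fun i y hy a ha => ?_⟩
  let c : (Σ i : Fin (N + 1), Fin (Cr.hodgeNumber φ i)) → PS0 p κ n := fun a =>
    Ideal.Quotient.mk (pIdeal p κ n) (e.repr y a)
  have hz : ∀ a, (0 : PS0 p κ n) • x a = 0 := fun a => Module.zero_smul (x a)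
  have h1 : red p κ n H y = ∑ a, c a • x a := by
    conv_lhs => rw [← e.sum_repr y, map_sum]
    exact Finset.sum_congr rfl fun a _ => by rw [map_smulₛₗ, hfx]
  -- The part of degree > i of the class of y lies in B_{i+1}. It also lies in C_i, being the class
  -- minus its part of degree ≤ i. So it vanishes.
  have h2 : ∑ a, (if (a.1 : ℕ) ≤ i then (0 : PS0 p κ n) else c a) • x a = 0 := by
    refine Submodule.disjoint_def.1 (hord.2 i).disjoint _ ?_ ?_
    · have h3 : ∑ a, (if (a.1 : ℕ) ≤ i then (0 : PS0 p κ n) else c a) • x a = red p κ n H y -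
          ∑ a, (if (a.1 : ℕ) ≤ i then c a else (0 : PS0 p κ n)) • x a := by
        rw [h1, ← Finset.sum_sub_distrib]
        refine Finset.sum_congr rfl fun a _ => ?_
        split_ifs
        · rw [hz, sub_self]
        · rw [hz, sub_zero]
      rw [h3]
      refine Submodule.sub_mem _ hy (Submodule.sum_mem _ fun a _ => ?_)
      split_ifs with h
      · exact Submodule.smul_mem _ _ (hC h (hx a).1)
      · rw [hz]; exact Submodule.zero_mem _
    · refine Submodule.sum_mem _ fun a _ => ?_
      split_ifs with h
      · rw [hz]; exact Submodule.zero_mem _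
      · exact Submodule.smul_mem _ _ (hB (by omega) (hx a).2)
  have h4 := (Fintype.linearIndependent_iff.1 x.linearIndependent) _ h2 a
  rw [if_neg (by omega)] at h4
  exact Ideal.mem_span_singleton.1 (Ideal.Quotient.eq_zero_iff_mem.1 h4)

theorem FCrystal.mem_imF_iff (Cr : FCrystal p κ n H) {ι : Type*} [Fintype ι]
    (e : Module.Basis ι (PS p κ n) H) (φ : FrobLift p κ n) (y : H) :
    y ∈ Cr.imF φ ↔ ∃ c : ι → PS p κ n, ∑ a, c a • Cr.frob φ (e a) = y := by
  rw [← Submodule.mem_span_range_iff_exists_fun]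
  suffices h : Cr.imF φ = Submodule.span (PS p κ n) (Set.range fun a => Cr.frob φ (e a)) by rw [h]
  apply le_antisymm
  · refine Submodule.span_le.2 ?_
    rintro _ ⟨x, rfl⟩
    rw [← e.sum_repr x, map_sum]
    refine Submodule.sum_mem _ fun a _ => ?_
    rw [map_smulₛₗ]
    exact Submodule.smul_mem _ _ (Submodule.subset_span ⟨a, rfl⟩)
  · refine Submodule.span_mono ?_
    rintro _ ⟨a, rfl⟩
    exact ⟨e a, rfl⟩

/-- The divided Frobenius matrix of an adapted basis is invertible. -/
theorem FCrystal.isUnit_of_adapted (Cr : FCrystal p κ n H) {ι : Type*} [Fintype ι] [DecidableEq ι]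
    (deg : ι → ℕ) (f : Module.Basis ι (PS p κ n) H) (φ : FrobLift p κ n)
    (hconj : ∀ a, red p κ n H (f a) ∈ Cr.conjFil φ (deg a)) (G : Matrix ι ι (PS p κ n))
    (hG : ∀ b, Cr.frob φ (f b) = p ^ deg b • ∑ a, G a b • f a) : IsUnit G := by
  choose y hy hyf using hconj
  simp only [SetLike.mem_coe, Submodule.mem_comap, LinearMap.lsmul_apply, Cr.mem_imF_iff f] at hy
  choose c hc using hy
  let Y : Matrix ι ι (PS p κ n) := Matrix.of fun a b => f.repr (y b) a
  have hY : IsUnit Y := by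
    refine isUnit_matrix_of_dvd_sub isUnit_one ?_
    have := natCast_pow_dvd_matrix_iff (p := p) (k := 1) (M := 1 - Y)
    rw [pow_one, pow_one] at this
    rw [this]
    intro a b
    obtain ⟨z, hz⟩ := (red_eq_iff _ _).1 (hyf b).symm
    have : f.repr (f b - y b) a = (1 - Y) a b := by
      rw [map_sub, f.repr_self, Finsupp.sub_apply, Finsupp.single_apply, Matrix.sub_apply,
        Matrix.one_apply]
      simp only [Y, Matrix.of_apply, eq_comm]
    rw [← this]
    have h1 := dvd_repr_of_eq_nsmul f (k := 1) (x := f b - y b) (y := z) (by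
      rw [hz, pow_one]; abel) a
    rwa [pow_one] at h1
  have key : Y * Matrix.diagonal (fun a => (p : PS p κ n) ^ deg a) =
      G * Matrix.diagonal (fun a => (p : PS p κ n) ^ deg a) * Matrix.of fun a b => c b a := by
    ext1 a b
    rw [Matrix.mul_diagonal, Matrix.mul_apply]
    have h1 := congrArg (fun x => f.repr x a) (hc b)
    simp only [map_sum, map_smul, Finsupp.smul_apply, Finset.sum_apply', hG,
      nsmul_pow_eq_smul (κ := κ) (n := n), f.repr_self, smul_eq_mul] at h1
    rw [mul_comm]
    change (p : PS p κ n) ^ deg b * f.repr (y b) a = _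
    rw [← h1]
    refine Finset.sum_congr rfl fun d _ => ?_
    rw [Matrix.mul_diagonal, Matrix.of_apply]
    have h2 : ∑ x, G x d * (Finsupp.single x (1 : PS p κ n)) a = G a d := by
      rw [Finset.sum_eq_single a]
      · simp
      · intro x _ hx; simp [hx]
      · simp
    rw [h2]
    ring
  have hdet := congrArg Matrix.det key
  rw [Matrix.det_mul, Matrix.det_mul, Matrix.det_mul, mul_right_comm] at hdet
  have hne : (Matrix.diagonal (fun a => (p : PS p κ n) ^ deg a)).det ≠ 0 := by
    rw [Matrix.det_diagonal]
    exact Finset.prod_ne_zero_iff.2 fun a _ => pow_ne_zero _ p_ne_zero_PS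
  have h3 := mul_right_cancel₀ hne hdet
  rw [Matrix.isUnit_iff_isUnit_det] at hY ⊢
  rw [h3] at hY
  exact isUnit_of_mul_isUnit_left hY

/-- The new basis with coordinates given by the columns of an invertible matrix. -/
theorem exists_basis_of_isUnit {ι : Type*} [Fintype ι] [DecidableEq ι]
    (f : Module.Basis ι (PS p κ n) H) {E : Matrix ι ι (PS p κ n)} (hE : IsUnit E) :
    ∃ e : Module.Basis ι (PS p κ n) H, ∀ b, e b = ∑ a, E a b • f a := by
  have := hE.invertible
  exact ⟨f.map (Matrix.toLinearEquiv f E ((Matrix.isUnit_iff_isUnit_det _).1 hE)), fun b => by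
    rw [Module.Basis.map_apply]
    exact Matrix.toLin_self f f E b⟩

/-- All hypotheses on the crystal enter here: ordinarity and the level give the adapted basis, and
divisibility with N < p gives the integral matrix G of F P⁻¹. -/
theorem FCrystal.exists_unitriangular_basis [IsAlgClosed κ] (Cr : FCrystal p κ n H)
    {φ : FrobLift p κ n} {N : ℕ} (hN : N < p) {Fil : ℕ → Submodule (PS p κ n) H}
    (hFil : Cr.IsHodgeFiltration φ Fil) (hdiv : Cr.IsDivisible Fil N)
    (hord : Cr.IsOrdinary φ) (hlev : Cr.LevelLE φ N) :
    ∃ (e : Module.Basis (Σ i : Fin (N + 1), Fin (Cr.hodgeNumber φ i)) (PS p κ n) H)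
      (r : Matrix (Σ i : Fin (N + 1), Fin (Cr.hodgeNumber φ i))
        (Σ i : Fin (N + 1), Fin (Cr.hodgeNumber φ i)) (PS p κ n)),
      (∀ a, e a ∈ Fil a.1) ∧ (∀ a b, b.1 < a.1 → r a b = 0) ∧
      (∀ a b, a.1 = b.1 → r a b = if a = b then 1 else 0) ∧
      ∀ b, Cr.frob (powLift p κ n) (e b) = p ^ (b.1 : ℕ) • ∑ a, r a b • e a := by
  obtain ⟨f, hf, hfC, hC⟩ := Cr.exists_adapted_basis hFil hord hlev
  have hdivf : ∀ b, ∃ g, Cr.frob (powLift p κ n) (f b) = p ^ (b.1 : ℕ) • g := fun b =>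
    Cr.frob_mem_of_divisible Fil hN hFil.zero hFil.griffiths hdiv _ (by omega) (hf b)
  choose g hg using hdivf
  let G : Matrix (Σ i : Fin (N + 1), Fin (Cr.hodgeNumber φ i))
    (Σ i : Fin (N + 1), Fin (Cr.hodgeNumber φ i)) (PS p κ n) := Matrix.of fun a b => f.repr (g b) a
  have hgG : ∀ b, g b = ∑ a, G a b • f a := fun b => (f.sum_repr (g b)).symm
  have hG : IsUnit G := Cr.isUnit_of_adapted (fun a => (a.1 : ℕ)) f (powLift p κ n)
    (fun a => by rw [← Cr.conjFil_eq φ]; exact hfC a) G (fun b => by rw [hg, hgG])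
  -- The column g_b satisfies p^(deg b) g_b ∈ Im F, so its class lies in the conjugate step deg b
  -- and its coordinates of higher degree are divisible by p.
  have hlow : ∀ a b, b.1 < a.1 → (p : PS p κ n) ∣ G a b := by
    intro a b hab
    refine hC b.1 (g b) ?_ a hab
    rw [Cr.conjFil_eq φ (powLift p κ n)]
    refine ⟨g b, ?_, rfl⟩
    rw [SetLike.mem_coe, Submodule.mem_comap, LinearMap.lsmul_apply,
      ← nsmul_pow_eq_smul (κ := κ) (n := n), ← hg]
    exact Submodule.subset_span ⟨_, rfl⟩
  obtain ⟨E, r, hE, hElow, hrt, hrd, hGE⟩ := exists_unitriangular_frobenius G hG hlow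
  obtain ⟨e, he⟩ := exists_basis_of_isUnit f hE
  refine ⟨e, r, fun b => ?_, hrt, hrd, fun b => ?_⟩
  · rw [he]
    refine Submodule.sum_mem _ fun a _ => ?_
    -- E is block lower triangular, so only vectors of degree ≥ deg b occur, and these lie in `Fil
    -- b.1`.
    by_cases hab : a.1 < b.1
    · rw [hElow a b hab, zero_smul]; exact Submodule.zero_mem _
    · exact Submodule.smul_mem _ _ (hFil.anti (not_lt.1 hab) (hf a))
  · have h1 : ∀ a, (∑ d, G a d * (p : PS p κ n) ^ (d.1 : ℕ) * (powLift p κ n).toRingHom (E d b)) =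
        (p : PS p κ n) ^ (b.1 : ℕ) * ∑ d, E a d * r d b := by
      intro a
      have := congrFun (congrFun hGE a) b
      rw [Matrix.mul_diagonal, Matrix.mul_apply, Matrix.mul_apply] at this
      simp only [Matrix.mul_diagonal, RingHom.mapMatrix_apply, Matrix.map_apply] at this
      rw [this, mul_comm]
    have h2 : Cr.frob (powLift p κ n) (e b) = ∑ a,
        (∑ d, G a d * (p : PS p κ n) ^ (d.1 : ℕ) * (powLift p κ n).toRingHom (E d b)) • f a := by
      simp only [he, map_sum, map_smulₛₗ, hg, hgG, nsmul_pow_eq_smul (κ := κ) (n := n),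
        Finset.smul_sum, Finset.sum_smul, smul_smul]
      rw [Finset.sum_comm]
      refine Finset.sum_congr rfl fun a _ => Finset.sum_congr rfl fun d _ => ?_
      congr 1
      ring
    rw [h2]
    simp only [h1, he, nsmul_pow_eq_smul (κ := κ) (n := n), Finset.smul_sum, Finset.sum_smul,
      smul_smul, Finset.mul_sum]
    rw [Finset.sum_comm]
    refine Finset.sum_congr rfl fun a _ => Finset.sum_congr rfl fun d _ => ?_
    congr 1
    ring

end Adapted

/-! ### Frobenius and connection on the spans of low-degree basis vectors -/

section LowU

variable {p : ℕ} [Fact p.Prime] {κ : Type v} [Field κ] [CharP κ p] {n : ℕ}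
  {H : Type u} [AddCommGroup H] [Module (PS p κ n) H] {ι : Type} [Fintype ι]

/-- The span of the basis vectors of degree `< i`. -/
def lowU (e : Module.Basis ι (PS p κ n) H) (deg : ι → ℕ) (i : ℕ) : Submodule (PS p κ n) H :=
  Submodule.span _ (Set.range fun a : {a : ι // deg a < i} => e a)

variable (e : Module.Basis ι (PS p κ n) H) (deg : ι → ℕ)

theorem mem_lowU {i : ℕ} {x : H} : x ∈ lowU e deg i ↔ ∀ a, i ≤ deg a → e.repr x a = 0 := by
  constructor
  · intro hx
    induction hx using Submodule.span_induction with
    | mem x hx =>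
      obtain ⟨⟨b, hb⟩, rfl⟩ := hx
      intro a ha
      change e.repr (e b) a = 0
      rw [e.repr_self, Finsupp.single_eq_of_ne]
      rintro rfl
      omega
    | zero => simp
    | add x y _ _ hx hy => intro a ha; rw [map_add, Finsupp.add_apply, hx a ha, hy a ha, add_zero]
    | smul c x _ hx => intro a ha; rw [map_smul, Finsupp.smul_apply, hx a ha, smul_zero]
  · intro h
    rw [← e.sum_repr x]
    refine Submodule.sum_mem _ fun a _ => ?_
    by_cases ha : deg a < i
    · exact Submodule.smul_mem _ _ (Submodule.subset_span ⟨⟨a, ha⟩, rfl⟩)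
    · rw [h a (by omega), zero_smul]; exact Submodule.zero_mem _

theorem basis_mem_lowU {i : ℕ} {a : ι} (h : deg a < i) : e a ∈ lowU e deg i :=
  Submodule.subset_span ⟨⟨a, h⟩, rfl⟩

theorem lowU_mono : Monotone (lowU e deg) := fun _ _ hij _ hx =>
  (mem_lowU e deg).2 fun a ha => (mem_lowU e deg).1 hx a (hij.trans ha)

theorem lowU_zero : lowU e deg 0 = ⊥ := by
  rw [eq_bot_iff]
  intro x hx
  rw [Submodule.mem_bot]
  apply e.ext_elem
  intro a
  rw [map_zero, (mem_lowU e deg).1 hx a (Nat.zero_le _), Finsupp.zero_apply]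

theorem free_lowU (i : ℕ) : Module.Free (PS p κ n) (lowU e deg i) :=
  Module.Free.of_basis (Module.Basis.span
    (e.linearIndependent.comp (fun a : {a : ι // deg a < i} => (a : ι)) Subtype.val_injective))

theorem fg_lowU (i : ℕ) : (lowU e deg i).FG :=
  Submodule.fg_span (Set.finite_range _)

theorem finite_lowU (i : ℕ) : Module.Finite (PS p κ n) (lowU e deg i) :=
  Module.Finite.iff_fg.2 (fg_lowU e deg i)

theorem mem_lowU_of_nsmul {i k : ℕ} {x : H} (h : p ^ k • x ∈ lowU e deg i) :
    x ∈ lowU e deg i := by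
  rw [mem_lowU] at h ⊢
  intro a ha
  have := h a ha
  rw [nsmul_pow_eq_smul (κ := κ) (n := n), map_smul, Finsupp.smul_apply, smul_eq_mul] at this
  exact (mul_eq_zero.1 this).resolve_left (pow_ne_zero _ p_ne_zero_PS)

/-- These submodules are p-adically closed, which lets later memberships be proved by successive
approximation. -/
theorem mem_lowU_of_approx [PerfectRing κ p] {i : ℕ} {x : H}
    (h : ∀ k : ℕ, ∃ u ∈ lowU e deg i, ∃ y : H, x = u + p ^ k • y) : x ∈ lowU e deg i := by
  rw [mem_lowU]
  intro a ha
  refine (padicallyComplete_PS n).sep _ fun k => ?_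
  obtain ⟨u, hu, y, rfl⟩ := h k
  rw [map_add, Finsupp.add_apply, (mem_lowU e deg).1 hu a ha, zero_add]
  exact dvd_repr_of_eq_nsmul e rfl a

variable [PerfectRing κ p] (Cr : FCrystal p κ n H)

/-- The basis `e` is a normal form for the Frobenius `powLift`: its matrix is block upper
triangular with diagonal blocks `p ^ i`, and its `b`-th column is divisible by `p ^ deg b`. -/
structure IsNormalBasis (r : Matrix ι ι (PS p κ n)) : Prop where
  lower : ∀ a b, deg b < deg a → r a b = 0
  diag_self : ∀ a, r a a = 1
  diag_ne : ∀ a b, a ≠ b → deg a = deg b → r a b = 0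
  frob : ∀ b, Cr.frob (powLift p κ n) (e b) = p ^ deg b • ∑ a, r a b • e a

variable {e deg Cr} {r : Matrix ι ι (PS p κ n)} (hr : IsNormalBasis e deg Cr r)
include hr

theorem IsNormalBasis.repr_frob (a b : ι) :
    e.repr (Cr.frob (powLift p κ n) (e b)) a = (p : PS p κ n) ^ deg b * r a b := by
  classical
  rw [hr.frob, nsmul_pow_eq_smul (κ := κ) (n := n), map_smul, Finsupp.smul_apply, smul_eq_mul,
    map_sum, Finset.sum_apply']
  congr 1
  rw [Finset.sum_eq_single a]
  · simp
  · intro c _ hc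
    simp [hc]
  · simp

theorem IsNormalBasis.frob_basis_sub_mem (b : ι) :
    Cr.frob (powLift p κ n) (e b) - p ^ deg b • e b ∈ lowU e deg (deg b) := by
  classical
  rw [mem_lowU]
  intro a ha
  rw [map_sub, Finsupp.sub_apply, hr.repr_frob, nsmul_pow_eq_smul (κ := κ) (n := n), map_smul,
    Finsupp.smul_apply, smul_eq_mul, e.repr_self, ← mul_sub]
  by_cases hab : a = b
  · subst hab; rw [hr.diag_self, Finsupp.single_eq_same, sub_self, mul_zero]
  · rw [Finsupp.single_eq_of_ne hab, sub_zero]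
    rcases ha.lt_or_eq with h | h
    · rw [hr.lower a b h, mul_zero]
    · rw [hr.diag_ne a b hab h.symm, mul_zero]

theorem IsNormalBasis.frob_mem {i : ℕ} {x : H} (hx : x ∈ lowU e deg i) :
    Cr.frob (powLift p κ n) x ∈ lowU e deg i := by
  induction hx using Submodule.span_induction with
  | mem x hx =>
    obtain ⟨⟨b, hb⟩, rfl⟩ := hx
    have := lowU_mono e deg hb.le (hr.frob_basis_sub_mem b)
    have h2 := Submodule.add_mem _ this
      (Submodule.smul_of_tower_mem _ (p ^ deg b) (basis_mem_lowU e deg hb))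
    rwa [sub_add_cancel] at h2
  | zero => rw [map_zero]; exact Submodule.zero_mem _
  | add x y _ _ hx hy => rw [map_add]; exact Submodule.add_mem _ hx hy
  | smul c x _ hx => rw [map_smulₛₗ]; exact Submodule.smul_mem _ _ hx

/-- Basis vectors of degree ≥ i are sent into p^i H, the others stay in the span. -/
theorem IsNormalBasis.exists_frob_eq_add (i : ℕ) (x : H) :
    ∃ u ∈ lowU e deg i, ∃ y, Cr.frob (powLift p κ n) x = u + p ^ i • y := by
  classical
  refine ⟨Cr.frob _ (∑ a, (if deg a < i then e.repr x a else 0) • e a), hr.frob_mem ?_,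
    ∑ a, (if deg a < i then 0 else (powLift p κ n).toRingHom (e.repr x a) *
      (p : PS p κ n) ^ (deg a - i)) • ∑ b, r b a • e b, ?_⟩
  · refine Submodule.sum_mem _ fun a _ => ?_
    split_ifs with h
    · exact Submodule.smul_mem _ _ (basis_mem_lowU e deg h)
    · rw [zero_smul]; exact Submodule.zero_mem _
  · conv_lhs => rw [← e.sum_repr x]
    rw [map_sum, map_sum, Finset.smul_sum, ← Finset.sum_add_distrib]
    refine Finset.sum_congr rfl fun a _ => ?_
    split_ifs with h
    · rw [zero_smul, smul_zero, add_zero]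
    · rw [zero_smul, map_zero, zero_add, map_smulₛₗ, hr.frob, nsmul_pow_eq_smul (κ := κ) (n := n),
        nsmul_pow_eq_smul (κ := κ) (n := n), smul_smul, smul_smul]
      congr 1
      rw [mul_left_comm, ← pow_add, Nat.add_sub_cancel' (by omega)]

/-- By induction on the degree, p^(deg b) e_b is F(e_b) minus multiples p^(deg b) r_ab e_a with deg
a < deg b, which are already in the span. -/
theorem IsNormalBasis.nsmul_mem_span {i : ℕ} {x : H} (hx : x ∈ lowU e deg (i + 1)) :
    p ^ i • x ∈ Submodule.span (PS p κ n) (Cr.frob (powLift p κ n) '' (lowU e deg (i + 1))) := by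
  set M := Submodule.span (PS p κ n) (Cr.frob (powLift p κ n) '' (lowU e deg (i + 1)))
  have key : ∀ d ≤ i, ∀ b, deg b = d → p ^ d • e b ∈ M := by
    intro d
    induction d using Nat.strong_induction_on with
    | _ d ih =>
      rintro hd b rfl
      have h1 : Cr.frob (powLift p κ n) (e b) ∈ M :=
        Submodule.subset_span ⟨_, basis_mem_lowU e deg (by omega), rfl⟩
      set w := Cr.frob (powLift p κ n) (e b) - p ^ deg b • e b with hw
      have h3 : w ∈ M := by
        rw [← e.sum_repr w]
        refine Submodule.sum_mem _ fun a _ => ?_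
        by_cases hab : deg b ≤ deg a
        · rw [(mem_lowU e deg).1 (hr.frob_basis_sub_mem b) a hab, zero_smul]
          exact Submodule.zero_mem _
        · have h4 : e.repr w a = (p : PS p κ n) ^ deg b * r a b := by
            rw [hw, map_sub, Finsupp.sub_apply, hr.repr_frob, nsmul_pow_eq_smul (κ := κ) (n := n),
              map_smul, Finsupp.smul_apply, e.repr_self, Finsupp.single_eq_of_ne, smul_zero, sub_zero]
            rintro rfl
            omega
          have h5 : deg b = deg a + (deg b - deg a) := by omega
          rw [h4, mul_comm, h5, pow_add, mul_comm _ ((p : PS p κ n) ^ (deg b - deg a)), ← mul_assoc,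
            mul_smul, ← nsmul_pow_eq_smul]
          exact Submodule.smul_mem _ _ (ih (deg a) (by omega) (by omega) a rfl)
      have := Submodule.sub_mem _ h1 h3
      rwa [hw, sub_sub_cancel] at this
  induction hx using Submodule.span_induction with
  | mem x hx =>
    obtain ⟨⟨b, hb⟩, rfl⟩ := hx
    have h := key (deg b) (by omega) b rfl
    change p ^ i • e b ∈ M
    rw [show i = (i - deg b) + deg b by omega, pow_add, mul_smul]
    exact Submodule.smul_of_tower_mem _ _ h
  | zero => rw [smul_zero]; exact Submodule.zero_mem _
  | add x y _ _ hx hy => rw [smul_add]; exact Submodule.add_mem _ hx hy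
  | smul c x _ hx => rw [smul_comm]; exact Submodule.smul_mem _ _ hx

/-- Let U be the span of degrees ≤ i and suppose D_j U ⊂ U + p^k H. Since D_j F = p t_j^(p-1) F D_j
and F(H) ⊂ U + p^(i+1) H, the derivative of an element of F(U) lies in U + p^(k+i+1) H. As p^i U is
in the span of F(U), dividing by p^i improves k to k + 1. -/
theorem IsNormalBasis.D_mem {i : ℕ} {x : H} (hx : x ∈ lowU e deg i) (j : Fin n) :
    Cr.D j x ∈ lowU e deg i := by
  cases i with
  | zero =>
    rw [lowU_zero, Submodule.mem_bot] at hx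
    rw [hx, map_zero]
    exact Submodule.zero_mem _
  | succ i =>
    refine mem_lowU_of_approx e deg fun k => ?_
    induction k generalizing x with
    | zero => exact ⟨0, Submodule.zero_mem _, Cr.D j x, by simp⟩
    | succ k ih =>
      have h1 : ∀ y ∈ Submodule.span (PS p κ n)
          (Cr.frob (powLift p κ n) '' (lowU e deg (i + 1))),
          y ∈ lowU e deg (i + 1) ∧ ∃ u ∈ lowU e deg (i + 1), ∃ h, Cr.D j y = u + p ^ (i + (k + 1)) • h := by
        intro y hy
        induction hy using Submodule.span_induction with
        | mem y hy =>
          obtain ⟨z, hz, rfl⟩ := hy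
          refine ⟨hr.frob_mem hz, ?_⟩
          obtain ⟨u, hu, h, hh⟩ := ih hz
          obtain ⟨u', hu', h', hh'⟩ := hr.exists_frob_eq_add (i + 1) h
          rw [Cr.D_frob_powLift, hh, map_add, map_nsmul, hh']
          refine ⟨((p : PS p κ n) * X j ^ (p - 1)) • (Cr.frob _ u + p ^ k • u'),
            Submodule.smul_mem _ _ (Submodule.add_mem _ (hr.frob_mem hu)
              (Submodule.smul_of_tower_mem _ _ hu')),
            ((p : PS p κ n) * X j ^ (p - 1)) • h', ?_⟩
          rw [smul_add (p ^ k), ← mul_smul (p ^ k), ← pow_add, ← add_assoc, smul_add _ _ (_ • h'),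
            smul_comm _ (p ^ _) h', show k + (i + 1) = i + (k + 1) by omega]
        | zero => exact ⟨Submodule.zero_mem _, 0, Submodule.zero_mem _, 0, by simp⟩
        | add y y' _ _ h h' =>
          obtain ⟨hy, u, hu, z, hz⟩ := h
          obtain ⟨hy', u', hu', z', hz'⟩ := h'
          exact ⟨Submodule.add_mem _ hy hy', u + u', Submodule.add_mem _ hu hu', z + z', by
            rw [map_add, hz, hz', smul_add]; abel⟩
        | smul a y _ h =>
          obtain ⟨hy, u, hu, z, hz⟩ := h
          refine ⟨Submodule.smul_mem _ _ hy, pderiv (WittVector p κ) j a • y + a • u,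
            Submodule.add_mem _ (Submodule.smul_mem _ _ hy) (Submodule.smul_mem _ _ hu), a • z, ?_⟩
          rw [Cr.leibniz, hz, smul_add, smul_comm a, add_assoc]
      obtain ⟨-, u, hu, h, hh⟩ := h1 _ (hr.nsmul_mem_span hx)
      refine ⟨Cr.D j x - p ^ (k + 1) • h, mem_lowU_of_nsmul e deg (k := i) ?_, h, by abel⟩
      rw [smul_sub, ← mul_smul, ← pow_add, ← map_nsmul, hh, add_sub_cancel_right]
      exact hu

theorem IsNormalBasis.frob_mem' (ψ : FrobLift p κ n) {i : ℕ} {x : H} (hx : x ∈ lowU e deg i) :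
    Cr.frob ψ x ∈ lowU e deg i := by
  refine mem_lowU_of_approx e deg fun k => ?_
  obtain ⟨S, -, h, hh⟩ := Cr.exists_taylor ψ (powLift p κ n) x k
  exact ⟨_, Submodule.sum_mem _ fun m _ => Submodule.smul_mem _ _ (hr.frob_mem
    (iterD_mem Cr.D (lowU e deg i) (fun j x hx => hr.D_mem hx j) m hx)), h, hh⟩

theorem IsNormalBasis.repr_frob_of_mem {i : ℕ} {x : H} (hx : x ∈ lowU e deg (i + 1)) {a : ι}
    (ha : deg a = i) : e.repr (Cr.frob (powLift p κ n) x) a =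
      (p : PS p κ n) ^ i * (powLift p κ n).toRingHom (e.repr x a) := by
  classical
  conv_lhs => rw [← e.sum_repr x]
  rw [map_sum, map_sum, Finset.sum_apply', Finset.sum_eq_single a]
  · rw [map_smulₛₗ, map_smul, Finsupp.smul_apply, hr.repr_frob, hr.diag_self, ha, smul_eq_mul,
      mul_one, mul_comm]
  · intro b _ hb
    rw [map_smulₛₗ, map_smul, Finsupp.smul_apply, hr.repr_frob, smul_eq_mul]
    rcases lt_trichotomy (deg b) i with h | h | h
    · rw [hr.lower a b (by omega), mul_zero, mul_zero]
    · rw [hr.diag_ne a b hb.symm (by omega), mul_zero, mul_zero]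
    · rw [(mem_lowU e deg).1 hx b h, map_zero, zero_mul]
  · simp

/-- The basis is horizontal modulo vectors of lower degree. -/
theorem IsNormalBasis.D_basis_mem (b : ι) (j : Fin n) : Cr.D j (e b) ∈ lowU e deg (deg b) := by
  have hmem : Cr.D j (e b) ∈ lowU e deg (deg b + 1) :=
    hr.D_mem (basis_mem_lowU e deg (Nat.lt_succ_self _)) j
  rw [mem_lowU]
  intro a ha
  rcases ha.lt_or_eq with h | h
  · exact (mem_lowU e deg).1 hmem a h
  -- F(e_b) - p^(deg b) e_b has lower degree and so does its derivative. Comparing coordinates at a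
  -- gives c = p t_j^(p-1) φ(c), so c is divisible by every power of p.
  · have h1 : e.repr (Cr.D j (e b)) a = (p : PS p κ n) * X j ^ (p - 1) *
        (powLift p κ n).toRingHom (e.repr (Cr.D j (e b)) a) := by
      apply mul_left_cancel₀ (pow_ne_zero (deg b) (p_ne_zero_PS (p := p) (κ := κ) (n := n)))
      rw [mul_left_comm, ← hr.repr_frob_of_mem hmem h.symm, ← smul_eq_mul (_ * _),
        ← Finsupp.smul_apply, ← map_smul, ← Cr.D_frob_powLift, ← smul_eq_mul, ← Finsupp.smul_apply,
        ← map_smul, ← nsmul_pow_eq_smul, ← map_nsmul, eq_comm, ← sub_eq_zero, ← Finsupp.sub_apply,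
        ← map_sub, ← map_sub]
      exact (mem_lowU e deg).1 (hr.D_mem (hr.frob_basis_sub_mem b) j) a ha
    refine (padicallyComplete_PS n).sep _ fun k => ?_
    induction k with
    | zero => simp
    | succ k ih =>
      rw [h1, pow_succ', mul_assoc]
      exact mul_dvd_mul_left _ ((map_natCast_pow_dvd _ ih).mul_left _)

theorem IsNormalBasis.iterD_basis_mem (b : ι) {m : Fin n →₀ ℕ} (hm : m ≠ 0) :
    iterD Cr.D m (e b) ∈ lowU e deg (deg b) := by
  -- D_j is only additive and would differentiate coefficients of e_b. Hence the filtration uses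
  -- integer multiples of e_b rather than its span over the power series ring.
  let A := (lowU e deg (deg b)).toAddSubgroup
  let Fil : ℕ → AddSubgroup H := fun k =>
    match k with | 0 => A | _ + 1 => A ⊔ AddSubgroup.zmultiples (e b)
  have h := iterD_mem_of_lowering Cr.D Fil (fun i j x hx => by
    have hA : ∀ x ∈ A ⊔ AddSubgroup.zmultiples (e b), Cr.D j x ∈ A := by
      intro x hx
      obtain ⟨y, hy, z, hz, rfl⟩ := AddSubgroup.mem_sup.1 hx
      obtain ⟨t, rfl⟩ := AddSubgroup.mem_zmultiples_iff.1 hz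
      rw [map_add, map_zsmul]
      exact A.add_mem (hr.D_mem hy j) (A.zsmul_mem (hr.D_basis_mem b j) t)
    have hx' : x ∈ A ⊔ AddSubgroup.zmultiples (e b) := by
      cases i with
      | zero => exact AddSubgroup.mem_sup_left hx
      | succ i => exact hx
    have h1 := hA x hx'
    rcases i with _ | _ | i
    · exact h1
    · exact h1
    · exact AddSubgroup.mem_sup_left h1) m 1 (x := e b)
    (AddSubgroup.mem_sup_right (AddSubgroup.mem_zmultiples _))
  have hdeg : 1 - m.degree = 0 := by
    have : m.degree ≠ 0 := fun h => hm ((Finsupp.degree_eq_zero_iff m).1 h)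
    omega
  rw [hdeg] at h
  exact h

/-- In the Taylor formula the term m = 0 is the Frobenius of `powLift`, and every other term has
lower degree because e_b is horizontal modulo lower degree. -/
theorem IsNormalBasis.frob_basis_sub_mem' (ψ : FrobLift p κ n) (b : ι) :
    Cr.frob ψ (e b) - p ^ deg b • e b ∈ lowU e deg (deg b) := by
  have h1 : Cr.frob ψ (e b) - Cr.frob (powLift p κ n) (e b) ∈ lowU e deg (deg b) := by
    refine mem_lowU_of_approx e deg fun k => ?_
    obtain ⟨S, h0, h, hh⟩ := Cr.exists_taylor ψ (powLift p κ n) (e b) k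
    classical
    rw [← Finset.add_sum_erase _ _ h0, taylorCoeff_zero, one_smul, iterD_zero] at hh
    refine ⟨∑ m ∈ S.erase 0, taylorCoeff ψ (powLift p κ n) m •
      Cr.frob (powLift p κ n) (iterD Cr.D m (e b)), ?_, h,
      sub_eq_iff_eq_add'.2 (by rw [hh, add_assoc]; rfl)⟩
    exact Submodule.sum_mem _ fun m hm => Submodule.smul_mem _ _ (hr.frob_mem
      (hr.iterD_basis_mem b (Finset.ne_of_mem_erase hm)))
  have := Submodule.add_mem _ h1 (hr.frob_basis_sub_mem b)
  rwa [sub_add_sub_cancel] at this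

theorem IsNormalBasis.repr_frob_of_mem' (ψ : FrobLift p κ n) {i : ℕ} {x : H}
    (hx : x ∈ lowU e deg (i + 1)) {a : ι} (ha : deg a = i) :
    e.repr (Cr.frob ψ x) a = (p : PS p κ n) ^ i * ψ.toRingHom (e.repr x a) := by
  classical
  conv_lhs => rw [← e.sum_repr x]
  have hb : ∀ b, deg b ≤ i →
      e.repr (Cr.frob ψ (e b)) a = (p : PS p κ n) ^ deg b * Finsupp.single b (1 : PS p κ n) a := by
    intro b hbi
    have := (mem_lowU e deg).1 (hr.frob_basis_sub_mem' ψ b) a (by omega)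
    rw [map_sub, Finsupp.sub_apply, sub_eq_zero] at this
    rw [this, nsmul_pow_eq_smul (κ := κ) (n := n), map_smul, e.repr_self, Finsupp.smul_apply,
      smul_eq_mul]
  rw [map_sum, map_sum, Finset.sum_apply', Finset.sum_eq_single a]
  · rw [map_smulₛₗ, map_smul, Finsupp.smul_apply, hb a ha.le, Finsupp.single_eq_same, ha,
      smul_eq_mul, mul_one, mul_comm]
  · intro b _ hba
    rw [map_smulₛₗ, map_smul, Finsupp.smul_apply, smul_eq_mul]
    rcases le_or_gt (deg b) i with h | h
    · rw [hb b h, Finsupp.single_eq_of_ne hba.symm, mul_zero, mul_zero]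
    · rw [(mem_lowU e deg).1 hx b h, map_zero, zero_mul]
  · simp

theorem IsNormalBasis.repr_D_of_mem (j : Fin n) {i : ℕ} {x : H}
    (hx : x ∈ lowU e deg (i + 1)) {a : ι} (ha : deg a = i) :
    e.repr (Cr.D j x) a = pderiv (WittVector p κ) j (e.repr x a) := by
  classical
  conv_lhs => rw [← e.sum_repr x]
  rw [map_sum, map_sum, Finset.sum_apply', Finset.sum_eq_single a]
  · rw [Cr.leibniz, map_add, map_smul, map_smul, Finsupp.add_apply, Finsupp.smul_apply,
      Finsupp.smul_apply, (mem_lowU e deg).1 (hr.D_basis_mem a j) a le_rfl, e.repr_self,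
      Finsupp.single_eq_same, smul_zero, add_zero, smul_eq_mul, mul_one]
  · intro b _ hba
    rw [Cr.leibniz, map_add, map_smul, map_smul, Finsupp.add_apply, Finsupp.smul_apply,
      Finsupp.smul_apply, e.repr_self, Finsupp.single_eq_of_ne hba.symm, smul_zero, zero_add]
    rcases le_or_gt (deg b) i with h | h
    · rw [(mem_lowU e deg).1 (hr.D_basis_mem b j) a (by omega), smul_zero]
    · rw [(mem_lowU e deg).1 hx b h, zero_smul]
  · simp

end LowU

/-! ### The unit root filtration: existence and uniqueness -/

section Filtration

variable {p : ℕ} [Fact p.Prime] {κ : Type v} [Field κ] [CharP κ p] [PerfectRing κ p] {n : ℕ}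
  {H : Type u} [AddCommGroup H] [Module (PS p κ n) H] {ι : Type} [Fintype ι]
  {e : Module.Basis ι (PS p κ n) H} {deg : ι → ℕ} {Cr : FCrystal p κ n H}
  {r : Matrix ι ι (PS p κ n)} (hr : IsNormalBasis e deg Cr r)

/-- Since `lowU` uses a strict bound on the degree, the step U_i is `lowU` at i + 1, and U_{-1} = 0
is `lowU` at 0. -/
theorem pred_lowU (e : Module.Basis ι (PS p κ n) H) (deg : ι → ℕ) (i : ℕ) :
    FCrystal.pred (fun i => lowU e deg (i + 1)) i = lowU e deg i := by
  cases i with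
  | zero => exact (lowU_zero e deg).symm
  | succ i => rfl

/-- The connection and the Frobenius maps for which the basis `v` is constant. -/
theorem exists_constant_operators {J : Type} [Finite J] {V : Type u} [AddCommGroup V]
    [Module (PS p κ n) V] (v : Module.Basis J (PS p κ n) V) :
    ∃ (D' : Fin n → AddMonoid.End V) (F' : ∀ φ : FrobLift p κ n, V →ₛₗ[φ.toRingHom] V),
      (∀ j x a, v.repr (D' j x) a = pderiv (WittVector p κ) j (v.repr x a)) ∧
      (∀ φ x a, v.repr (F' φ x) a = φ.toRingHom (v.repr x a)) ∧
      ∀ φ x, x ∈ Submodule.span (PS p κ n) (Set.range (F' φ)) := by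
  have := Fintype.ofFinite J
  have hs : ∀ (f : J → PS p κ n) a, v.repr (v.equivFun.symm f) a = f a := fun f a => by
    rw [← v.equivFun_apply, LinearEquiv.apply_symm_apply]
  let F' : ∀ φ : FrobLift p κ n, V →ₛₗ[φ.toRingHom] V := fun φ =>
    { toFun := fun x => v.equivFun.symm fun a => φ.toRingHom (v.repr x a)
      map_add' := fun x y => v.ext_elem fun a => by
        rw [map_add v.repr (v.equivFun.symm _), Finsupp.add_apply, hs, hs, hs, map_add v.repr,
          Finsupp.add_apply, map_add φ.toRingHom]
      map_smul' := fun c x => v.ext_elem fun a => by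
        rw [map_smul v.repr (φ.toRingHom c), Finsupp.smul_apply, hs, hs, map_smul v.repr,
          Finsupp.smul_apply, smul_eq_mul, map_mul φ.toRingHom, smul_eq_mul] }
  have hF' : ∀ φ x a, v.repr (F' φ x) a = φ.toRingHom (v.repr x a) := fun φ x a => hs _ a
  refine ⟨fun j =>
    { toFun := fun x => v.equivFun.symm fun a => pderiv (WittVector p κ) j (v.repr x a)
      map_zero' := v.ext_elem fun a => by
        rw [hs, map_zero v.repr, Finsupp.zero_apply, map_zero (pderiv (WittVector p κ) j)]
      map_add' := fun x y => v.ext_elem fun a => by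
        rw [map_add v.repr (v.equivFun.symm _), Finsupp.add_apply, hs, hs, hs, map_add v.repr,
          Finsupp.add_apply, map_add (pderiv (WittVector p κ) j)] }, F', fun j x a => hs _ a, hF',
    fun φ x => ?_⟩
  have h : (⊤ : Submodule (PS p κ n) V) ≤ Submodule.span (PS p κ n) (Set.range (F' φ)) := by
    rw [← v.span_eq]
    refine Submodule.span_mono ?_
    rintro _ ⟨a, rfl⟩
    refine ⟨v a, v.ext_elem fun b => ?_⟩
    classical
    rw [hF', v.repr_self, Finsupp.single_apply]
    split_ifs
    · rw [map_one]
    · rw [map_zero]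
  exact h trivial

/-- The graded piece is realised inside H, as the span of the basis vectors of degree i, so it stays
in the universe of H. -/
theorem exists_graded_lowU (e : Module.Basis ι (PS p κ n) H) (deg : ι → ℕ) (i : ℕ) :
    ∃ (V : Type u) (_ : AddCommGroup V) (_ : Module (PS p κ n) V)
      (v : Module.Basis {a // deg a = i} (PS p κ n) V) (q : lowU e deg (i + 1) →ₗ[PS p κ n] V),
      Function.Surjective q ∧ ∀ x a, v.repr (q x) a = e.repr x a := by
  have hfin : Fintype {a : ι // deg a = i} := Fintype.ofFinite _
  let v := Module.Basis.span (e.linearIndependent.comp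
    (fun a : {a : ι // deg a = i} => (a : ι)) Subtype.val_injective)
  refine ⟨_, inferInstance, inferInstance, v, v.equivFun.symm.toLinearMap ∘ₗ
    (LinearMap.pi fun a : {a : ι // deg a = i} => e.coord a) ∘ₗ Submodule.subtype _, ?_, ?_⟩
  · generalize v = v
    intro y
    refine ⟨⟨∑ a : {a : ι // deg a = i}, v.repr y a • e a, Submodule.sum_mem _ fun a _ =>
      Submodule.smul_mem _ _ (basis_mem_lowU e deg (by have := a.2; omega))⟩, ?_⟩
    rw [LinearMap.comp_apply, LinearEquiv.coe_coe, LinearEquiv.symm_apply_eq]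
    ext1 b
    change e.repr (∑ a : {a : ι // deg a = i}, v.repr y a • e a) b = _
    rw [map_sum, Finset.sum_apply', Finset.sum_eq_single b, v.equivFun_apply]
    · simp
    · intro c _ hc
      rw [map_smul, Finsupp.smul_apply, e.repr_self, Finsupp.single_eq_of_ne, smul_zero]
      exact fun h => hc (Subtype.ext h.symm)
    · simp
  · generalize v = v
    intro x a
    rw [LinearMap.comp_apply, LinearEquiv.coe_coe, ← v.equivFun_apply, LinearEquiv.apply_symm_apply]
    rfl

include hr

/-- The sub-`F`-crystal spanned by the basis vectors of degree `≤ i`. -/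
def IsNormalBasis.sub (i : ℕ) : FCrystal p κ n (lowU e deg (i + 1)) :=
  Cr.restrict _ (free_lowU e deg _) (finite_lowU e deg _) (fun _ _ h => mem_lowU_of_nsmul e deg h)
    (fun j _ hx => hr.D_mem hx j) (fun ψ _ hx => hr.frob_mem' ψ hx) (powLift p κ n) i
    (fun _ hx => hr.nsmul_mem_span hx)

/-- One inclusion is p^i U_i ⊂ Im F. For the other, p^i y ∈ Im F gives p^i y = u + p^(i+1) h with u
∈ U_i, so y - p h ∈ U_i by saturation and has the same class as y. -/
theorem IsNormalBasis.lifts (φ : FrobLift p κ n) (i : ℕ) :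
    FCrystal.Lifts (lowU e deg (i + 1)) (Cr.conjFil φ i) := by
  refine ⟨fun x hx => mem_lowU_of_nsmul e deg (k := 1) (by rwa [pow_one]), ?_⟩
  rw [Cr.conjFil_eq φ (powLift p κ n)]
  apply le_antisymm
  · refine Submodule.map_mono fun x hx => ?_
    rw [Submodule.mem_comap, LinearMap.lsmul_apply, ← nsmul_pow_eq_smul]
    exact Submodule.span_mono (Set.image_subset_range _ _) (hr.nsmul_mem_span hx)
  · rintro _ ⟨y, hy, rfl⟩
    rw [SetLike.mem_coe, Submodule.mem_comap, LinearMap.lsmul_apply, ← nsmul_pow_eq_smul] at hy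
    have h1 : ∀ z ∈ Cr.imF (powLift p κ n), ∃ u ∈ lowU e deg (i + 1), ∃ h, z = u + p ^ (i + 1) • h := by
      intro z hz
      induction hz using Submodule.span_induction with
      | mem z hz => obtain ⟨x, rfl⟩ := hz; exact hr.exists_frob_eq_add (i + 1) x
      | zero => exact ⟨0, Submodule.zero_mem _, 0, by simp⟩
      | add z z' _ _ h h' =>
        obtain ⟨s, hs, t, rfl⟩ := h
        obtain ⟨s', hs', t', rfl⟩ := h'
        exact ⟨s + s', Submodule.add_mem _ hs hs', t + t', by rw [smul_add]; abel⟩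
      | smul a z _ h =>
        obtain ⟨s, hs, t, rfl⟩ := h
        exact ⟨a • s, Submodule.smul_mem _ _ hs, a • t, by rw [smul_add, smul_comm]⟩
    obtain ⟨u, hu, h, hh⟩ := h1 _ hy
    refine ⟨y - p • h, mem_lowU_of_nsmul e deg (k := i) ?_, ?_⟩
    · rw [smul_sub, hh, ← mul_smul, ← pow_succ, add_sub_cancel_right]
      exact hu
    · rw [eq_comm, red_eq_iff]
      exact ⟨h, by abel⟩

/-- In coordinates the graded piece is a sum of copies of the constant crystal, with connection ∂_j
and Frobenius p^i ψ. -/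
theorem IsNormalBasis.isUnitRootFiltration (φ : FrobLift p κ n) :
    Cr.IsUnitRootFiltration φ (fun i => lowU e deg (i + 1)) where
  mono := fun i j hij => lowU_mono e deg (Nat.succ_le_succ hij)
  sub := fun i => ⟨hr.sub i, fun _ _ => rfl, fun _ _ => rfl⟩
  lifts := hr.lifts φ
  graded := fun i => by
    obtain ⟨V, _, _, v, q, hsurj, hq⟩ := exists_graded_lowU e deg i
    obtain ⟨D', F', hD', hF', hunit⟩ := exists_constant_operators v
    have hD : ∀ j x, q ((hr.sub i).D j x) = D' j (q x) := by
      intro j x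
      apply v.ext_elem
      intro a
      rw [hq, hD', hq]
      exact hr.repr_D_of_mem j x.2 a.2
    have hF : ∀ φ x, q ((hr.sub i).frob φ x) = p ^ i • F' φ (q x) := by
      intro φ x
      apply v.ext_elem
      intro a
      rw [hq, nsmul_pow_eq_smul (κ := κ) (n := n), map_smul, Finsupp.smul_apply, hF', hq,
        smul_eq_mul]
      exact hr.repr_frob_of_mem' φ x.2 a.2
    refine ⟨V, inferInstance, inferInstance,
      (hr.sub i).quotient (Module.Free.of_basis v) (Module.Finite.of_basis v) q hsurj i D' F' hD hF
        hunit, q, fun ψ => eq_top_iff.2 fun x _ => hunit ψ x, hsurj, fun x => ?_,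
      fun j x y hxy => ?_, fun ψ x y hxy => ?_⟩
    · rw [pred_lowU, mem_lowU]
      constructor
      · intro h a ha
        rcases ha.lt_or_eq with h1 | h1
        · exact (mem_lowU e deg).1 x.2 a h1
        · rw [← hq x ⟨a, h1.symm⟩, h, map_zero, Finsupp.zero_apply]
      · intro h
        apply v.ext_elem
        intro a
        rw [hq, h a (by have := a.2; omega), map_zero, Finsupp.zero_apply]
    · have : y = (hr.sub i).D j x := Subtype.ext hxy
      rw [this]
      exact hD j x
    · have : y = (hr.sub i).frob ψ x := Subtype.ext hxy
      rw [this]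
      exact hF ψ x

/-- The unit root filtration is unique. -/
theorem IsNormalBasis.eq_of_isUnitRootFiltration {φ : FrobLift p κ n}
    {U : ℕ → Submodule (PS p κ n) H} (hU : Cr.IsUnitRootFiltration φ U) (i : ℕ) :
    U i = lowU e deg (i + 1) := by
  -- Put L = `lowU e deg (i + 1)` and suppose U_j ⊂ L + p^k H. As V_j is a unit crystal, modulo
  -- U_{j-1} ⊂ L any p^j x with x ∈ U_j is a combination of Frobenius images of U_j, so p^j x ∈ L +
  -- p^(k+i+1) H. Saturation and j ≤ i improve k to k + 1.
  have hstep : ∀ j ≤ i, FCrystal.pred U j ≤ lowU e deg (i + 1) → U j ≤ lowU e deg (i + 1) := by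
    intro j hji hpred x hx
    obtain ⟨V, _, _, Cv, q, hunit, hqs, hker, -, hqF⟩ := hU.graded j
    obtain ⟨Cs, -, hCs⟩ := hU.sub j
    refine mem_lowU_of_approx e deg fun k => ?_
    induction k generalizing x with
    | zero => exact ⟨0, Submodule.zero_mem _, x, by simp⟩
    | succ k ih =>
      have h1 : ∀ w ∈ Cv.imF φ, ∃ y : U j, q y = p ^ j • w ∧
          ∃ u ∈ lowU e deg (i + 1), ∃ h, (y : H) = u + p ^ (k + (i + 1)) • h := by
        intro w hw
        have hw' : w ∈ Cv.imF (powLift p κ n) := by rwa [← Cv.imF_eq φ]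
        clear hw
        induction hw' using Submodule.span_induction with
        | mem w hw =>
          obtain ⟨w, rfl⟩ := hw
          obtain ⟨z, rfl⟩ := hqs w
          obtain ⟨u, hu, h, hh⟩ := ih z.2
          obtain ⟨u', hu', h', hh'⟩ := hr.exists_frob_eq_add (i + 1) h
          refine ⟨Cs.frob _ z, hqF _ _ _ (hCs _ _), Cr.frob _ u + p ^ k • u',
            Submodule.add_mem _ (hr.frob_mem hu) (Submodule.smul_of_tower_mem _ _ hu'), h', ?_⟩
          rw [hCs, hh, map_add, map_nsmul, hh', smul_add, ← mul_smul, ← pow_add, add_assoc]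
        | zero => exact ⟨0, by simp, 0, Submodule.zero_mem _, 0, by simp⟩
        | add w w' _ _ h h' =>
          obtain ⟨y, hy, s, hs, t, ht⟩ := h
          obtain ⟨y', hy', s', hs', t', ht'⟩ := h'
          exact ⟨y + y', by rw [map_add, hy, hy', smul_add], s + s', Submodule.add_mem _ hs hs',
            t + t', by rw [Submodule.coe_add, ht, ht', smul_add]; abel⟩
        | smul a w _ h =>
          obtain ⟨y, hy, s, hs, t, ht⟩ := h
          exact ⟨a • y, by rw [map_smul, hy, smul_comm], a • s, Submodule.smul_mem _ _ hs, a • t, by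
            rw [Submodule.coe_smul, ht, smul_add, smul_comm]⟩
      obtain ⟨y, hy, u, hu, h, hh⟩ := h1 (q ⟨x, hx⟩) (by rw [hunit]; trivial)
      have h2 : ((p ^ j • (⟨x, hx⟩ : U j) - y : U j) : H) ∈ FCrystal.pred U j := by
        rw [← hker, map_sub, map_nsmul, hy, sub_self]
      have h3 := Submodule.add_mem _ (hpred h2) hu
      obtain ⟨l, rfl⟩ := Nat.exists_eq_add_of_le hji
      refine ⟨x - p ^ (k + 1) • (p ^ l • h), mem_lowU_of_nsmul e deg (k := j) ?_, p ^ l • h, by abel⟩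
      have e1 : p ^ j • (x - p ^ (k + 1) • (p ^ l • h)) =
          ((p ^ j • (⟨x, hx⟩ : U j) - y : U j) : H) + u := by
        rw [Submodule.coe_sub, hh, smul_sub, ← mul_smul, ← mul_smul, ← pow_add, ← pow_add,
          show j + (k + 1) + l = k + (j + l + 1) by omega]
        change _ = p ^ j • x - _ + u
        abel
      rw [e1]
      exact h3
  have hle : ∀ j ≤ i, U j ≤ lowU e deg (i + 1) := by
    intro j
    induction j with
    | zero => exact fun h => hstep 0 h bot_le
    | succ j ih => exact fun h => hstep (j + 1) h (ih (by omega))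
  apply le_antisymm (hle i le_rfl)
  -- Both modules have the same reduction, so the inclusion just proved is an equality by Nakayama.
  refine le_of_forall_exists_add_nsmul (fg_lowU e deg _) fun x hx => ?_
  have h1 : red p κ n H x ∈ Submodule.map (red p κ n H) (U i) := by
    rw [(hU.lifts i).2, ← (hr.lifts φ i).2]
    exact ⟨x, hx, rfl⟩
  obtain ⟨y, hy, hyx⟩ := h1
  obtain ⟨z, hz⟩ := (red_eq_iff _ _).1 hyx.symm
  refine ⟨y, hy, z, mem_lowU_of_nsmul e deg (k := 1) ?_, hz⟩
  have := Submodule.sub_mem _ hx (hle i le_rfl hy)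
  rw [hz, add_sub_cancel_left] at this
  rwa [pow_one]

end Filtration

/-! ### Block unitriangular matrices -/

section Unitriangular

variable {R S : Type*} [CommRing R] [CommRing S] {ι : Type*} [Fintype ι] [DecidableEq ι]
  {deg : ι → ℕ}

/-- Block upper triangular with identity diagonal blocks, with respect to the grading `deg`. -/
def IsUnitriangular (deg : ι → ℕ) (M : Matrix ι ι R) : Prop :=
  ∀ a b, deg b ≤ deg a → M a b = (1 : Matrix ι ι R) a b

theorem IsUnitriangular.blockTriangular {M : Matrix ι ι R} (h : IsUnitriangular deg M) :
    M.BlockTriangular deg := fun a b hab => by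
  rw [h a b hab.le, Matrix.one_apply_ne]
  rintro rfl
  exact lt_irrefl _ hab

theorem IsUnitriangular.det_eq_one {M : Matrix ι ι R} (h : IsUnitriangular deg M) :
    M.det = 1 := by
  rw [h.blockTriangular.det]
  refine Finset.prod_eq_one fun k _ => ?_
  have : M.toSquareBlock deg k = 1 := by
    ext ⟨a, ha⟩ ⟨b, hb⟩
    rw [Matrix.toSquareBlock_def, Matrix.of_apply, h a b (by rw [ha, hb]), Matrix.one_apply,
      Matrix.one_apply]
    simp only [Subtype.mk.injEq]
  rw [this, Matrix.det_one]

theorem IsUnitriangular.isUnit_det {M : Matrix ι ι R} (h : IsUnitriangular deg M) :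
    IsUnit M.det := by rw [h.det_eq_one]; exact isUnit_one

theorem IsUnitriangular.inv {M : Matrix ι ι R} (h : IsUnitriangular deg M) :
    IsUnitriangular deg M⁻¹ := by
  have : Invertible M := M.invertibleOfIsUnitDet h.isUnit_det
  have hB := Matrix.blockTriangular_inv_of_blockTriangular h.blockTriangular
  intro a b hab
  rcases hab.lt_or_eq with hlt | heq
  · rw [hB hlt, Matrix.one_apply_ne]
    rintro rfl
    exact lt_irrefl _ hlt
  · have h1 : (M * M⁻¹) a b = (1 : Matrix ι ι R) a b := by rw [M.mul_nonsing_inv h.isUnit_det]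
    rw [Matrix.mul_apply, Finset.sum_eq_single a, h a a le_rfl, Matrix.one_apply_eq, one_mul] at h1
    · exact h1
    · intro c _ hca
      rcases le_or_gt (deg c) (deg a) with h2 | h2
      · rw [h a c h2, Matrix.one_apply_ne hca.symm, zero_mul]
      · rw [hB (heq.trans_lt h2), mul_zero]
    · simp

theorem IsUnitriangular.map {M : Matrix ι ι R} (h : IsUnitriangular deg M) (f : R →+* S) :
    IsUnitriangular deg (M.map f) := fun a b hab => by
  rw [Matrix.map_apply, h a b hab, Matrix.one_apply, Matrix.one_apply]
  split_ifs
  · exact map_one f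
  · exact map_zero f

end Unitriangular

/-! ### Frobenius on W(κ)[1/p] and its power series -/

section FracFrobenius

variable (p : ℕ) [Fact p.Prime] (κ : Type v) [Field κ] [CharP κ p] [PerfectRing κ p]

/-- The Frobenius endomorphism of `W(κ)[1/p]`. -/
abbrev fracFrob : KK p κ →+* KK p κ := (WittVector.FractionRing.frobenius p κ : KK p κ →+* KK p κ)

/-- The endomorphism `t_i ↦ t_i ^ p` of `K[[t_1, …, t_n]]` over the Frobenius of `K`. -/
abbrev fracExpand (n : ℕ) : KPS p κ n →+* KPS p κ n :=
  frobExpand (Fact.out : p.Prime).ne_zero (fracFrob p κ)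

variable {p κ}

theorem fracFrob_algebraMap (w : WittVector p κ) :
    fracFrob p κ (algebraMap _ (KK p κ) w) = algebraMap _ (KK p κ) (WittVector.frobenius w) := by
  change IsFractionRing.ringEquivOfRingEquiv (WittVector.frobeniusEquiv p κ) _ = _
  rw [IsFractionRing.ringEquivOfRingEquiv_algebraMap]
  rfl

theorem toKPS_powLift {n : ℕ} (f : PS p κ n) :
    toKPS ((powLift p κ n).toRingHom f) = fracExpand p κ n (toKPS f) :=
  map_frobExpand _ _ _ _ (RingHom.ext fun w => (fracFrob_algebraMap w).symm) f

theorem coeff_toKPS {n : ℕ} (f : PS p κ n) (d : Fin n →₀ ℕ) :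
    coeff d (toKPS f) = algebraMap (WittVector p κ) (KK p κ) (coeff d f) := coeff_map _ _ _

theorem constantCoeff_toKPS {n : ℕ} (f : PS p κ n) :
    constantCoeff (toKPS f) = algebraMap (WittVector p κ) (KK p κ) (constantCoeff f) :=
  coeff_toKPS f 0

theorem pderiv_toKPS {n : ℕ} (f : PS p κ n) (j : Fin n) :
    pderiv (KK p κ) j (toKPS f) = toKPS (pderiv (WittVector p κ) j f) := by
  ext d
  rw [coeff_pderiv, coeff_toKPS, coeff_toKPS, coeff_pderiv, map_mul, map_add, map_natCast, map_one]

theorem p_ne_zero_KK : (p : KK p κ) ≠ 0 := Nat.cast_ne_zero.2 (Fact.out : p.Prime).ne_zero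

end FracFrobenius

/-! ### Solving the Frobenius equation for the trivializing matrix -/

section Horizontal

variable {p : ℕ} [Fact p.Prime] {κ : Type v} [Field κ] [CharP κ p] [PerfectRing κ p] {n : ℕ}
  {ι : Type*} [Fintype ι] [DecidableEq ι] {deg : ι → ℕ}

/-- This is the constant term of T r P = P φ(T) after writing T_ab(0) = p^(deg b - deg a) β_ab and
cancelling p^(deg b). Applying σ⁻¹ makes it a fixed point problem: terms with deg c > deg a carry a
factor p, and those with deg c = deg a reduce to r_ab because β has identity diagonal blocks. -/
theorem exists_wittVector_frobenius_eq (r : Matrix ι ι (WittVector p κ)) (hr : IsUnitriangular deg r) :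
    ∃ β : Matrix ι ι (WittVector p κ), IsUnitriangular deg β ∧
      ∀ a b, deg a ≤ deg b → WittVector.frobenius (β a b) =
        ∑ c, if deg a ≤ deg c then (p : WittVector p κ) ^ (deg c - deg a) * β a c * r c b else 0 := by
  let σ := WittVector.frobeniusEquiv p κ
  let Φ : Matrix ι ι (WittVector p κ) → Matrix ι ι (WittVector p κ) := fun β => Matrix.of fun a b =>
    σ.symm (r a b + ∑ c, if deg a < deg c then
      (p : WittVector p κ) ^ (deg c - deg a) * β a c * r c b else 0)
  obtain ⟨β, hβ⟩ := ((padicallyComplete_wittVector (p := p) (κ := κ)).matrix ι).exists_fixedPoint Φ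
    (by
      intro k x y hxy
      rw [natCast_pow_dvd_matrix_iff] at hxy ⊢
      intro a b
      change _ ∣ σ.symm _ - σ.symm _
      rw [← map_sub, add_sub_add_left_eq_sub, ← Finset.sum_sub_distrib]
      have : (p : WittVector p κ) ^ (k + 1) = σ.symm ((p : WittVector p κ) ^ (k + 1)) := by
        rw [map_pow, map_natCast]
      rw [this]
      refine map_dvd σ.symm (Finset.dvd_sum fun c _ => ?_)
      split_ifs with h
      · rw [mul_assoc, mul_assoc, ← mul_sub, ← sub_mul]
        obtain ⟨l, hl⟩ := Nat.exists_eq_add_of_lt h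
        have e1 : deg c - deg a = l + 1 := by omega
        rw [e1, add_comm k 1, pow_add, pow_add]
        rw [pow_one]
        refine mul_dvd_mul (Dvd.intro_left _ rfl) ((hxy a c).trans ?_)
        exact Dvd.intro _ rfl
      · simp)
  have hfix : ∀ a b, σ (β a b) = r a b + ∑ c, if deg a < deg c then
      (p : WittVector p κ) ^ (deg c - deg a) * β a c * r c b else 0 := by
    intro a b
    conv_lhs => rw [← hβ]
    exact σ.apply_symm_apply _
  have htri : IsUnitriangular deg β := by
    intro a b hab
    apply σ.injective
    rw [hfix, hr a b hab, Finset.sum_eq_zero, add_zero, Matrix.one_apply]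
    · split_ifs
      · rw [map_one]
      · rw [map_zero]
    · intro c _
      split_ifs with h
      · rw [hr c b (by omega), Matrix.one_apply_ne, mul_zero]
        rintro rfl
        omega
      · rfl
  refine ⟨β, htri, fun a b hab => ?_⟩
  change σ (β a b) = _
  rw [hfix, ← Finset.sum_erase_add _ _ (Finset.mem_univ a), if_neg (lt_irrefl _), add_zero,
    ← Finset.sum_erase_add (a := a) _ _ (Finset.mem_univ a), if_pos le_rfl, Nat.sub_self, pow_zero, one_mul,
    htri a a le_rfl, Matrix.one_apply_eq, one_mul, add_comm]
  congr 1
  refine Finset.sum_congr rfl fun c hc => ?_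
  have hca := Finset.ne_of_mem_erase hc
  by_cases h1 : deg a < deg c
  · rw [if_pos h1, if_pos h1.le]
  · rw [if_neg h1]
    split_ifs with h2
    · rw [htri a c (by omega), Matrix.one_apply_ne hca.symm, mul_zero, zero_mul]
    · rfl

/-- The solution `T` of `T * r * diag(p ^ deg) = diag(p ^ deg) * φ(T)`, for the Frobenius lift
`φ` with `φ(t_i) = t_i ^ p` and a unitriangular matrix `r`. -/
theorem exists_frobenius_trivialization (r : Matrix ι ι (PS p κ n)) (hr : IsUnitriangular deg r) :
    ∃ T : Matrix ι ι (KPS p κ n), IsUnitriangular deg T ∧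
      (∀ a b, deg a ≤ deg b → ∃ w, constantCoeff (T a b) =
        algebraMap (WittVector p κ) (KK p κ) ((p : WittVector p κ) ^ (deg b - deg a) * w)) ∧
      (∀ a b, constantCoeff (T a b) ∈ (algebraMap (WittVector p κ) (KK p κ)).range) ∧
      ∀ a b, T a b = ∑ c, C ((p : KK p κ) ^ deg a / p ^ deg c) * fracExpand p κ n (T a c) *
        toKPS (r⁻¹ c b) := by
  have hp1 : 1 < p := (Fact.out : p.Prime).one_lt
  obtain ⟨β, hβ, hβr⟩ := exists_wittVector_frobenius_eq (r.map constantCoeff) (hr.map constantCoeff)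
  let B : ι → ι → KK p κ := fun a b => if deg a ≤ deg b then
    algebraMap (WittVector p κ) (KK p κ) ((p : WittVector p κ) ^ (deg b - deg a) * β a b) else 0
  -- The equation T = P φ(T) P⁻¹ r⁻¹, with the constant terms of T reset to B before φ is applied.
  -- Only then does φ contract in degree.
  let Φ : Matrix ι ι (KPS p κ n) → Matrix ι ι (KPS p κ n) := fun T => Matrix.of fun a b =>
    ∑ c, C ((p : KK p κ) ^ deg a / p ^ deg c) *
      fracExpand p κ n (T a c + C (B a c - constantCoeff (T a c))) * toKPS (r⁻¹ c b)
  obtain ⟨T, hT⟩ := exists_fixedPoint_of_degree_contraction Φ (by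
    intro k X Y hXY a b d hd
    change coeff d (∑ c, _) = coeff d (∑ c, _)
    rw [map_sum, map_sum]
    refine Finset.sum_congr rfl fun c _ => ?_
    refine coeff_mul_congr (k := k + 1) (fun d hd => ?_) (fun _ _ => rfl) d hd
    rw [coeff_C_mul, coeff_C_mul]
    congr 1
    refine coeff_frobExpand_congr _ hp1 _ (k := k) ?_ (fun d hd => ?_) d hd
    · rw [map_add, map_add, constantCoeff_C, constantCoeff_C]; ring
    · rw [map_add, map_add, hXY a c d hd]
      congr 1
      rw [← coeff_zero_eq_constantCoeff_apply, ← coeff_zero_eq_constantCoeff_apply, hXY a c 0 (by rw [map_zero]; omega)])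
  have hpK := p_ne_zero_KK (p := p) (κ := κ)
  have hB : ∀ a c, ((p : KK p κ) ^ deg a / p ^ deg c) * fracFrob p κ (B a c) =
      ∑ b, B a b * algebraMap (WittVector p κ) (KK p κ) (constantCoeff (r b c)) := by
    intro a c
    by_cases hac : deg a ≤ deg c
    · have e1 : ((p : KK p κ) ^ deg a / p ^ deg c) * fracFrob p κ (B a c) =
          algebraMap (WittVector p κ) (KK p κ) (WittVector.frobenius (β a c)) := by
        simp only [B]
        rw [if_pos hac, fracFrob_algebraMap, map_mul, map_mul, map_pow, map_pow, map_natCast,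
          map_natCast]
        obtain ⟨l, hl⟩ := Nat.exists_eq_add_of_le hac
        rw [hl, Nat.add_sub_cancel_left, pow_add]
        field_simp
      rw [e1, hβr a c hac, map_sum]
      refine Finset.sum_congr rfl fun b _ => ?_
      simp only [B]
      split_ifs
      · rw [map_mul]; rfl
      · rw [map_zero, zero_mul]
    · simp only [B]
      rw [if_neg hac, map_zero, mul_zero, eq_comm]
      refine Finset.sum_eq_zero fun b _ => ?_
      split_ifs with h
      · rw [hr b c (by omega), Matrix.one_apply_ne, map_zero, map_zero, mul_zero]
        rintro rfl
        omega
      · rw [zero_mul]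
  -- B already solves the constant-term equation, so the reset in Φ is vacuous at the fixed point.
  have hconst : ∀ a b, constantCoeff (T a b) = B a b := by
    intro a b
    conv_lhs => rw [← hT]
    change constantCoeff (∑ c, _) = _
    have e1 : ∀ c, constantCoeff (C ((p : KK p κ) ^ deg a / p ^ deg c) *
        fracExpand p κ n (T a c + C (B a c - constantCoeff (T a c))) * toKPS (r⁻¹ c b)) =
        ∑ d, B a d * (algebraMap (WittVector p κ) (KK p κ) (constantCoeff (r d c * r⁻¹ c b))) := by
      intro c
      rw [map_mul, map_mul, constantCoeff_frobExpand, constantCoeff_C, map_add, constantCoeff_C,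
        add_sub_cancel, hB, constantCoeff_toKPS, Finset.sum_mul]
      refine Finset.sum_congr rfl fun d _ => ?_
      rw [map_mul, map_mul, mul_assoc]
    rw [map_sum, Finset.sum_congr rfl fun c _ => e1 c, Finset.sum_comm]
    have e2 : ∀ d, ∑ c, B a d * (algebraMap (WittVector p κ) (KK p κ)
        (constantCoeff (r d c * r⁻¹ c b))) = B a d * if d = b then 1 else 0 := by
      intro d
      rw [← Finset.mul_sum, ← map_sum, ← map_sum, ← Matrix.mul_apply,
        r.mul_nonsing_inv hr.isUnit_det, Matrix.one_apply]
      split_ifs <;> simp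
    rw [Finset.sum_congr rfl fun d _ => e2 d]
    simp
  have hfix : ∀ a b, T a b = ∑ c, C ((p : KK p κ) ^ deg a / p ^ deg c) *
      fracExpand p κ n (T a c) * toKPS (r⁻¹ c b) := by
    intro a b
    conv_lhs => rw [← hT]
    change (∑ c, _) = _
    refine Finset.sum_congr rfl fun c _ => ?_
    rw [hconst, sub_self, map_zero, add_zero]
  have hB1 : ∀ a b, deg b ≤ deg a → B a b = (1 : Matrix ι ι (KK p κ)) a b := by
    intro a b hab
    simp only [B]
    split_ifs with h
    · rw [show deg b - deg a = 0 by omega, pow_zero, one_mul, hβ a b hab, Matrix.one_apply,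
        Matrix.one_apply]
      split_ifs
      · rw [map_one]
      · rw [map_zero]
    · rw [Matrix.one_apply_ne]
      rintro rfl
      exact h le_rfl
  refine ⟨T, ?_, fun a b hab => ⟨β a b, ?_⟩, fun a b => ?_, hfix⟩
  · have key : ∀ k a b, deg b ≤ deg a → ∀ d : Fin n →₀ ℕ, d.degree < k →
        coeff d (T a b) = coeff d ((1 : Matrix ι ι (KPS p κ n)) a b) := by
      intro k
      induction k with
      | zero => intro a b _ d hd; omega
      | succ k ih =>
        intro a b hab d hd
        have e1 : coeff d (T a b) = ∑ c, coeff d (C ((p : KK p κ) ^ deg a / p ^ deg c) *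
            fracExpand p κ n ((1 : Matrix ι ι (KPS p κ n)) a c) * toKPS (r⁻¹ c b)) := by
          conv_lhs => rw [hfix, map_sum]
          refine Finset.sum_congr rfl fun c _ => ?_
          by_cases hc : deg c ≤ deg a
          · refine coeff_mul_congr (k := k + 1) (fun d hd => ?_) (fun _ _ => rfl) d hd
            rw [coeff_C_mul, coeff_C_mul]
            congr 1
            refine coeff_frobExpand_congr _ hp1 _ (k := k) ?_ (fun d hd => ih a c hc d hd) d hd
            rw [hconst, hB1 a c hc, Matrix.one_apply, Matrix.one_apply]
            split_ifs <;> simp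
          · rw [hr.inv c b (by omega), Matrix.one_apply_ne, map_zero, mul_zero, mul_zero]
            rintro rfl
            omega
        rw [e1, Finset.sum_eq_single a]
        · rw [Matrix.one_apply_eq, map_one, mul_one, div_self (pow_ne_zero _ hpK), map_one, one_mul,
            hr.inv a b hab, Matrix.one_apply, Matrix.one_apply]
          split_ifs <;> simp
        · intro c _ hc
          rw [Matrix.one_apply_ne hc.symm, map_zero, mul_zero, zero_mul, map_zero]
        · simp
    intro a b hab
    ext d
    exact key (d.degree + 1) a b hab d (by omega)
  · rw [hconst]
    exact if_pos hab
  · rw [hconst]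
    simp only [B]
    split_ifs
    · exact ⟨_, rfl⟩
    · exact zero_mem _

end Horizontal

/-! ### p-adic bounds on coefficients and logarithmic growth -/

section Balls

variable {p : ℕ} [Fact p.Prime] {κ : Type v} [Field κ] [CharP κ p] [PerfectRing κ p] {n : ℕ}

variable (p κ) in
/-- The lattice `p ^ r W` in `K = W[1/p]`. -/
def intBall (r : ℕ) : Submodule (WittVector p κ) (KK p κ) where
  carrier := {x | ∃ w, x = algebraMap _ _ ((p : WittVector p κ) ^ r * w)}
  add_mem' := by
    rintro _ _ ⟨w, rfl⟩ ⟨w', rfl⟩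
    exact ⟨w + w', by rw [mul_add, map_add]⟩
  zero_mem' := ⟨0, by rw [mul_zero, map_zero]⟩
  smul_mem' := by
    rintro c _ ⟨w, rfl⟩
    exact ⟨c * w, by rw [Algebra.smul_def, ← map_mul]; congr 1; ring⟩

theorem intBall_anti {r s : ℕ} (h : r ≤ s) {x : KK p κ} (hx : x ∈ intBall p κ s) :
    x ∈ intBall p κ r := by
  obtain ⟨w, rfl⟩ := hx
  exact ⟨(p : WittVector p κ) ^ (s - r) * w, by rw [← mul_assoc, ← pow_add, Nat.add_sub_cancel' h]⟩

theorem mul_mem_intBall {r s : ℕ} {x y : KK p κ} (hx : x ∈ intBall p κ r)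
    (hy : y ∈ intBall p κ s) : x * y ∈ intBall p κ (r + s) := by
  obtain ⟨w, rfl⟩ := hx
  obtain ⟨w', rfl⟩ := hy
  exact ⟨w * w', by rw [← map_mul, pow_add]; congr 1; ring⟩

theorem algebraMap_mem_intBall {r : ℕ} {w : WittVector p κ} (h : (p : WittVector p κ) ^ r ∣ w) :
    algebraMap _ (KK p κ) w ∈ intBall p κ r := by
  obtain ⟨w, rfl⟩ := h
  exact ⟨w, rfl⟩

theorem mem_intBall_zero {x : KK p κ} :
    x ∈ intBall p κ 0 ↔ x ∈ (algebraMap (WittVector p κ) (KK p κ)).range := by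
  constructor
  · rintro ⟨w, rfl⟩
    exact ⟨_, rfl⟩
  · rintro ⟨w, rfl⟩
    exact ⟨w, by rw [pow_zero, one_mul]⟩

theorem pow_mem_intBall (r : ℕ) : (p : KK p κ) ^ r ∈ intBall p κ r :=
  ⟨1, by rw [mul_one, map_pow, map_natCast]⟩

theorem natCast_mem_intBall (r : ℕ) : (r : KK p κ) ∈ intBall p κ 0 :=
  ⟨r, by rw [pow_zero, one_mul, map_natCast]⟩

theorem mem_intBall_of_pow_mul {r s : ℕ} {x : KK p κ}
    (h : (p : KK p κ) ^ s * x ∈ intBall p κ (s + r)) : x ∈ intBall p κ r := by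
  obtain ⟨w, hw⟩ := h
  refine ⟨w, mul_left_cancel₀ (pow_ne_zero s p_ne_zero_KK) ?_⟩
  rw [hw, pow_add, mul_assoc, map_mul, map_pow _ _ s, map_natCast]

theorem fracFrob_mem_intBall {r : ℕ} {x : KK p κ} (h : x ∈ intBall p κ r) :
    fracFrob p κ x ∈ intBall p κ r := by
  obtain ⟨w, rfl⟩ := h
  rw [fracFrob_algebraMap, map_mul, map_pow, map_natCast]
  exact ⟨_, rfl⟩

theorem coeff_mul_mem_intBall {f g : KPS p κ n} {r : ℕ} {d : Fin n →₀ ℕ}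
    (h : ∀ d₁ d₂, d₁ + d₂ = d → coeff d₁ f * coeff d₂ g ∈ intBall p κ r) :
    coeff d (f * g) ∈ intBall p κ r := by
  classical
  rw [coeff_mul]
  exact Submodule.sum_mem _ fun x hx => h _ _ (Finset.HasAntidiagonal.mem_antidiagonal.1 hx)

/-- The denominators of the coefficients of `f` grow at most logarithmically. -/
def LogGrowth (N : ℕ) (f : KPS p κ n) : Prop :=
  ∀ (k : ℕ) (m : Fin n →₀ ℕ), m.degree < p ^ k → (p : KK p κ) ^ (N * k) * coeff m f ∈ intBall p κ 0

theorem LogGrowth.sum {N : ℕ} {ι : Type*} (s : Finset ι) {f : ι → KPS p κ n}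
    (hf : ∀ i, LogGrowth N (f i)) : LogGrowth N (∑ i ∈ s, f i) := fun k m hm => by
  rw [map_sum, Finset.mul_sum]
  exact Submodule.sum_mem _ fun i _ => hf i k m hm

theorem degree_add_eq_of_eq {d₁ d₂ d : Fin n →₀ ℕ} (h : d₁ + d₂ = d) : d₁.degree + d₂.degree = d.degree := by
  rw [← h, map_add]

theorem LogGrowth.mul_toKPS {N : ℕ} {f : KPS p κ n} (hf : LogGrowth N f) (g : PS p κ n) :
    LogGrowth N (f * toKPS g) := fun k m hm => by
  rw [← coeff_C_mul, ← mul_assoc]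
  refine coeff_mul_mem_intBall fun d₁ d₂ hd => ?_
  rw [coeff_C_mul, coeff_toKPS]
  exact mul_mem_intBall (s := 0) (hf k d₁ (by have := degree_add_eq_of_eq hd; omega))
    (algebraMap_mem_intBall (by rw [pow_zero]; exact one_dvd _))

end Balls

/-! ### Growth, Frobenius equation and horizontality of the rows of T -/

section Trivialization

variable {p : ℕ} [Fact p.Prime] {κ : Type v} [Field κ] [CharP κ p] [PerfectRing κ p] {n : ℕ}
  {H : Type u} [AddCommGroup H] [Module (PS p κ n) H] {ι : Type} [Fintype ι] [DecidableEq ι]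
  {deg : ι → ℕ}

/-- One application of the Frobenius equation divides the relevant degrees by p and costs at most
p^N in denominators. Degrees below p^k thus cost at most p^(N k), starting from integral constant
terms. -/
theorem logGrowth_of_frobenius_eq {N : ℕ} (hN : ∀ a, deg a ≤ N) {T : Matrix ι ι (KPS p κ n)}
    {s : Matrix ι ι (PS p κ n)}
    (h0 : ∀ a b, constantCoeff (T a b) ∈ (algebraMap (WittVector p κ) (KK p κ)).range)
    (hT : ∀ a b, T a b = ∑ c, C ((p : KK p κ) ^ deg a / p ^ deg c) * fracExpand p κ n (T a c) *
      toKPS (s c b)) (a b : ι) : LogGrowth N (T a b) := by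
  intro k
  induction k generalizing b with
  | zero =>
    intro m hm
    have : m = 0 := by rwa [pow_zero, Nat.lt_one_iff, Finsupp.degree_eq_zero_iff] at hm
    rw [this, mul_zero, pow_zero, one_mul, mem_intBall_zero]
    exact h0 a b
  | succ k ih =>
    intro m hm
    rw [hT, map_sum, Finset.mul_sum]
    refine Submodule.sum_mem _ fun c _ => ?_
    rw [mul_assoc, coeff_C_mul, ← mul_assoc]
    have e1 : (p : KK p κ) ^ (N * (k + 1)) * ((p : KK p κ) ^ deg a / p ^ deg c) =
        (p : KK p κ) ^ (N - deg c + deg a) * p ^ (N * k) := by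
      have hpK := p_ne_zero_KK (p := p) (κ := κ)
      obtain ⟨l, hl⟩ := Nat.exists_eq_add_of_le (hN c)
      rw [hl, Nat.add_sub_cancel_left, ← hl, mul_add, mul_one, pow_add, pow_add, hl, pow_add]
      field_simp
    rw [e1, mul_assoc]
    refine mul_mem_intBall (r := 0) (s := 0) (intBall_anti (Nat.zero_le _) (pow_mem_intBall _)) ?_
    rw [← coeff_C_mul, ← mul_assoc]
    refine coeff_mul_mem_intBall fun d₁ d₂ hd => ?_
    rw [coeff_C_mul, coeff_toKPS]
    refine mul_mem_intBall (r := 0) (s := 0) ?_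
      (algebraMap_mem_intBall (by rw [pow_zero]; exact one_dvd _))
    by_cases hd1 : ∃ m', d₁ = p • m'
    · obtain ⟨m', rfl⟩ := hd1
      rw [coeff_frobExpand_smul]
      have h1 : m'.degree < p ^ k := by
        have h2 := degree_add_eq_of_eq hd
        rw [map_nsmul, smul_eq_mul] at h2
        have h3 : p * m'.degree < p * p ^ k := by rw [← pow_succ']; omega
        exact lt_of_mul_lt_mul_left h3 (Nat.zero_le _)
      have h4 := fracFrob_mem_intBall (ih c m' h1)
      rwa [map_mul, map_pow, map_natCast] at h4
    · push Not at hd1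
      rw [coeff_frobExpand_eq_zero _ _ _ hd1, mul_zero]
      exact zero_mem _

/-- The linear forms `x ↦ ∑_b T_{ab} x_b`. -/
def rowForm (e : Module.Basis ι (PS p κ n) H) (T : Matrix ι ι (KPS p κ n)) (a : ι) :
    H →ₛₗ[(toKPS : PS p κ n →+* KPS p κ n)] KPS p κ n where
  toFun x := ∑ b, T a b * toKPS (e.repr x b)
  map_add' x y := by
    rw [← Finset.sum_add_distrib]
    refine Finset.sum_congr rfl fun b _ => ?_
    rw [map_add, Finsupp.add_apply, map_add, mul_add]
  map_smul' c x := by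
    rw [Finset.smul_sum]
    refine Finset.sum_congr rfl fun b _ => ?_
    rw [map_smul, Finsupp.smul_apply, smul_eq_mul, map_mul, smul_eq_mul]
    ring

theorem rowForm_apply (e : Module.Basis ι (PS p κ n) H) (T : Matrix ι ι (KPS p κ n)) (a : ι) (x : H) :
    rowForm e T a x = ∑ b, T a b * toKPS (e.repr x b) := rfl

theorem rowForm_basis (e : Module.Basis ι (PS p κ n) H) (T : Matrix ι ι (KPS p κ n)) (a b : ι) :
    rowForm e T a (e b) = T a b := by
  rw [rowForm_apply, Finset.sum_eq_single b]
  · rw [e.repr_self, Finsupp.single_eq_same, map_one, mul_one]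
  · intro c _ hc
    rw [e.repr_self, Finsupp.single_eq_of_ne hc, map_zero, mul_zero]
  · simp

theorem logGrowth_rowForm (e : Module.Basis ι (PS p κ n) H) {N : ℕ} {T : Matrix ι ι (KPS p κ n)}
    (hT : ∀ a b, LogGrowth N (T a b)) (a : ι) (x : H) : LogGrowth N (rowForm e T a x) :=
  LogGrowth.sum _ fun b => (hT a b).mul_toKPS _

variable {e : Module.Basis ι (PS p κ n) H} {Cr : FCrystal p κ n H} {r : Matrix ι ι (PS p κ n)}

theorem IsNormalBasis.isUnitriangular (hr : IsNormalBasis e deg Cr r) : IsUnitriangular deg r := by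
  intro a b hab
  rcases hab.lt_or_eq with h | h
  · rw [hr.lower a b h, Matrix.one_apply_ne]
    rintro rfl
    exact lt_irrefl _ h
  · by_cases hab' : a = b
    · subst hab'
      rw [hr.diag_self, Matrix.one_apply_eq]
    · rw [hr.diag_ne a b hab' h.symm, Matrix.one_apply_ne hab']

/-- The matrix equation T r P = P φ(T), tested on basis vectors and extended by semilinearity. -/
theorem IsNormalBasis.rowForm_frob (hr : IsNormalBasis e deg Cr r) {T : Matrix ι ι (KPS p κ n)}
    (hT : ∀ a b, T a b = ∑ c, C ((p : KK p κ) ^ deg a / p ^ deg c) * fracExpand p κ n (T a c) *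
      toKPS (r⁻¹ c b)) (a : ι) (x : H) :
    rowForm e T a (Cr.frob (powLift p κ n) x) =
      (p : KPS p κ n) ^ deg a * fracExpand p κ n (rowForm e T a x) := by
  have hpK := p_ne_zero_KK (p := p) (κ := κ)
  have hTr : ∀ b, ∑ c, T a c * toKPS (r c b) =
      C ((p : KK p κ) ^ deg a / p ^ deg b) * fracExpand p κ n (T a b) := by
    intro b
    have e1 : ∀ c, T a c * toKPS (r c b) = ∑ d, C ((p : KK p κ) ^ deg a / p ^ deg d) *
        fracExpand p κ n (T a d) * toKPS (r⁻¹ d c * r c b) := by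
      intro c
      conv_lhs => rw [hT, Finset.sum_mul]
      refine Finset.sum_congr rfl fun d _ => ?_
      rw [map_mul, mul_assoc]
    rw [Finset.sum_congr rfl fun c _ => e1 c, Finset.sum_comm]
    have e2 : ∀ d, ∑ c, C ((p : KK p κ) ^ deg a / p ^ deg d) * fracExpand p κ n (T a d) *
        toKPS (r⁻¹ d c * r c b) = C ((p : KK p κ) ^ deg a / p ^ deg d) *
          fracExpand p κ n (T a d) * if d = b then 1 else 0 := by
      intro d
      rw [← Finset.mul_sum, ← map_sum, ← Matrix.mul_apply,
        r.nonsing_inv_mul hr.isUnitriangular.isUnit_det, Matrix.one_apply]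
      split_ifs <;> simp
    rw [Finset.sum_congr rfl fun d _ => e2 d]
    simp
  have hb : ∀ b, rowForm e T a (Cr.frob (powLift p κ n) (e b)) =
      (p : KPS p κ n) ^ deg a * fracExpand p κ n (T a b) := by
    intro b
    have e1 : ∀ c, T a c * toKPS (e.repr (Cr.frob (powLift p κ n) (e b)) c) =
        C ((p : KK p κ) ^ deg b) * (T a c * toKPS (r c b)) := by
      intro c
      rw [hr.repr_frob, map_mul, map_pow, map_natCast, map_pow, map_natCast]
      ring
    rw [rowForm_apply, Finset.sum_congr rfl fun c _ => e1 c, ← Finset.mul_sum, hTr, ← mul_assoc,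
      ← map_mul, mul_div_cancel₀ _ (pow_ne_zero _ hpK), map_pow, map_natCast]
  conv_lhs => rw [← e.sum_repr x]
  rw [map_sum, map_sum, rowForm_apply, map_sum, Finset.mul_sum]
  refine Finset.sum_congr rfl fun b _ => ?_
  rw [LinearMap.map_smulₛₗ, LinearMap.map_smulₛₗ, hb, smul_eq_mul, map_mul, toKPS_powLift]
  ring

/-- The rows of `T` are horizontal. -/
theorem FCrystal.rowForm_D (Cr : FCrystal p κ n H) {T : Matrix ι ι (KPS p κ n)} {a : ι}
    (hF : ∀ x, rowForm e T a (Cr.frob (powLift p κ n) x) =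
      (p : KPS p κ n) ^ deg a * fracExpand p κ n (rowForm e T a x)) (j : Fin n) (x : H) :
    rowForm e T a (Cr.D j x) = pderiv (KK p κ) j (rowForm e T a x) := by
  have hp1 : 1 < p := (Fact.out : p.Prime).one_lt
  -- The defect of horizontality is linear, since the derivatives of coefficients cancel. It
  -- satisfies S(F x) = p^(deg a + 1) t_j^(p-1) φ(S x).
  let S : H →ₛₗ[(toKPS : PS p κ n →+* KPS p κ n)] KPS p κ n :=
    { toFun := fun x => pderiv (KK p κ) j (rowForm e T a x) - rowForm e T a (Cr.D j x)
      map_add' := fun x y => by rw [map_add, map_add, map_add, map_add]; ring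
      map_smul' := fun c x => by
        rw [LinearMap.map_smulₛₗ, Cr.leibniz, map_add, LinearMap.map_smulₛₗ, LinearMap.map_smulₛₗ,
          smul_eq_mul, smul_eq_mul, smul_eq_mul, smul_eq_mul, Derivation.leibniz, smul_eq_mul,
          smul_eq_mul, pderiv_toKPS]
        ring }
  have hS : ∀ x, S (Cr.frob (powLift p κ n) x) =
      (p : KPS p κ n) ^ (deg a + 1) * (X j ^ (p - 1) * fracExpand p κ n (S x)) := by
    intro x
    change pderiv (KK p κ) j (rowForm e T a _) - rowForm e T a (Cr.D j _) =
      _ * (_ * fracExpand p κ n (pderiv (KK p κ) j (rowForm e T a x) - rowForm e T a (Cr.D j x)))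
    rw [Cr.D_frob_powLift, LinearMap.map_smulₛₗ, hF, hF, ← Nat.cast_pow, ← nsmul_eq_mul, map_nsmul,
      pderiv_frobExpand, map_sub, map_mul, map_pow, map_natCast, nsmul_eq_mul, smul_eq_mul,
      Nat.cast_pow]
    have : (toKPS (X j : PS p κ n)) = X j := map_X _ _
    rw [this]
    ring
  obtain ⟨l, hl⟩ := Cr.isogeny (powLift p κ n)
  -- If S vanishes in degrees < k on H, the factor t_j^(p-1) makes it vanish in degree k on Im F,
  -- hence on p^l H ⊂ Im F, hence on H because p is invertible in K.
  have key : ∀ k x, ∀ d : Fin n →₀ ℕ, d.degree < k → coeff d (S x) = 0 := by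
    intro k
    induction k with
    | zero => intro x d hd; omega
    | succ k ih =>
      have h1 : ∀ x ∈ Submodule.span (PS p κ n) (Set.range (Cr.frob (powLift p κ n))),
          ∀ d : Fin n →₀ ℕ, d.degree < k + 1 → coeff d (S x) = 0 := by
        intro x hx
        induction hx using Submodule.span_induction with
        | mem x hx =>
          obtain ⟨x, rfl⟩ := hx
          intro d hd
          classical
          rw [hS, ← map_natCast (C (σ := Fin n) (R := KK p κ)), ← map_pow, coeff_C_mul, X_pow_eq,
            coeff_monomial_mul]
          split_ifs with hle
          · have hdeg : (d - Finsupp.single j (p - 1)).degree < k := by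
              have h3 : d - Finsupp.single j (p - 1) + Finsupp.single j (p - 1) = d :=
                tsub_add_cancel_of_le hle
              have h4 := degree_add_eq_of_eq h3
              rw [Finsupp.degree_single] at h4
              omega
            by_cases hd1 : ∃ m', d - Finsupp.single j (p - 1) = p • m'
            · obtain ⟨m', hm'⟩ := hd1
              rw [hm', coeff_frobExpand_smul, ih, map_zero, mul_zero, mul_zero]
              rw [hm', map_nsmul, smul_eq_mul] at hdeg
              exact (Nat.le_mul_of_pos_left _ (by omega)).trans_lt hdeg
            · push Not at hd1
              rw [coeff_frobExpand_eq_zero _ _ _ hd1, mul_zero, mul_zero]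
          · exact mul_zero _
        | zero => intro d _; rw [map_zero, map_zero]
        | add x y _ _ hx hy => intro d hd; rw [map_add, map_add, hx d hd, hy d hd, add_zero]
        | smul c x _ hx =>
          intro d hd
          rw [LinearMap.map_smulₛₗ, smul_eq_mul,
            coeff_mul_congr (f' := toKPS c) (g' := 0) (k := k + 1) (fun _ _ => rfl)
              (fun d hd => by rw [hx d hd, map_zero]) d hd, mul_zero, map_zero]
      intro x d hd
      have h2 := h1 _ (hl x) d hd
      rw [map_nsmul, map_nsmul, nsmul_eq_mul, Nat.cast_pow] at h2
      exact (mul_eq_zero.1 h2).resolve_left (pow_ne_zero _ p_ne_zero_KK)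
  have h0 : S x = 0 := by
    ext d
    rw [key (d.degree + 1) x d (by omega), map_zero]
  exact (sub_eq_zero.1 h0).symm

end Trivialization

/-! ### Iterated partial derivatives of power series -/

section Partial

variable {R : Type*} [CommRing R] {n : ℕ}

variable (R) in
/-- The partial derivatives of power series, as additive endomorphisms. -/
def partialEnd (j : Fin n) : AddMonoid.End (MvPowerSeries (Fin n) R) :=
  (pderiv R j).toLinearMap.toAddMonoidHom

theorem partialEnd_apply (j : Fin n) (f : MvPowerSeries (Fin n) R) :
    partialEnd R j f = pderiv R j f := rfl

theorem coeff_partialEnd_pow (j : Fin n) (k : ℕ) (f : MvPowerSeries (Fin n) R) (e : Fin n →₀ ℕ) :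
    coeff e ((partialEnd R j ^ k) f) =
      ((e j + k).descFactorial k : R) * coeff (e + Finsupp.single j k) f := by
  induction k generalizing f with
  | zero => simp
  | succ k ih =>
    rw [pow_succ, end_mul_apply, ih, partialEnd_apply, coeff_pderiv, ← add_assoc (e j) k 1,
      Nat.succ_descFactorial_succ, add_assoc e, ← Finsupp.single_add, Finsupp.add_apply,
      Finsupp.single_eq_same]
    push_cast
    ring

theorem coeff_iterD_partialEnd (m : Fin n →₀ ℕ) (f : MvPowerSeries (Fin n) R) (e : Fin n →₀ ℕ) :
    coeff e (iterD (partialEnd R) m f) =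
      (∏ j, ((e j + m j).descFactorial (m j) : R)) * coeff (e + m) f := by
  have key : ∀ (l : List (Fin n)), l.Nodup → ∀ e : Fin n →₀ ℕ,
      coeff e ((l.map fun j => partialEnd R j ^ m j).prod f) =
        (l.map fun j => ((e j + m j).descFactorial (m j) : R)).prod *
          coeff (e + (l.map fun j => Finsupp.single j (m j)).sum) f := by
    intro l
    induction l with
    | nil => intro _ e; simp
    | cons j l ih =>
      intro hl e
      rw [List.nodup_cons] at hl
      rw [List.map_cons, List.prod_cons, end_mul_apply, coeff_partialEnd_pow, ih hl.2,
        List.map_cons, List.prod_cons, List.map_cons, List.sum_cons, ← mul_assoc, ← add_assoc]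
      congr 2
      congr 1
      refine List.map_congr_left fun i hi => ?_
      rw [Finsupp.add_apply, Finsupp.single_eq_of_ne, add_zero]
      rintro rfl
      exact hl.1 hi
  have h := key (List.finRange n) (List.nodup_finRange n) e
  rw [iterD, List.ofFn_eq_map, h, ← List.ofFn_eq_map, ← List.ofFn_eq_map, List.prod_ofFn,
    List.sum_ofFn, Finsupp.univ_sum_single]

theorem prod_X_pow_eq (k : Fin n →₀ ℕ) :
    ∏ j, (X j : MvPowerSeries (Fin n) R) ^ k j = monomial k 1 := by
  rw [monomial_one_eq, Finsupp.prod_fintype]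
  exact fun _ => pow_zero _

theorem iterD_partialEnd_prod_X (m k : Fin n →₀ ℕ) :
    iterD (partialEnd R) m (∏ j, (X j : MvPowerSeries (Fin n) R) ^ k j) =
      ∏ j, ((k j).descFactorial (m j) : MvPowerSeries (Fin n) R) * X j ^ (k j - m j) := by
  classical
  ext e
  have e1 : ∏ j, ((k j).descFactorial (m j) : MvPowerSeries (Fin n) R) * X j ^ (k j - m j) =
      C (∏ j, ((k j).descFactorial (m j) : R)) * monomial (k - m) 1 := by
    rw [Finset.prod_mul_distrib, map_prod, ← prod_X_pow_eq]
    simp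
  rw [coeff_iterD_partialEnd, prod_X_pow_eq, e1, coeff_C_mul, coeff_monomial, coeff_monomial]
  by_cases hmk : m ≤ k
  · by_cases he : e = k - m
    · have h1 : e + m = k := by rw [he, tsub_add_cancel_of_le hmk]
      rw [if_pos h1, if_pos he]
      congr 1
      refine Finset.prod_congr rfl fun j _ => ?_
      rw [← h1, Finsupp.add_apply]
    · rw [if_neg, if_neg he, mul_zero, mul_zero]
      rintro rfl
      exact he (add_tsub_cancel_right _ _).symm
  · obtain ⟨j, hj⟩ : ∃ j, ¬ m j ≤ k j := by
      by_contra h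
      push Not at h
      exact hmk h
    have h0 : ∏ j, ((k j).descFactorial (m j) : R) = 0 := by
      refine Finset.prod_eq_zero (Finset.mem_univ j) ?_
      rw [Nat.descFactorial_eq_zero_iff_lt.2 (by omega), Nat.cast_zero]
    rw [h0, zero_mul, if_neg, mul_zero]
    rintro rfl
    exact hmk le_add_self

end Partial

/-! ### The (p, t)-adic filtration and Taylor expansion of monomials -/

section Adic

variable {p : ℕ} [Fact p.Prime] {κ : Type v} [Field κ] [CharP κ p] [PerfectRing κ p] {n : ℕ}

/-- `f` lies in the `k`-th power of the ideal `(p, t_1, …, t_n)`. -/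
def IsAdic (k : ℕ) (f : PS p κ n) : Prop :=
  ∀ d : Fin n →₀ ℕ, (p : WittVector p κ) ^ (k - d.degree) ∣ coeff d f

theorem IsAdic.mul {k l : ℕ} {f g : PS p κ n} (hf : IsAdic k f) (hg : IsAdic l g) :
    IsAdic (k + l) (f * g) := fun d => by
  classical
  rw [coeff_mul]
  refine Finset.dvd_sum fun x hx => ?_
  have h := degree_add_eq_of_eq (Finset.HasAntidiagonal.mem_antidiagonal.1 hx)
  refine (pow_dvd_pow _ ?_).trans ((pow_add (p : WittVector p κ) _ _).dvd.trans
    (mul_dvd_mul (hf x.1) (hg x.2)))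
  omega

theorem isAdic_zero (f : PS p κ n) : IsAdic 0 f := fun d => by simp

theorem IsAdic.pow {f : PS p κ n} (hf : IsAdic 1 f) (k : ℕ) : IsAdic k (f ^ k) := by
  induction k with
  | zero => exact isAdic_zero _
  | succ k ih => rw [pow_succ]; exact ih.mul hf

theorem IsAdic.prod_pow {f : Fin n → PS p κ n} (hf : ∀ j, IsAdic 1 (f j)) (m : Fin n →₀ ℕ) :
    IsAdic m.degree (∏ j, f j ^ m j) := by
  have key : ∀ s : Finset (Fin n), IsAdic (∑ j ∈ s, m j) (∏ j ∈ s, f j ^ m j) := by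
    classical
    intro s
    induction s using Finset.induction_on with
    | empty => exact isAdic_zero _
    | insert j s hj ih =>
      rw [Finset.sum_insert hj, Finset.prod_insert hj]
      exact ((hf j).pow _).mul ih
  rw [Finsupp.degree_eq_sum]
  exact key _

theorem isAdic_one_of_dvd {f : PS p κ n} (h : (p : PS p κ n) ∣ f) : IsAdic 1 f := fun d => by
  have h1 : (p : PS p κ n) ^ 1 ∣ f := by rwa [pow_one]
  have := natCast_pow_dvd_mvPowerSeries_iff.1 h1 d
  exact (pow_dvd_pow _ (Nat.sub_le _ _)).trans this

theorem isAdic_sub (φ ψ : FrobLift p κ n) (j : Fin n) :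
    IsAdic 1 (φ.toRingHom (X j) - ψ.toRingHom (X j)) :=
  isAdic_one_of_dvd (p_dvd_frobLift_sub φ ψ _)

theorem isAdic_frobLift_X (ψ : FrobLift p κ n) (j : Fin n) : IsAdic 1 (ψ.toRingHom (X j)) := by
  have h0 : IsAdic 1 (X j : PS p κ n) := fun d => by
    classical
    rw [coeff_X]
    split_ifs with h
    · rw [h, Finsupp.degree_single, Nat.sub_self, pow_zero]
    · exact dvd_zero _
  have h1 : IsAdic 1 ((X j : PS p κ n) ^ p) := fun d =>
    (pow_dvd_pow _ (Nat.sub_le_sub_right (Fact.out : p.Prime).one_lt.le _)).trans (h0.pow p d)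
  have h2 := isAdic_sub ψ (powLift p κ n) j
  rw [powLift_X] at h2
  intro d
  have h3 := dvd_add (h2 d) (h1 d)
  rwa [← map_add, sub_add_cancel] at h3

theorem prod_factorial_mul_taylorCoeff (φ ψ : FrobLift p κ n) (m : Fin n →₀ ℕ) :
    (∏ j, ((m j).factorial : PS p κ n)) * taylorCoeff φ ψ m =
      ∏ j, (φ.toRingHom (X j) - ψ.toRingHom (X j)) ^ m j := by
  rw [taylorCoeff, ← Finset.prod_mul_distrib]
  exact Finset.prod_congr rfl fun j _ => factorial_mul_dpow (p_dvd_frobLift_sub φ ψ _) _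

/-- The Taylor expansion of a monomial is finite. -/
theorem sum_taylorCoeff_mul_prod_X (φ : FrobLift p κ n) (k : Fin n →₀ ℕ) {S : Finset (Fin n →₀ ℕ)}
    (hS : ∀ m ≤ k, m ∈ S) :
    ∑ m ∈ S, taylorCoeff φ (powLift p κ n) m *
      (powLift p κ n).toRingHom (iterD (partialEnd (WittVector p κ)) m (∏ j, X j ^ k j)) =
      ∏ j, φ.toRingHom (X j) ^ k j := by
  classical
  have hterm : ∀ m : Fin n →₀ ℕ, taylorCoeff φ (powLift p κ n) m *
      (powLift p κ n).toRingHom (iterD (partialEnd (WittVector p κ)) m (∏ j, X j ^ k j)) =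
      ∏ j, ((φ.toRingHom (X j) - (powLift p κ n).toRingHom (X j)) ^ m j *
        (powLift p κ n).toRingHom (X j) ^ (k j - m j) * ((k j).choose (m j) : PS p κ n)) := by
    intro m
    rw [iterD_partialEnd_prod_X, map_prod, Finset.prod_mul_distrib, Finset.prod_mul_distrib,
      ← prod_factorial_mul_taylorCoeff]
    simp_rw [map_mul, map_natCast, map_pow, Nat.descFactorial_eq_factorial_mul_choose, Nat.cast_mul]
    rw [Finset.prod_mul_distrib, Finset.prod_mul_distrib]
    ring
  simp_rw [hterm]
  -- The binomial theorem for the sum of φ(t_j) - t_j^p and t_j^p. Expanding the product over j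
  -- gives the Taylor terms, and those with m not ≤ k vanish.
  have hpow : ∀ j, φ.toRingHom (X j) ^ k j = ∑ i ∈ Finset.range (k j + 1),
      ((φ.toRingHom (X j) - (powLift p κ n).toRingHom (X j)) ^ i *
        (powLift p κ n).toRingHom (X j) ^ (k j - i) * ((k j).choose i : PS p κ n)) := by
    intro j
    rw [← add_pow, sub_add_cancel]
  simp_rw [hpow]
  rw [Finset.prod_univ_sum]
  symm
  refine Finset.sum_of_injOn (fun x => Finsupp.equivFunOnFinite.symm x)
    (Finsupp.equivFunOnFinite.symm.injective.injOn) (fun x hx => ?_) (fun m _ hm => ?_)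
    (fun x _ => rfl)
  · refine hS _ fun j => ?_
    have := Fintype.mem_piFinset.1 hx j
    rw [Finset.mem_range] at this
    exact Nat.lt_succ_iff.1 this
  · obtain ⟨j, hj⟩ : ∃ j, k j < m j := by
      by_contra h
      push Not at h
      refine hm ⟨m, ?_, by ext j; rfl⟩
      exact Fintype.mem_piFinset.2 fun j => Finset.mem_range.2 (Nat.lt_succ_iff.2 (h j))
    refine Finset.prod_eq_zero (Finset.mem_univ j) ?_
    rw [Nat.choose_eq_zero_of_lt hj, Nat.cast_zero, mul_zero]

end Adic

/-! ### Evaluating series of logarithmic growth at a lift of Frobenius -/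

section FrobValue

variable {p : ℕ} [Fact p.Prime] {κ : Type v} [Field κ] [CharP κ p] [PerfectRing κ p] {n : ℕ}

/-- With k = log_p M + 1 this says that M eventually exceeds a linear function of log_p M. It is
proved from (l/2 + 1)² ≤ p^l for l = log_p M. -/
theorem exists_log_bound (hp : 1 < p) (N c : ℕ) :
    ∃ B, ∀ M > B, ∃ k, M < p ^ k ∧ c + N * k ≤ M := by
  refine ⟨p ^ (2 * (2 * N + c)), fun M hM => ⟨Nat.log p M + 1, Nat.lt_pow_succ_log_self hp M, ?_⟩⟩
  have h0 : M ≠ 0 := by omega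
  have h1 : 2 * (2 * N + c) ≤ Nat.log p M := Nat.le_log_of_pow_le hp hM.le
  refine le_trans ?_ (Nat.pow_log_le_self p h0)
  generalize Nat.log p M = k at h1
  have h2 : (k / 2 + 1) ^ 2 ≤ p ^ k := by
    calc (k / 2 + 1) ^ 2 ≤ (2 ^ (k / 2)) ^ 2 := Nat.pow_le_pow_left Nat.lt_two_pow_self 2
      _ = 2 ^ (k / 2 * 2) := (pow_mul _ _ _).symm
      _ ≤ 2 ^ k := Nat.pow_le_pow_right (by norm_num) (Nat.div_mul_le_self k 2)
      _ ≤ p ^ k := Nat.pow_le_pow_left hp k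
  refine le_trans ?_ h2
  have h3 : k + 1 ≤ 2 * (k / 2 + 1) := by omega
  have h4 : 2 * N + c ≤ k / 2 + 1 := by omega
  calc c + N * (k + 1) ≤ c * (k / 2 + 1) + N * (2 * (k / 2 + 1)) :=
        add_le_add (Nat.le_mul_of_pos_right _ (by omega)) (Nat.mul_le_mul_left _ h3)
    _ = (2 * N + c) * (k / 2 + 1) := by ring
    _ ≤ (k / 2 + 1) ^ 2 := by rw [sq]; exact Nat.mul_le_mul_right _ h4

/-- ψ(t)^m lies in (p, t)^|m|, so its coefficient at d is divisible by p^(|m| - |d|). This outweighs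
the denominator p^(N k). -/
theorem coeff_frobValue_term_mem {f : KPS p κ n} {N : ℕ} (hf : LogGrowth N f) (ψ : FrobLift p κ n)
    (d m : Fin n →₀ ℕ) {k r : ℕ} (h1 : m.degree < p ^ k) (h2 : d.degree + r + N * k ≤ m.degree) :
    coeff d (C (fracFrob p κ (coeff m f)) * toKPS (∏ j, ψ.toRingHom (X j) ^ m j)) ∈
      intBall p κ r := by
  rw [coeff_C_mul, coeff_toKPS]
  apply mem_intBall_of_pow_mul (s := N * k)
  rw [← mul_assoc]
  have h3 := fracFrob_mem_intBall (hf k m h1)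
  rw [map_mul, map_pow, map_natCast] at h3
  exact intBall_anti (by omega) (mul_mem_intBall h3
    (algebraMap_mem_intBall (IsAdic.prod_pow (isAdic_frobLift_X ψ) m d)))

/-- The bound is uniform in m. The m! in the derivatives cancels the denominators of the divided
powers, leaving (ψ(t) - t^p)^m in (p, t)^|m|. If |m| is small, then e must be large, and p • e
contributes to the degree of d. -/
theorem coeff_taylor_term_mem {f : KPS p κ n} {N : ℕ} (hf : LogGrowth N f) (ψ : FrobLift p κ n)
    (d : Fin n →₀ ℕ) {B r : ℕ} (hB : ∀ M > B, ∃ k, M < p ^ k ∧ d.degree + r + N * k ≤ M)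
    (hfB : ∀ m : Fin n →₀ ℕ, m.degree ≤ B → coeff m f = 0) (m : Fin n →₀ ℕ) :
    coeff d (toKPS (taylorCoeff ψ (powLift p κ n) m) *
      fracExpand p κ n (iterD (partialEnd (KK p κ)) m f)) ∈ intBall p κ r := by
  refine coeff_mul_mem_intBall fun d₁ d₂ hd => ?_
  by_cases hd2 : ∃ e, d₂ = p • e
  · obtain ⟨e, rfl⟩ := hd2
    rw [coeff_frobExpand_smul, coeff_iterD_partialEnd]
    by_cases hem : (e + m).degree ≤ B
    · rw [hfB _ hem, mul_zero, map_zero, mul_zero]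
      exact zero_mem _
    obtain ⟨k, hk1, hk2⟩ := hB _ (not_le.1 hem)
    apply mem_intBall_of_pow_mul (s := N * k)
    have e1 : (p : KK p κ) ^ (N * k) * (coeff d₁ (toKPS (taylorCoeff ψ (powLift p κ n) m)) *
        fracFrob p κ ((∏ j, ((e j + m j).descFactorial (m j) : KK p κ)) * coeff (e + m) f)) =
        algebraMap (WittVector p κ) (KK p κ)
          (coeff d₁ (∏ j, (ψ.toRingHom (X j) - (powLift p κ n).toRingHom (X j)) ^ m j)) *
          ((∏ j, (e j + m j).choose (m j) : ℕ) *
            fracFrob p κ ((p : KK p κ) ^ (N * k) * coeff (e + m) f)) := by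
      have e0 : (∏ j, ((m j).factorial : PS p κ n)) =
          C ((∏ j, (m j).factorial : ℕ) : WittVector p κ) := by
        rw [map_natCast, Nat.cast_prod]
      rw [← prod_factorial_mul_taylorCoeff, e0, coeff_C_mul, coeff_toKPS, ← Nat.cast_prod]
      simp_rw [Nat.descFactorial_eq_factorial_mul_choose]
      rw [Finset.prod_mul_distrib]
      simp only [map_mul, map_pow, map_natCast, Nat.cast_mul]
      ring
    rw [e1]
    have h3 := degree_add_eq_of_eq hd
    rw [map_nsmul, smul_eq_mul] at h3
    have h4 : e.degree ≤ p * e.degree := Nat.le_mul_of_pos_left _ (Fact.out : p.Prime).pos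
    rw [map_add] at hk2
    exact intBall_anti (by omega) (mul_mem_intBall
      (algebraMap_mem_intBall (IsAdic.prod_pow (isAdic_sub ψ (powLift p κ n)) m d₁))
      (mul_mem_intBall (natCast_mem_intBall _) (fracFrob_mem_intBall (hf k _ hk1))))
  · push Not at hd2
    rw [coeff_frobExpand_eq_zero _ _ _ hd2, mul_zero]
    exact zero_mem _

theorem sum_taylor_monomial (ψ : FrobLift p κ n) (c : KK p κ) (k : Fin n →₀ ℕ)
    {S : Finset (Fin n →₀ ℕ)} (hS : ∀ m ≤ k, m ∈ S) :
    ∑ m ∈ S, toKPS (taylorCoeff ψ (powLift p κ n) m) *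
      fracExpand p κ n (iterD (partialEnd (KK p κ)) m (C c * toKPS (∏ j, X j ^ k j))) =
      C (fracFrob p κ c) * toKPS (∏ j, ψ.toRingHom (X j) ^ k j) := by
  rw [← sum_taylorCoeff_mul_prod_X ψ k hS, map_sum, Finset.mul_sum]
  refine Finset.sum_congr rfl fun m _ => ?_
  have h1 := iterD_map (AddMonoidHom.mulLeft (C c : KPS p κ n)) (partialEnd (KK p κ))
    (partialEnd (KK p κ)) (fun j x => by
      change C c * pderiv (KK p κ) j x = pderiv (KK p κ) j (C c * x)
      rw [Derivation.leibniz, pderiv_C, smul_zero, add_zero, smul_eq_mul]) m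
      (toKPS (∏ j, X j ^ k j))
  have h2 := iterD_map (toKPS : PS p κ n →+* KPS p κ n).toAddMonoidHom
    (partialEnd (WittVector p κ)) (partialEnd (KK p κ)) (fun j x => (pderiv_toKPS x j).symm) m
    (∏ j, X j ^ k j)
  change C c * iterD _ m _ = iterD _ m (C c * _) at h1
  change toKPS (iterD (partialEnd (WittVector p κ)) m (∏ j, X j ^ k j)) =
    iterD (partialEnd (KK p κ)) m (toKPS (∏ j, X j ^ k j)) at h2
  rw [← h1, ← h2, map_mul (fracExpand p κ n), ← toKPS_powLift, frobExpand_C, map_mul toKPS]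
  ring

/-- A power series of logarithmic growth can be evaluated by its Taylor expansion. -/
theorem isFrobValue_of_taylor {f g : KPS p κ n} {N : ℕ} (hf : LogGrowth N f) (ψ : FrobLift p κ n)
    (h : ∀ (d : Fin n →₀ ℕ) (r : ℕ), ∃ S₀ : Finset (Fin n →₀ ℕ), ∀ S : Finset (Fin n →₀ ℕ),
      S₀ ⊆ S → coeff d (g - ∑ m ∈ S, toKPS (taylorCoeff ψ (powLift p κ n) m) *
        fracExpand p κ n (iterD (partialEnd (KK p κ)) m f)) ∈ intBall p κ r) :
    IsFrobValue ψ f g := by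
  classical
  intro d r
  obtain ⟨S₁, hS₁⟩ := h d r
  obtain ⟨B, hB⟩ := exists_log_bound (Fact.out : p.Prime).one_lt N (d.degree + r)
  let SB : Finset (Fin n →₀ ℕ) := (Finsupp.finite_of_degree_le (σ := Fin n) B).toFinset
  have hSB : ∀ m, m ∈ SB ↔ m.degree ≤ B := fun m => by simp [SB]
  let fB : KPS p κ n := ∑ k ∈ SB, C (coeff k f) * toKPS (∏ j, X j ^ k j)
  have hfB : ∀ m, coeff m fB = if m.degree ≤ B then coeff m f else 0 := by
    intro m
    simp only [fB]
    rw [map_sum]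
    have : ∀ k ∈ SB, coeff m (C (coeff k f) * toKPS (∏ j, X j ^ k j)) =
        if m = k then coeff k f else 0 := by
      intro k _
      rw [coeff_C_mul, coeff_toKPS, prod_X_pow_eq, coeff_monomial]
      split_ifs <;> simp
    rw [Finset.sum_congr rfl this, Finset.sum_ite_eq]
    simp only [hSB]
  have hf' : LogGrowth N (f - fB) := by
    intro k m hm
    rw [map_sub, hfB]
    split_ifs
    · rw [sub_self, mul_zero]; exact zero_mem _
    · rw [sub_zero]; exact hf k m hm
  refine ⟨SB, fun S hS => ?_⟩
  let tay : (Fin n →₀ ℕ) → KPS p κ n → KPS p κ n := fun m x =>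
    toKPS (taylorCoeff ψ (powLift p κ n) m) *
        fracExpand p κ n (iterD (partialEnd (KK p κ)) m x)
  let term : (Fin n →₀ ℕ) → KPS p κ n := fun m =>
    C (fracFrob p κ (coeff m f)) * toKPS (∏ j, ψ.toRingHom (X j) ^ m j)
  have htay_sub : ∀ m x y, tay m (x - y) = tay m x - tay m y := by
    intro m x y
    simp only [tay]
    rw [map_sub, map_sub, mul_sub]
  have htay_sum : ∀ m (F : (Fin n →₀ ℕ) → KPS p κ n), tay m (∑ k ∈ SB, F k) = ∑ k ∈ SB, tay m (F k) := by
    intro m F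
    simp only [tay]
    rw [map_sum, map_sum, Finset.mul_sum]
  have hpoly : ∑ m ∈ S₁ ∪ SB, tay m fB = ∑ k ∈ SB, term k := by
    simp only [fB, htay_sum]
    rw [Finset.sum_comm]
    refine Finset.sum_congr rfl fun k hk => sum_taylor_monomial ψ _ k fun m hm => ?_
    exact Finset.mem_union_right _ ((hSB m).2 ((Finsupp.degree_mono hm).trans ((hSB k).1 hk)))
  -- For the truncation fB the Taylor sum equals the substitution exactly. So the error consists of
  -- the Taylor remainder of g, the Taylor terms of the tail of f, and the substituted terms of
  -- large degree, each lying in p^r W.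
  have hsplit : g - ∑ m ∈ S, term m = (g - ∑ m ∈ S₁ ∪ SB, tay m f) +
      ∑ m ∈ S₁ ∪ SB, tay m (f - fB) - ∑ m ∈ S \ SB, term m := by
    simp only [htay_sub]
    rw [Finset.sum_sub_distrib, hpoly, ← Finset.sum_sdiff hS]
    ring
  change coeff d (g - ∑ m ∈ S, term m) ∈ intBall p κ r
  rw [hsplit, map_sub, map_add, map_sum, map_sum]
  refine Submodule.sub_mem _ (Submodule.add_mem _ (hS₁ _ Finset.subset_union_left)
    (Submodule.sum_mem _ fun m _ => coeff_taylor_term_mem hf' ψ d hB (fun m hm => ?_) m))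
    (Submodule.sum_mem _ fun m hm => ?_)
  · rw [map_sub, hfB, if_pos hm, sub_self]
  · rw [Finset.mem_sdiff, hSB, not_le] at hm
    obtain ⟨k, hk1, hk2⟩ := hB _ hm.2
    exact coeff_frobValue_term_mem hf ψ d m hk1 hk2

end FrobValue

/-! ### Comparison with the Taylor formula and assembly of the trivialization -/

section Summary

variable {p : ℕ} [Fact p.Prime] {κ : Type v} [Field κ] [CharP κ p] [PerfectRing κ p] {n : ℕ}
  {H : Type u} [AddCommGroup H] [Module (PS p κ n) H]

/-- A common element has zero reduction, and by saturation its quotient by p is again common. So it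
is infinitely divisible by p. -/
theorem FCrystal.Lifts.disjoint [Module.Free (PS p κ n) H] [Module.Finite (PS p κ n) H]
    {S S' : Submodule (PS p κ n) H} {S₀ S₀' : Submodule (PS0 p κ n) (Red p κ n H)}
    (h : FCrystal.Lifts S S₀) (h' : FCrystal.Lifts S' S₀') (hd : Disjoint S₀ S₀') :
    Disjoint S S' := by
  have hp : ∀ x, x ∈ S → x ∈ S' → ∃ y, y ∈ S ∧ y ∈ S' ∧ x = p • y := by
    intro x hx hx'
    have h0 : red p κ n H x = 0 := by
      rw [Submodule.disjoint_def] at hd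
      exact hd _ (h.2 ▸ ⟨x, hx, rfl⟩) (h'.2 ▸ ⟨x, hx', rfl⟩)
    obtain ⟨y, rfl⟩ := (red_eq_zero_iff x).1 h0
    exact ⟨y, h.1 y hx, h'.1 y hx', rfl⟩
  rw [Submodule.disjoint_def]
  intro x hx hx'
  have hk : ∀ k : ℕ, ∃ y, y ∈ S ∧ y ∈ S' ∧ x = p ^ k • y := by
    intro k
    induction k with
    | zero => exact ⟨x, hx, hx', by rw [pow_zero, one_smul]⟩
    | succ k ih =>
      obtain ⟨y, hy, hy', rfl⟩ := ih
      obtain ⟨z, hz, hz', rfl⟩ := hp y hy hy'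
      exact ⟨z, hz, hz', by rw [pow_succ, mul_smul]⟩
  exact eq_zero_of_forall_eq_nsmul (p := p) (κ := κ) (n := n) fun k => (hk k).imp fun y hy => hy.2.2

variable {ι : Type} [Fintype ι] [DecidableEq ι]
  {e : Module.Basis ι (PS p κ n) H} {deg : ι → ℕ} {Cr : FCrystal p κ n H}
  {r : Matrix ι ι (PS p κ n)}

/-- The row form turns D_j into ∂_j and F into p^(deg a) φ, so it carries the Taylor formula of the
crystal to that of the power series. -/
theorem IsNormalBasis.isFrobValue {T : Matrix ι ι (KPS p κ n)} {N : ℕ} {a : ι}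
    (hT : ∀ a b, LogGrowth N (T a b))
    (hF : ∀ x, rowForm e T a (Cr.frob (powLift p κ n) x) =
      (p : KPS p κ n) ^ deg a * fracExpand p κ n (rowForm e T a x)) (ψ : FrobLift p κ n) (x : H) :
    IsFrobValue ψ (rowForm e T a x) (C ((p : KK p κ) ^ deg a)⁻¹ * rowForm e T a (Cr.frob ψ x)) := by
  have hpK := p_ne_zero_KK (p := p) (κ := κ)
  refine isFrobValue_of_taylor (logGrowth_rowForm e hT a x) ψ fun d r => ?_
  obtain ⟨k, hk⟩ : ∃ k, d.degree < p ^ k := ⟨_, Nat.lt_pow_self (Fact.out : p.Prime).one_lt⟩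
  -- The precision pays for the division by p^(deg a) and for the denominator p^(N k) of the row
  -- form at exponents of degree < p^k, leaving p^r.
  obtain ⟨S₀, hS₀⟩ := Cr.taylor ψ (powLift p κ n) x (deg a + (N * k + r))
  refine ⟨S₀, fun S hS => ?_⟩
  obtain ⟨h, hh⟩ := hS₀ S hS
  have hterm : ∀ m, rowForm e T a (taylorCoeff ψ (powLift p κ n) m •
      Cr.frob (powLift p κ n) (iterD Cr.D m x)) = C ((p : KK p κ) ^ deg a) *
        (toKPS (taylorCoeff ψ (powLift p κ n) m) *
          fracExpand p κ n (iterD (partialEnd (KK p κ)) m (rowForm e T a x))) := by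
    intro m
    have h1 := iterD_map (rowForm e T a : H →ₛₗ[_] KPS p κ n).toAddMonoidHom Cr.D
      (partialEnd (KK p κ)) (fun j x => Cr.rowForm_D hF j x) m x
    change rowForm e T a (iterD Cr.D m x) = iterD _ m (rowForm e T a x) at h1
    rw [LinearMap.map_smulₛₗ, smul_eq_mul, hF, h1, map_pow, map_natCast]
    ring
  have h2 := congrArg (rowForm e T a) hh
  rw [map_sub, map_sum, map_nsmul] at h2
  change rowForm e T a (Cr.frob ψ x) - ∑ m ∈ S, rowForm e T a (taylorCoeff ψ (powLift p κ n) m •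
      Cr.frob (powLift p κ n) (iterD Cr.D m x)) = _ at h2
  rw [Finset.sum_congr rfl fun m _ => hterm m, ← Finset.mul_sum, sub_eq_iff_eq_add] at h2
  have h3 : C ((p : KK p κ) ^ deg a)⁻¹ * rowForm e T a (Cr.frob ψ x) -
      ∑ m ∈ S, toKPS (taylorCoeff ψ (powLift p κ n) m) *
        fracExpand p κ n (iterD (partialEnd (KK p κ)) m (rowForm e T a x)) =
      C ((p : KK p κ) ^ (N * k + r)) * rowForm e T a h := by
    rw [h2, mul_add, ← mul_assoc (C _) (C _), ← map_mul, inv_mul_cancel₀ (pow_ne_zero _ hpK),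
      map_one, one_mul, add_sub_cancel_right, nsmul_eq_mul, Nat.cast_pow, pow_add,
      ← map_natCast (C (σ := Fin n) (R := KK p κ)), ← map_pow, ← map_pow, ← mul_assoc, ← mul_assoc,
      ← map_mul, inv_mul_cancel₀ (pow_ne_zero _ hpK), map_one, one_mul]
  rw [h3, coeff_C_mul, pow_add, mul_comm ((p : KK p κ) ^ (N * k)), mul_assoc]
  exact mul_mem_intBall (s := 0) (pow_mem_intBall r) (logGrowth_rowForm e hT a h k d hk)

/-- The trivialization of the connection by a matrix with entries in `K[[t_1, …, t_n]]`. -/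
theorem IsNormalBasis.exists_trivialization (hr : IsNormalBasis e deg Cr r) :
    ∃ T : Matrix ι ι (KPS p κ n), IsUnitriangular deg T ∧
      (∀ a b, deg a ≤ deg b → ∃ w : WittVector p κ, constantCoeff (T a b) =
        algebraMap (WittVector p κ) (KK p κ) ((p : WittVector p κ) ^ (deg b - deg a) * w)) ∧
      (∀ j, (Cr.connMatrix e j).map toKPS = T⁻¹ * T.map (pderiv (KK p κ) j)) ∧
      ∀ ψ : FrobLift p κ n, ∃ Tψ : Matrix ι ι (KPS p κ n),
        (∀ a b, IsFrobValue ψ (T a b) (Tψ a b)) ∧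
        (Cr.frobMatrix e ψ).map toKPS =
          T⁻¹ * Matrix.diagonal (fun a => (p : KPS p κ n) ^ deg a) * Tψ := by
  have hpK := p_ne_zero_KK (p := p) (κ := κ)
  obtain ⟨T, hT1, hT2, hT3, hT4⟩ :=
    exists_frobenius_trivialization r hr.isUnitriangular
  have hF := fun a => hr.rowForm_frob hT4 a
  have hlog := logGrowth_of_frobenius_eq
    (fun a => Finset.le_sup (f := deg) (Finset.mem_univ a)) hT3 hT4
  have hT : T⁻¹ * T = 1 := T.nonsing_inv_mul hT1.isUnit_det
  have hcancel : ∀ A B : Matrix ι ι (KPS p κ n), T * A = B → A = T⁻¹ * B := by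
    rintro A _ rfl
    rw [← Matrix.mul_assoc, hT, Matrix.one_mul]
  refine ⟨T, hT1, hT2, fun j => hcancel _ _ ?_, fun ψ =>
    ⟨Matrix.of fun a b => C ((p : KK p κ) ^ deg a)⁻¹ * rowForm e T a (Cr.frob ψ (e b)),
      fun a b => ?_, ?_⟩⟩
  · ext1 a b
    rw [Matrix.mul_apply, Matrix.map_apply, ← rowForm_basis e T a b, ← Cr.rowForm_D (hF a)]
    rfl
  · have := IsNormalBasis.isFrobValue hlog (hF a) ψ (e b)
    rwa [rowForm_basis] at this
  · rw [Matrix.mul_assoc]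
    refine hcancel _ _ ?_
    ext1 a b
    rw [Matrix.diagonal_mul, Matrix.of_apply, ← mul_assoc,
      ← map_natCast (C (σ := Fin n) (R := KK p κ)), ← map_pow, ← map_mul,
      mul_inv_cancel₀ (pow_ne_zero _ hpK), map_one, one_mul, Matrix.mul_apply]
    rfl

end Summary

end OrdinaryCrystal

end

/-! ### The main theorem -/

theorem theorem1p6 {p : ℕ} [Fact p.Prime] {κ : Type*} [Field κ] [CharP κ p] [IsAlgClosed κ]
    {n N : ℕ} (hN : N < p)
    {H : Type*} [AddCommGroup H] [Module (OrdinaryCrystal.PS p κ n) H]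
    (Cr : OrdinaryCrystal.FCrystal p κ n H) (φ : OrdinaryCrystal.FrobLift p κ n)
    (Fil : ℕ → Submodule (OrdinaryCrystal.PS p κ n) H)
    (hFil : Cr.IsHodgeFiltration φ Fil) (hdiv : Cr.IsDivisible Fil N)
    (hord : Cr.IsOrdinary φ) (hlev : Cr.LevelLE φ N) :
    (∃! U : ℕ → Submodule (OrdinaryCrystal.PS p κ n) H, Cr.IsUnitRootFiltration φ U) ∧
    ∀ U : ℕ → Submodule (OrdinaryCrystal.PS p κ n) H, Cr.IsUnitRootFiltration φ U →
      DirectSum.IsInternal (fun i : Fin (N + 1) => U i ⊓ Fil i) ∧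
      ∃ (e : Module.Basis (Σ i : Fin (N + 1), Fin (Cr.hodgeNumber φ i))
          (OrdinaryCrystal.PS p κ n) H)
        (T : Matrix (Σ i : Fin (N + 1), Fin (Cr.hodgeNumber φ i))
          (Σ i : Fin (N + 1), Fin (Cr.hodgeNumber φ i)) (OrdinaryCrystal.KPS p κ n)),
        (∀ a, e a ∈ U a.1 ⊓ Fil a.1) ∧
        (∀ a b, b.1 < a.1 → T a b = 0) ∧
        (∀ a b, a.1 = b.1 → T a b = if a = b then 1 else 0) ∧
        (∀ a b, a.1 ≤ b.1 → ∃ w : WittVector p κ,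
          MvPowerSeries.constantCoeff (T a b) =
            algebraMap (WittVector p κ) (OrdinaryCrystal.KK p κ)
              ((p : WittVector p κ) ^ ((b.1 : ℕ) - (a.1 : ℕ)) * w)) ∧
        (∀ j : Fin n, (Cr.connMatrix e j).map OrdinaryCrystal.toKPS =
          T⁻¹ * T.map (MvPowerSeries.pderiv (OrdinaryCrystal.KK p κ) j)) ∧
        ∀ ψ : OrdinaryCrystal.FrobLift p κ n,
          ∃ Tψ : Matrix (Σ i : Fin (N + 1), Fin (Cr.hodgeNumber φ i))
            (Σ i : Fin (N + 1), Fin (Cr.hodgeNumber φ i)) (OrdinaryCrystal.KPS p κ n),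
            (∀ a b, OrdinaryCrystal.IsFrobValue ψ (T a b) (Tψ a b)) ∧
            (Cr.frobMatrix e ψ).map OrdinaryCrystal.toKPS =
              T⁻¹ * Matrix.diagonal (fun a => (p : OrdinaryCrystal.KPS p κ n) ^ (a.1 : ℕ)) *
                Tψ := by
  have := Cr.free
  have := Cr.finite
  obtain ⟨e, r, heFil, hr1, hr2, hr3⟩ := Cr.exists_unitriangular_basis hN hFil hdiv hord hlev
  let deg : (Σ i : Fin (N + 1), Fin (Cr.hodgeNumber φ i)) → ℕ := fun a => a.1
  have hr : OrdinaryCrystal.IsNormalBasis e deg Cr r :=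
    { lower := hr1
      diag_self := fun a => by rw [hr2 a a rfl, if_pos rfl]
      diag_ne := fun a b hab h => by rw [hr2 a b (Fin.ext h), if_neg hab]
      frob := hr3 }
  have hU : Cr.IsUnitRootFiltration φ (fun i => OrdinaryCrystal.lowU e deg (i + 1)) :=
    hr.isUnitRootFiltration φ
  refine ⟨⟨_, hU, fun U' hU' => funext fun i => hr.eq_of_isUnitRootFiltration hU' i⟩,
    fun U' hU' => ?_⟩
  obtain rfl : U' = fun i => OrdinaryCrystal.lowU e deg (i + 1) :=
    funext fun i => hr.eq_of_isUnitRootFiltration hU' i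
  have heU : ∀ a : (Σ i : Fin (N + 1), Fin (Cr.hodgeNumber φ i)),
      e a ∈ OrdinaryCrystal.lowU e deg (a.1 + 1) ⊓ Fil a.1 := fun a =>
    ⟨OrdinaryCrystal.basis_mem_lowU e deg (Nat.lt_succ_self _), heFil a⟩
  obtain ⟨T, hT1, hT2, hT3, hT4⟩ := hr.exists_trivialization
  refine ⟨?_, e, T, heU, fun a b hab => ?_, fun a b hab => ?_, fun a b hab => hT2 a b hab, hT3, hT4⟩
  · rw [DirectSum.isInternal_submodule_iff_iSupIndep_and_iSup_eq_top]
    -- Independence is inherited from the opposite filtrations modulo p, and generation is clear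
    -- because every basis vector lies in one of the summands.
    refine ⟨OrdinaryCrystal.iSupIndep_of_opposite hU.mono hFil.anti
      (fun i => (hU.lifts i).disjoint (hFil.lifts (i + 1)) (hord.2 i).disjoint)
      (fun _ => inf_le_left) (fun _ => inf_le_right), ?_⟩
    rw [eq_top_iff, ← e.span_eq, Submodule.span_le]
    rintro _ ⟨a, rfl⟩
    exact Submodule.mem_iSup_of_mem a.1 (heU a)
  · rw [hT1 a b (show (b.1 : ℕ) ≤ a.1 from hab.le), Matrix.one_apply_ne]
    rintro rfl
    exact lt_irrefl _ hab
  · rw [hT1 a b (show (b.1 : ℕ) ≤ a.1 by rw [hab]), Matrix.one_apply]
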